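/- Let $k$ be a field and let $A$ be a left and right noetherian $k$-algebra with a connected $\mathbb N^r$-grading, $r\ge 0$; that is, $A=\bigoplus_{g\in\mathbb Z^r}A_g$ is a $\mathbb Z^r$-graded algebra with $A_g=0$ for $g\notin\mathbb N^r$ and $A_0=k$. Let $A^e=A\otimes_k A^{\mathrm{op}}$ with the induced $\mathbb Z^r$-grading. For a complex $M^\bullet$ of objects of an abelian category, $\operatorname{injdim} M^\bullet$ denotes the infimum in $\mathbb Z\cup\{\pm\infty\}$ of the integers $n$ such that there is a quasi-isomorphism $M^\bullet\to I^\bullet$ to a left bounded complex of injective objects with $I^i=0$ for all $i>n$; write $\operatorname{injdim}_A^{\mathbb Z^r}$ for the category of $\mathbb Z^r$-graded left $A$-modules (with degree preserving homomorphisms) and $\operatorname{injdim}_A$ for the category of all left $A$-modules. A $\mathbb Z^r$-graded dualizing complex over $A$ is a bounded complex $R^\bullet$ of $\mathbb Z^r$-graded $A^e$-modules such that (i) the cohomology modules of $R^\bullet$ are finitely generated over $A$ and over $A^{\mathrm{op}}$; (ii) $R^\bullet$ has finite injective dimension as a complex of graded $A$-modules and as a complex of graded $A^{\mathrm{op}}$-modules;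 (iii) the natural maps $A^{\mathrm{op}}\to \mathrm R\mathrm{HOM}_A^{\mathbb Z^r}(R^\bullet,R^\bullet)$ and $A\to \mathrm R\mathrm{HOM}_{A^{\mathrm{op}}}^{\mathbb Z^r}(R^\bullet,R^\bullet)$, given by right and left multiplication, are isomorphisms in the derived category of graded $A^e$-modules, where $\mathrm{HOM}_A^{\mathbb Z^r}(M,N)=\bigoplus_{g}\operatorname{Hom}_A(M,N)_g$ is the sum of the spaces of $A$-linear maps that are homogeneous of degree $g$. A dualizing complex in the ungraded sense is defined in the same way with all gradings omitted. For a group morphism $\phi:\mathbb Z^r\to\mathbb Z^s$ and a $\mathbb Z^r$-graded module $M$, let $\phi_!(M)$ be the same module with the $\mathbb Z^s$-grading $\phi_!(M)_h=\bigoplus_{\phi(g)=h}M_g$; in the same way $\phi_!(A)$ is $A$ regarded as a $\mathbb Z^s$-graded algebra. Theorem. Let $R^\bullet$ be a $\mathbb Z^r$-graded dualizing complex over $A$. (1) If $s\ge 0$ and $\phi:\mathbb Z^r\to\mathbb Z^s$ is a group morphism such that $\phi_!(A)$ is connected $\mathbb N^s$-graded, then $\phi_!(R^\bullet)$ is a $\mathbb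 Z^s$-graded dualizing complex over $\phi_!(A)$, and $\operatorname{injdim}_{A}^{\mathbb Z^s}\phi_!(R^\bullet)=\operatorname{injdim}_A^{\mathbb Z^r}R^\bullet$. (2) The complex of $A^e$-modules underlying $R^\bullet$ is a dualizing complex over $A$ in the ungraded sense, and $\operatorname{injdim}_A R^\bullet\le \operatorname{injdim}_A^{\mathbb Z^r}R^\bullet+1$. -/

import Mathlib

universe u v w

noncomputable section

open CategoryTheory CategoryTheory.Limits
open scoped TensorProduct DirectSum

section Internal

variable {G : Type w} [DecidableEq G] {M : Type u} [AddCommGroup M]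
  {σ : Type*} [SetLike σ M] [AddSubmonoidClass σ M]

theorem isInternal_of_proj (gr : G → σ) (p : G → M →+ M)
    (h1 : ∀ g, ∀ x ∈ gr g, p g x = x) (h2 : ∀ g h, g ≠ h → ∀ x ∈ gr g, p h x = 0)
    (h3 : ∀ x : M, x ∈ AddSubmonoid.closure (⋃ g, (gr g : Set M))) :
    DirectSum.IsInternal gr := by
  have key : ∀ (y : ⨁ g, gr g) (h : G), p h (DirectSum.coeAddMonoidHom gr y) = y h := by
    intro y h
    induction y using DirectSum.induction_on with
    | zero => simp
    | of g x =>
      rw [DirectSum.coeAddMonoidHom_of]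
      by_cases hgh : g = h
      · subst hgh
        rw [DirectSum.of_eq_same]
        exact h1 _ _ x.2
      · rw [DirectSum.of_eq_of_ne _ _ _ (Ne.symm hgh)]
        exact h2 _ _ hgh _ x.2
    | add x y hx hy => simp [hx, hy]
  constructor
  · intro x y hxy
    ext h
    rw [← key x h, ← key y h, hxy]
  · intro x
    rw [← AddMonoidHom.mem_mrange]
    refine (AddSubmonoid.closure_le (S := AddMonoidHom.mrange _)).2 ?_ (h3 x)
    intro y hy
    obtain ⟨g, hg⟩ := Set.mem_iUnion.1 hy
    exact ⟨DirectSum.of (fun g => gr g) g ⟨y, hg⟩, DirectSum.coeAddMonoidHom_of gr g ⟨y, hg⟩⟩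

/-- The projection onto the homogeneous component of degree `g`. -/
def internalProj {gr : G → σ} (hgr : DirectSum.IsInternal gr) (g : G) : M →+ M :=
  letI := hgr.chooseDecomposition
  (AddSubmonoidClass.subtype (gr g)).comp
    ((DFinsupp.evalAddMonoidHom g).comp (DirectSum.decomposeAddEquiv gr).toAddMonoidHom)

variable {gr : G → σ}

theorem internalProj_mem (hgr : DirectSum.IsInternal gr) (g : G) (x : M) :
    internalProj hgr g x ∈ gr g :=
  SetLike.coe_mem _

theorem internalProj_same (hgr : DirectSum.IsInternal gr) {g : G} {x : M} (hx : x ∈ gr g) :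
    internalProj hgr g x = x :=
  let _ := hgr.chooseDecomposition
  DirectSum.decompose_of_mem_same gr hx

theorem internalProj_ne (hgr : DirectSum.IsInternal gr) {g h : G} (hgh : g ≠ h) {x : M}
    (hx : x ∈ gr g) : internalProj hgr h x = 0 :=
  let _ := hgr.chooseDecomposition
  DirectSum.decompose_of_mem_ne gr hx hgh

theorem internal_induction (hgr : DirectSum.IsInternal gr) {p : M → Prop} (x : M) (zero : p 0)
    (homog : ∀ g, ∀ x ∈ gr g, p x) (add : ∀ x y, p x → p y → p (x + y)) : p x :=
  let _ := hgr.chooseDecomposition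
  DirectSum.Decomposition.inductionOn gr zero (fun m => homog _ m.1 m.2) add x

theorem internal_mem_closure (hgr : DirectSum.IsInternal gr) (x : M) :
    x ∈ AddSubmonoid.closure (⋃ g, (gr g : Set M)) :=
  internal_induction hgr x (zero_mem _)
    (fun g _ hx => AddSubmonoid.subset_closure (Set.mem_iUnion.2 ⟨g, hx⟩))
    (fun _ _ hx hy => add_mem hx hy)

theorem mem_closure_internalProj (hgr : DirectSum.IsInternal gr) (x : M) :
    x ∈ AddSubmonoid.closure (Set.range fun g => internalProj hgr g x) := by
  classical
  let _ := hgr.chooseDecomposition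
  have h : ∑ i ∈ (DirectSum.decompose gr x).support, (DirectSum.decompose gr x i : M) ∈
      AddSubmonoid.closure (Set.range fun g => internalProj hgr g x) :=
    sum_mem fun g _ => AddSubmonoid.subset_closure ⟨g, rfl⟩
  rwa [DirectSum.sum_support_decompose gr x] at h

theorem isInternal_push (hgr : DirectSum.IsInternal gr) {H : Type*} [DecidableEq H]
    {τ : Type*} [SetLike τ M]
    [AddSubmonoidClass τ M] (φ : G → H) (gr' : H → τ)
    (h1 : ∀ g, ∀ x ∈ gr g, x ∈ gr' (φ g))
    (h2 : ∀ h, ∀ x ∈ gr' h, x ∈ AddSubmonoid.closure (⋃ g : {g // φ g = h}, (gr g : Set M))) :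
    DirectSum.IsInternal gr' := by
  let _ := hgr.chooseDecomposition
  let p : H → M →+ M := fun h =>
    (DirectSum.toAddMonoid fun g =>
      if φ g = h then AddSubmonoidClass.subtype (gr g) else 0).comp
      (DirectSum.decomposeAddEquiv gr).toAddMonoidHom
  have hp : ∀ h g, ∀ x ∈ gr g, p h x = if φ g = h then x else 0 := by
    intro h g x hx
    change DirectSum.toAddMonoid _ (DirectSum.decompose gr x) = _
    rw [DirectSum.decompose_of_mem gr hx, DirectSum.toAddMonoid_of]
    split_ifs <;> simp
  refine isInternal_of_proj gr' p ?_ ?_ ?_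
  · intro h x hx
    refine (AddSubmonoid.closure_le (S := AddMonoidHom.eqLocusM (p h) (AddMonoidHom.id M))).2
      ?_ (h2 h x hx)
    intro x hx
    obtain ⟨⟨g, hg⟩, hx⟩ := Set.mem_iUnion.1 hx
    change p h x = x
    rw [hp h g x hx, if_pos hg]
  · intro h h' hh x hx
    refine (AddSubmonoid.closure_le (S := AddMonoidHom.eqLocusM (p h') 0)).2
      ?_ (h2 h x hx)
    intro x hx
    obtain ⟨⟨g, hg⟩, hx⟩ := Set.mem_iUnion.1 hx
    change p h' x = 0
    rw [hp h' g x hx, if_neg (by rw [hg]; exact hh)]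
  · intro x
    refine internal_induction hgr x (zero_mem _) ?_ (fun x y hx hy => add_mem hx hy)
    intro g x hx
    exact AddSubmonoid.subset_closure (Set.mem_iUnion.2 ⟨φ g, h1 g x hx⟩)

end Internal

section GradedModules

variable {k : Type v} [CommRing k] {G : Type w} [DecidableEq G] [AddCommGroup G]
  {B : Type u} [Ring B] [Algebra k B]

/-- The grading `φ_!(B)_h = ⨁_{φ g = h} B_g`. -/
def pushGrading {H : Type*} [AddCommGroup H] (φ : G →+ H) (ℬ : G → Submodule k B)
    (h : H) : Submodule k B :=
  ⨆ g : {g // φ g = h}, ℬ g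

/-- Graded (left) modules over an algebra `B` with homogeneous components `ℬ g`: a `B`-module
with a direct sum decomposition into subgroups `gr g`, such that `ℬ g • gr h ⊆ gr (g + h)`. -/
structure GrMod (ℬ : G → Submodule k B) where
  carrier : Type u
  [addCommGroup : AddCommGroup carrier]
  [module : Module B carrier]
  gr : G → AddSubgroup carrier
  isInternal : DirectSum.IsInternal gr
  smul_mem' : ∀ (g h : G) (b : B) (m : carrier), b ∈ ℬ g → m ∈ gr h → b • m ∈ gr (g + h)

namespace GrMod

variable {ℬ : G → Submodule k B}

instance : CoeSort (GrMod ℬ) (Type u) := ⟨GrMod.carrier⟩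

attribute [instance] GrMod.addCommGroup GrMod.module

/-- The group of degree preserving `B`-linear maps. -/
def homs (M N : GrMod ℬ) : AddSubgroup (M →ₗ[B] N) where
  carrier := {f | ∀ g, ∀ x ∈ M.gr g, f x ∈ N.gr g}
  add_mem' hf hf' g x hx := add_mem (hf g x hx) (hf' g x hx)
  zero_mem' _ _ _ := zero_mem _
  neg_mem' hf g x hx := neg_mem (hf g x hx)

instance : Category (GrMod ℬ) where
  Hom M N := homs M N
  id M := ⟨LinearMap.id, fun _ _ hx => hx⟩
  comp f f' := ⟨f'.1.comp f.1, fun g _ hx => f'.2 g _ (f.2 g _ hx)⟩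

/-- The linear map underlying a morphism of graded modules. -/
def lin {M N : GrMod ℬ} (f : M ⟶ N) : M →ₗ[B] N := f.1

/-- The morphism of graded modules given by a degree preserving linear map. -/
def ofLin {M N : GrMod ℬ} (f : M →ₗ[B] N) (hf : ∀ g, ∀ x ∈ M.gr g, f x ∈ N.gr g) : M ⟶ N :=
  ⟨f, hf⟩

theorem lin_mem {M N : GrMod ℬ} (f : M ⟶ N) {g : G} {x : M} (hx : x ∈ M.gr g) :
    lin f x ∈ N.gr g := f.2 g x hx

@[simp] theorem lin_ofLin {M N : GrMod ℬ} (f : M →ₗ[B] N)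
    (hf : ∀ g, ∀ x ∈ M.gr g, f x ∈ N.gr g) : lin (ofLin f hf) = f := rfl

@[simp] theorem lin_id (M : GrMod ℬ) : lin (𝟙 M) = LinearMap.id := rfl

@[simp] theorem lin_comp {M N P : GrMod ℬ} (f : M ⟶ N) (f' : N ⟶ P) :
    lin (f ≫ f') = (lin f').comp (lin f) := rfl

theorem hom_ext {M N : GrMod ℬ} {f f' : M ⟶ N} (h : lin f = lin f') : f = f' := Subtype.ext h

theorem hom_ext' {M N : GrMod ℬ} {f f' : M ⟶ N} (h : ∀ x, lin f x = lin f' x) : f = f' :=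
  hom_ext (LinearMap.ext h)

instance : Preadditive (GrMod ℬ) where
  homGroup M N := inferInstanceAs (AddCommGroup (homs M N))
  add_comp _ _ _ _ _ g := hom_ext' fun _ => map_add (lin g) _ _
  comp_add _ _ _ _ _ _ := rfl

@[simp] theorem lin_zero (M N : GrMod ℬ) : lin (0 : M ⟶ N) = 0 := rfl

@[simp] theorem lin_add {M N : GrMod ℬ} (f f' : M ⟶ N) : lin (f + f') = lin f + lin f' := rfl

theorem lin_proj {M N : GrMod ℬ} (f : M ⟶ N) (g : G) (x : M) :
    lin f (internalProj M.isInternal g x) = internalProj N.isInternal g (lin f x) := by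
  refine internal_induction (p := fun x => lin f (internalProj M.isInternal g x) =
    internalProj N.isInternal g (lin f x)) M.isInternal x (by simp) ?_
    (fun x y hx hy => by simp [hx, hy])
  intro h x hx
  by_cases hh : h = g
  · subst hh
    rw [internalProj_same _ hx, internalProj_same _ (lin_mem f hx)]
  · rw [internalProj_ne _ hh hx, internalProj_ne _ hh (lin_mem f hx), map_zero]

/-- The graded module on a submodule stable under the projections to the components. -/
def sub (M : GrMod ℬ) (S : Submodule B M)
    (hS : ∀ g, ∀ x ∈ S, internalProj M.isInternal g x ∈ S) : GrMod ℬ where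
  carrier := S
  gr g := (M.gr g).comap S.subtype.toAddMonoidHom
  smul_mem' g h b m hb hm := M.smul_mem' g h b m hb hm
  isInternal := by
    refine isInternal_of_proj _
      (fun g => ((internalProj M.isInternal g).comp S.subtype.toAddMonoidHom).codRestrict S
        (fun x => hS g x x.2)) ?_ ?_ ?_
    · intro g x hx
      exact Subtype.ext (internalProj_same M.isInternal hx)
    · intro g h hgh x hx
      exact Subtype.ext (internalProj_ne M.isInternal hgh hx)
    · intro x
      have := mem_closure_internalProj M.isInternal (x : M)
      have hx : x.1 ∈ (AddSubmonoid.closure (⋃ g, (((M.gr g).comap S.subtype.toAddMonoidHom :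
          AddSubgroup S) : Set S))).map S.subtype.toAddMonoidHom := by
        refine (AddSubmonoid.closure_le).2 ?_ this
        rintro _ ⟨g, rfl⟩
        exact ⟨⟨_, hS g x x.2⟩, AddSubmonoid.subset_closure
          (Set.mem_iUnion.2 ⟨g, internalProj_mem M.isInternal g _⟩), rfl⟩
      obtain ⟨y, hy, hyx⟩ := hx
      rwa [← Subtype.ext hyx]

/-- The graded module on the quotient by a submodule stable under the projections. -/
def quot (M : GrMod ℬ) (S : Submodule B M)
    (hS : ∀ g, ∀ x ∈ S, internalProj M.isInternal g x ∈ S) : GrMod ℬ where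
  carrier := M ⧸ S
  gr g := (M.gr g).map S.mkQ.toAddMonoidHom
  smul_mem' := by
    rintro g h b _ hb ⟨m, hm, rfl⟩
    exact ⟨b • m, M.smul_mem' g h b m hb hm, rfl⟩
  isInternal := by
    refine isInternal_of_proj _
      (fun g => QuotientAddGroup.map S.toAddSubgroup S.toAddSubgroup
        (internalProj M.isInternal g) (fun x hx => hS g x hx)) ?_ ?_ ?_
    · rintro g _ ⟨x, hx, rfl⟩
      exact congrArg S.mkQ (internalProj_same M.isInternal hx)
    · rintro g h hgh _ ⟨x, hx, rfl⟩
      exact congrArg S.mkQ (internalProj_ne M.isInternal hgh hx)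
    · intro x
      obtain ⟨x, rfl⟩ := S.mkQ_surjective x
      refine internal_induction (p := fun x => S.mkQ x ∈ AddSubmonoid.closure
        (⋃ g, (((M.gr g).map S.mkQ.toAddMonoidHom : AddSubgroup (M ⧸ S)) : Set (M ⧸ S))))
        M.isInternal x (by rw [map_zero]; exact zero_mem _) ?_
        (fun x y hx hy => by rw [map_add]; exact add_mem hx hy)
      intro g x hx
      exact AddSubmonoid.subset_closure (Set.mem_iUnion.2 ⟨g, ⟨x, hx, rfl⟩⟩)

theorem ker_proj {M N : GrMod ℬ} (f : M ⟶ N) (g : G) (x : M) (hx : x ∈ LinearMap.ker (lin f)) :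
    internalProj M.isInternal g x ∈ LinearMap.ker (lin f) := by
  rw [LinearMap.mem_ker] at hx ⊢
  rw [lin_proj, hx, map_zero]

theorem range_proj {M N : GrMod ℬ} (f : M ⟶ N) (g : G) (x : N)
    (hx : x ∈ LinearMap.range (lin f)) :
    internalProj N.isInternal g x ∈ LinearMap.range (lin f) := by
  obtain ⟨y, rfl⟩ := hx
  exact ⟨_, lin_proj f g y⟩

/-- The kernel of a morphism of graded modules. -/
def ker {M N : GrMod ℬ} (f : M ⟶ N) : GrMod ℬ := M.sub (LinearMap.ker (lin f)) (ker_proj f)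

/-- The inclusion of the kernel. -/
def kerι {M N : GrMod ℬ} (f : M ⟶ N) : ker f ⟶ M :=
  ofLin (LinearMap.ker (lin f)).subtype fun _ _ hx => hx

/-- The cokernel of a morphism of graded modules. -/
def coker {M N : GrMod ℬ} (f : M ⟶ N) : GrMod ℬ :=
  N.quot (LinearMap.range (lin f)) (range_proj f)

/-- The projection to the cokernel. -/
def cokerπ {M N : GrMod ℬ} (f : M ⟶ N) : N ⟶ coker f :=
  ofLin (LinearMap.range (lin f)).mkQ fun _ x hx => ⟨x, hx, rfl⟩

theorem kerι_comp {M N : GrMod ℬ} (f : M ⟶ N) : kerι f ≫ f = 0 := hom_ext' fun x => x.2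

theorem comp_cokerπ {M N : GrMod ℬ} (f : M ⟶ N) : f ≫ cokerπ f = 0 :=
  hom_ext (LinearMap.range_mkQ_comp _)

/-- Morphisms with image in the image of an injective morphism factor through it. -/
def lift {K M P : GrMod ℬ} (i : K ⟶ M) (hi : Function.Injective (lin i)) (f : P ⟶ M)
    (hf : ∀ x, lin f x ∈ LinearMap.range (lin i)) : P ⟶ K :=
  ofLin ((LinearEquiv.ofInjective (lin i) hi).symm.toLinearMap.comp
    ((lin f).codRestrict (LinearMap.range (lin i)) hf)) (by
      intro g x hx
      obtain ⟨y, hy⟩ := hf x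
      have h1 : internalProj K.isInternal g y = y := hi (by
        rw [lin_proj, hy, internalProj_same _ (lin_mem f hx)])
      have h2 : (LinearEquiv.ofInjective (lin i) hi).symm
          ((lin f).codRestrict (LinearMap.range (lin i)) hf x) = y := by
        rw [LinearEquiv.symm_apply_eq]
        exact Subtype.ext hy.symm
      change (LinearEquiv.ofInjective (lin i) hi).symm
          ((lin f).codRestrict (LinearMap.range (lin i)) hf x) ∈ K.gr g
      rw [h2, ← h1]
      exact internalProj_mem _ _ _)

theorem lift_comp {K M P : GrMod ℬ} (i : K ⟶ M) (hi : Function.Injective (lin i)) (f : P ⟶ M)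
    (hf : ∀ x, lin f x ∈ LinearMap.range (lin i)) : lift i hi f hf ≫ i = f :=
  hom_ext' fun x => congrArg Subtype.val ((LinearEquiv.ofInjective (lin i) hi).apply_symm_apply
    ((lin f).codRestrict (LinearMap.range (lin i)) hf x))

/-- Morphisms vanishing on the kernel of a surjective morphism factor through it. -/
def desc {M N P : GrMod ℬ} (p : M ⟶ N) (hp : Function.Surjective (lin p)) (f : M ⟶ P)
    (hf : LinearMap.ker (lin p) ≤ LinearMap.ker (lin f)) : N ⟶ P :=
  ofLin (((LinearMap.ker (lin p)).liftQ (lin f) hf).comp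
    ((lin p).quotKerEquivOfSurjective hp).symm.toLinearMap) (by
      intro g y hy
      obtain ⟨x, rfl⟩ := hp y
      have h1 : lin p (internalProj M.isInternal g x) = lin p x := by
        rw [lin_proj, internalProj_same _ hy]
      rw [← h1]
      have h2 : ((lin p).quotKerEquivOfSurjective hp).symm
          (lin p (internalProj M.isInternal g x)) =
          (LinearMap.ker (lin p)).mkQ (internalProj M.isInternal g x) := by
        rw [LinearEquiv.symm_apply_eq]
        rfl
      change ((LinearMap.ker (lin p)).liftQ (lin f) hf)
        (((lin p).quotKerEquivOfSurjective hp).symm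
          (lin p (internalProj M.isInternal g x))) ∈ P.gr g
      rw [h2]
      exact lin_mem f (internalProj_mem _ _ _))

theorem comp_desc {M N P : GrMod ℬ} (p : M ⟶ N) (hp : Function.Surjective (lin p)) (f : M ⟶ P)
    (hf : LinearMap.ker (lin p) ≤ LinearMap.ker (lin f)) : p ≫ desc p hp f hf = f :=
  hom_ext' fun x => by
    have h2 : ((lin p).quotKerEquivOfSurjective hp).symm (lin p x) =
        (LinearMap.ker (lin p)).mkQ x := by
      rw [LinearEquiv.symm_apply_eq]
      rfl
    change ((LinearMap.ker (lin p)).liftQ (lin f) hf)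
      (((lin p).quotKerEquivOfSurjective hp).symm (lin p x)) = lin f x
    rw [h2]
    rfl

/-- An injective morphism is the kernel of each morphism with which it is exact. -/
def isKernel {K M N : GrMod ℬ} (i : K ⟶ M) (f : M ⟶ N) (w : i ≫ f = 0)
    (hi : Function.Injective (lin i)) (h : LinearMap.ker (lin f) ≤ LinearMap.range (lin i)) :
    IsLimit (KernelFork.ofι i w) :=
  KernelFork.IsLimit.ofι _ _
    (fun a ha => lift i hi a fun x => h (congrArg (fun z => lin z x) ha))
    (fun a ha => lift_comp i hi a _)
    (fun a ha b hb => hom_ext' fun x => hi (by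
      have h1 := congrArg (fun z => lin z x) hb
      have h2 := congrArg (fun z => lin z x)
        (lift_comp i hi a fun x => h (congrArg (fun z => lin z x) ha))
      exact h1.trans h2.symm))

/-- A surjective morphism is the cokernel of each morphism with which it is exact. -/
def isCokernel {M N P : GrMod ℬ} (f : M ⟶ N) (p : N ⟶ P) (w : f ≫ p = 0)
    (hp : Function.Surjective (lin p)) (h : LinearMap.ker (lin p) ≤ LinearMap.range (lin f)) :
    IsColimit (CokernelCofork.ofπ p w) :=
  CokernelCofork.IsColimit.ofπ _ _
    (fun a ha => desc p hp a fun x hx => by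
      obtain ⟨y, rfl⟩ := h hx
      exact congrArg (fun z => lin z y) ha)
    (fun a ha => comp_desc p hp a _)
    (fun a ha b hb => hom_ext' fun x => by
      obtain ⟨x, rfl⟩ := hp x
      have h1 := congrArg (fun z => lin z x) hb
      have h2 := congrArg (fun z => lin z x) (comp_desc p hp a fun x hx => by
        obtain ⟨y, rfl⟩ := h hx
        exact congrArg (fun z => lin z y) ha)
      exact h1.trans h2.symm)

instance : HasKernels (GrMod ℬ) where
  has_limit f := ⟨⟨_, isKernel (kerι f) f (kerι_comp f) Subtype.val_injective
    (fun x hx => ⟨⟨x, hx⟩, rfl⟩)⟩⟩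

instance : HasCokernels (GrMod ℬ) where
  has_colimit f := ⟨⟨_, isCokernel f (cokerπ f) (comp_cokerπ f) (Submodule.mkQ_surjective _)
    (Submodule.ker_mkQ _).le⟩⟩

theorem injective_of_mono {M N : GrMod ℬ} (f : M ⟶ N) [Mono f] :
    Function.Injective (lin f) := by
  have h : kerι f = 0 := (cancel_mono f).1 (by rw [kerι_comp, zero_comp])
  rw [← LinearMap.ker_eq_bot, eq_bot_iff]
  intro x hx
  exact congrArg (fun z : ker f ⟶ M => lin z (⟨x, hx⟩ : LinearMap.ker (lin f))) h

theorem surjective_of_epi {M N : GrMod ℬ} (f : M ⟶ N) [Epi f] :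
    Function.Surjective (lin f) := by
  have h : cokerπ f = 0 := (cancel_epi f).1 (by rw [comp_cokerπ, comp_zero])
  rw [← LinearMap.range_eq_top, eq_top_iff]
  intro x _
  exact (Submodule.Quotient.mk_eq_zero _).1 (congrArg (fun z => lin z x) h)

/-- The zero graded module. -/
def zero : GrMod ℬ where
  carrier := PUnit
  gr _ := ⊤
  isInternal := isInternal_of_proj _ 0 (fun _ _ _ => rfl) (fun _ _ _ _ _ => rfl)
    (fun _ => zero_mem _)
  smul_mem' _ _ _ _ _ _ := trivial

instance : HasZeroObject (GrMod ℬ) where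
  zero := ⟨zero,
    ⟨fun _ => ⟨⟨⟨0⟩, fun f => hom_ext' fun _ => (map_zero (lin f) : lin f 0 = 0)⟩⟩,
    fun _ => ⟨⟨⟨0⟩, fun _ => hom_ext' fun _ => rfl⟩⟩⟩⟩

/-- The product of two graded modules. -/
def prod (M N : GrMod ℬ) : GrMod ℬ where
  carrier := M × N
  gr g := (M.gr g).prod (N.gr g)
  smul_mem' g h b m hb hm := ⟨M.smul_mem' g h b _ hb hm.1, N.smul_mem' g h b _ hb hm.2⟩
  isInternal := by
    refine isInternal_of_proj _
      (fun g => (internalProj M.isInternal g).prodMap (internalProj N.isInternal g)) ?_ ?_ ?_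
    · intro g x hx
      exact Prod.ext (internalProj_same _ hx.1) (internalProj_same _ hx.2)
    · intro g h hgh x hx
      exact Prod.ext (internalProj_ne _ hgh hx.1) (internalProj_ne _ hgh hx.2)
    · rintro ⟨x, y⟩
      have hxy : ((x, y) : M × N) = (x, 0) + (0, y) := by simp
      rw [hxy]
      refine add_mem ?_ ?_
      · refine internal_induction (p := fun x => ((x, 0) : M × N) ∈ AddSubmonoid.closure
          (⋃ g, (((M.gr g).prod (N.gr g) : AddSubgroup (M × N)) : Set (M × N))))
          M.isInternal x (zero_mem _) ?_ ?_
        · exact fun g x hx => AddSubmonoid.subset_closure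
            (Set.mem_iUnion.2 ⟨g, ⟨hx, zero_mem _⟩⟩)
        · intro x y hx hy
          simpa using add_mem hx hy
      · refine internal_induction (p := fun x => ((0, x) : M × N) ∈ AddSubmonoid.closure
          (⋃ g, (((M.gr g).prod (N.gr g) : AddSubgroup (M × N)) : Set (M × N))))
          N.isInternal y (zero_mem _) ?_ ?_
        · exact fun g x hx => AddSubmonoid.subset_closure
            (Set.mem_iUnion.2 ⟨g, ⟨zero_mem _, hx⟩⟩)
        · intro x y hx hy
          simpa using add_mem hx hy

instance : HasBinaryBiproducts (GrMod ℬ) where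
  has_binary_biproduct M N := HasBinaryBiproduct.mk ⟨_, isBinaryBilimitOfTotal
    { pt := prod M N
      fst := ofLin (LinearMap.fst B M N) fun _ _ hx => hx.1
      snd := ofLin (LinearMap.snd B M N) fun _ _ hx => hx.2
      inl := ofLin (LinearMap.inl B M N) fun _ _ hx => ⟨hx, zero_mem _⟩
      inr := ofLin (LinearMap.inr B M N) fun _ _ hx => ⟨zero_mem _, hx⟩
      inl_fst := rfl
      inl_snd := rfl
      inr_fst := rfl
      inr_snd := rfl }
    (hom_ext' fun _ => Prod.ext (add_zero _) (zero_add _))⟩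

instance : HasFiniteProducts (GrMod ℬ) :=
  hasFiniteProducts_of_has_binary_and_terminal

instance : Abelian (GrMod ℬ) where
  normalMonoOfMono f _ := ⟨{
    Z := coker f
    g := cokerπ f
    w := comp_cokerπ f
    isLimit := isKernel f _ _ (injective_of_mono f) (Submodule.ker_mkQ _).le }⟩
  normalEpiOfEpi f _ := ⟨{
    W := ker f
    g := kerι f
    w := kerι_comp f
    isColimit := isCokernel _ f _ (surjective_of_epi f) (fun x hx => ⟨⟨x, hx⟩, rfl⟩) }⟩


/-- The functor forgetting the grading. -/
def forget (ℬ : G → Submodule k B) : GrMod ℬ ⥤ ModuleCat.{u} B where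
  obj M := ModuleCat.of B M
  map f := ModuleCat.ofHom (lin f)

instance : (forget ℬ).Additive where

/-- Restriction of scalars along a homomorphism of algebras that preserves degrees. -/
def restrict {E : Type u} [Ring E] [Algebra k E] {ℰ : G → Submodule k E} (ι : B →ₐ[k] E)
    (hι : ∀ g, ∀ b ∈ ℬ g, ι b ∈ ℰ g) : GrMod ℰ ⥤ GrMod ℬ where
  obj M :=
    { carrier := (ModuleCat.restrictScalars ι.toRingHom).obj (ModuleCat.of E M)
      gr := M.gr
      isInternal := M.isInternal
      smul_mem' := fun g h b m hb hm => M.smul_mem' g h (ι b) m (hι g b hb) hm }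
  map f := ofLin ((ModuleCat.restrictScalars ι.toRingHom).map (ModuleCat.ofHom (lin f))).hom
    fun _ _ hx => lin_mem f hx

instance {E : Type u} [Ring E] [Algebra k E] {ℰ : G → Submodule k E} (ι : B →ₐ[k] E)
    (hι : ∀ g, ∀ b ∈ ℬ g, ι b ∈ ℰ g) : (restrict ι hι : GrMod ℰ ⥤ GrMod ℬ).Additive where
  map_add := rfl

variable {H : Type w} [DecidableEq H] [AddCommGroup H]

/-- Change of grading along `φ : G → H`: the underlying module is unchanged, and the component of
degree `h` is the sum of the components of the degrees `g` with `φ g = h`. Here `ℬ'` is a grading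
of `B` that is contained in the grading `φ_!(ℬ)`. -/
def pushObj (φ : G →+ H) (ℬ' : H → Submodule k B)
    (hℬ' : ∀ h, ℬ' h ≤ pushGrading φ ℬ h) (M : GrMod ℬ) : GrMod ℬ' where
  carrier := M
  gr := fun h => ⨆ g : {g // φ g = h}, M.gr g
  isInternal := by
    refine isInternal_push M.isInternal φ _
      (fun g x hx => AddSubgroup.mem_iSup_of_mem (⟨g, rfl⟩ : {g' // φ g' = φ g}) hx) ?_
    intro h x hx
    refine AddSubgroup.iSup_induction (fun g : {g // φ g = h} => M.gr g)
      (C := fun x => x ∈ AddSubmonoid.closure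
        (⋃ g : {g // φ g = h}, (M.gr g : Set M))) hx ?_ (zero_mem _)
      (fun _ _ hx hy => add_mem hx hy)
    exact fun g x hx => AddSubmonoid.subset_closure (Set.mem_iUnion.2 ⟨g, hx⟩)
  smul_mem' := by
    intro h h' b m hb hm
    refine Submodule.iSup_induction (fun g : {g // φ g = h} => ℬ g)
      (motive := fun b => b • m ∈ ⨆ g : {g // φ g = h + h'}, M.gr g) (hℬ' h hb) ?_
      (by rw [zero_smul]; exact zero_mem _)
      (fun _ _ hx hy => by rw [add_smul]; exact add_mem hx hy)
    intro g b hb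
    refine AddSubgroup.iSup_induction (fun g : {g // φ g = h'} => M.gr g)
      (C := fun m => b • m ∈ ⨆ g : {g // φ g = h + h'}, M.gr g) hm ?_
      (by rw [smul_zero]; exact zero_mem _)
      (fun _ _ hx hy => by rw [smul_add]; exact add_mem hx hy)
    intro g' m hm
    exact AddSubgroup.mem_iSup_of_mem
      (⟨g.1 + g'.1, by rw [map_add, g.2, g'.2]⟩ : {g // φ g = h + h'})
      (M.smul_mem' _ _ b m hb hm)

theorem pushObj_mem (φ : G →+ H) (ℬ' : H → Submodule k B)
    (hℬ' : ∀ h, ℬ' h ≤ pushGrading φ ℬ h) {M N : GrMod ℬ} (f : M ⟶ N) (h : H) (x : M)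
    (hx : x ∈ (pushObj φ ℬ' hℬ' M).gr h) : lin f x ∈ (pushObj φ ℬ' hℬ' N).gr h := by
  refine AddSubgroup.iSup_induction (fun g : {g // φ g = h} => M.gr g)
    (C := fun x => lin f x ∈ ⨆ g : {g // φ g = h}, N.gr g) hx ?_
    (by rw [map_zero]; exact zero_mem _)
    (fun _ _ hx hy => by rw [map_add]; exact add_mem hx hy)
  exact fun g x hx => AddSubgroup.mem_iSup_of_mem g (lin_mem f hx)

/-- The change of grading functor `φ_!`. -/
def push (φ : G →+ H) (ℬ' : H → Submodule k B)
    (hℬ' : ∀ h, ℬ' h ≤ pushGrading φ ℬ h) : GrMod ℬ ⥤ GrMod ℬ' where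
  obj M := pushObj φ ℬ' hℬ' M
  map {M N} f := ofLin (M := pushObj φ ℬ' hℬ' M) (N := pushObj φ ℬ' hℬ' N)
    (show M ⟶ N from f).1
    (pushObj_mem φ ℬ' hℬ' f)

instance (φ : G →+ H) (ℬ' : H → Submodule k B)
    (hℬ' : ∀ h, ℬ' h ≤ pushGrading φ ℬ h) : (push φ ℬ' hℬ').Additive where
  map_add := rfl

end GrMod

end GradedModules

section Gradings

variable {k : Type v} [CommRing k] {G : Type w} [AddCommGroup G]
  {A : Type u} [Ring A] [Algebra k A]

/-- The grading of the opposite algebra. -/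
def opGrading (𝒜 : G → Submodule k A) (g : G) : Submodule k Aᵐᵒᵖ :=
  (𝒜 g).map (MulOpposite.opLinearEquiv k).toLinearMap

/-- The grading of the enveloping algebra `A ⊗ Aᵐᵒᵖ`: its component of degree `g` is the sum of
the `𝒜 g₁ ⊗ 𝒜 g₂` with `g₁ + g₂ = g`. -/
def envGrading (𝒜 : G → Submodule k A) (g : G) : Submodule k (A ⊗[k] Aᵐᵒᵖ) :=
  Submodule.span k {t | ∃ g₁ g₂ : G, g₁ + g₂ = g ∧ ∃ a ∈ 𝒜 g₁, ∃ b ∈ 𝒜 g₂,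
    t = a ⊗ₜ[k] MulOpposite.op b}

variable {𝒜 : G → Submodule k A}

theorem mem_pushGrading {H : Type*} [AddCommGroup H] (φ : G →+ H) {g : G} {h : H} (hg : φ g = h)
    {a : A} (ha : a ∈ 𝒜 g) : a ∈ pushGrading φ 𝒜 h :=
  Submodule.mem_iSup_of_mem (⟨g, hg⟩ : {g // φ g = h}) ha

theorem pushGrading_induction {H : Type*} [AddCommGroup H] (φ : G →+ H) {h : H}
    {p : A → Prop} {a : A} (ha : a ∈ pushGrading φ 𝒜 h) (zero : p 0)
    (homog : ∀ g, φ g = h → ∀ a ∈ 𝒜 g, p a) (add : ∀ a b, p a → p b → p (a + b)) : p a :=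
  Submodule.iSup_induction (fun g : {g // φ g = h} => 𝒜 g) (motive := p) ha
    (fun g a ha => homog g g.2 a ha) zero add

instance [DecidableEq G] [GradedAlgebra 𝒜] {H : Type*} [DecidableEq H] [AddCommGroup H]
    (φ : G →+ H) : GradedAlgebra (pushGrading φ 𝒜) where
  one_mem := mem_pushGrading φ (map_zero φ) (SetLike.GradedOne.one_mem (A := 𝒜))
  mul_mem := by
    intro h h' a b ha hb
    refine pushGrading_induction φ (p := fun a => a * b ∈ pushGrading φ 𝒜 (h + h')) ha
      (by rw [zero_mul]; exact zero_mem _) ?_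
      (fun _ _ hx hy => by rw [add_mul]; exact add_mem hx hy)
    intro g hg a ha
    refine pushGrading_induction φ (p := fun b => a * b ∈ pushGrading φ 𝒜 (h + h')) hb
      (by rw [mul_zero]; exact zero_mem _) ?_
      (fun _ _ hx hy => by rw [mul_add]; exact add_mem hx hy)
    intro g' hg' b hb
    exact mem_pushGrading φ (by rw [map_add, hg, hg']) (SetLike.GradedMul.mul_mem ha hb)
  toDecomposition := (isInternal_push (DirectSum.Decomposition.isInternal 𝒜) φ (pushGrading φ 𝒜)
    (fun _ _ hx => mem_pushGrading φ rfl hx) (fun h x hx => pushGrading_induction φ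
      (p := fun x => x ∈ AddSubmonoid.closure (⋃ g : {g // φ g = h}, (𝒜 g : Set A))) hx
      (zero_mem _) (fun g hg _ ha => AddSubmonoid.subset_closure
        (Set.mem_iUnion.2 ⟨(⟨g, hg⟩ : {g // φ g = h}), ha⟩))
      (fun _ _ hx hy => add_mem hx hy))).chooseDecomposition

theorem tmul_mem_envGrading {g₁ g₂ : G} {a b : A} (ha : a ∈ 𝒜 g₁) (hb : b ∈ 𝒜 g₂) :
    a ⊗ₜ[k] MulOpposite.op b ∈ envGrading 𝒜 (g₁ + g₂) :=
  Submodule.subset_span ⟨g₁, g₂, rfl, a, ha, b, hb, rfl⟩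

/-- `φ_!(A)ᵉ = φ_!(Aᵉ)`. -/
theorem envGrading_pushGrading {H : Type*} [AddCommGroup H] (φ : G →+ H) (h : H) :
    envGrading (pushGrading φ 𝒜) h = pushGrading φ (envGrading 𝒜) h := by
  apply le_antisymm
  · refine Submodule.span_le.2 ?_
    rintro _ ⟨h₁, h₂, rfl, a, ha, b, hb, rfl⟩
    refine pushGrading_induction φ (p := fun a => a ⊗ₜ[k] MulOpposite.op b ∈
      pushGrading φ (envGrading 𝒜) (h₁ + h₂)) ha
      (by rw [TensorProduct.zero_tmul]; exact zero_mem _) ?_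
      (fun _ _ hx hy => by rw [TensorProduct.add_tmul]; exact add_mem hx hy)
    intro g₁ hg₁ a ha
    refine pushGrading_induction φ (p := fun b => a ⊗ₜ[k] MulOpposite.op b ∈
      pushGrading φ (envGrading 𝒜) (h₁ + h₂)) hb
      (by rw [MulOpposite.op_zero, TensorProduct.tmul_zero]; exact zero_mem _) ?_
      (fun _ _ hx hy => by
        rw [MulOpposite.op_add, TensorProduct.tmul_add]; exact add_mem hx hy)
    intro g₂ hg₂ b hb
    exact mem_pushGrading φ (by rw [map_add, hg₁, hg₂]) (tmul_mem_envGrading ha hb)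
  · refine iSup_le ?_
    rintro ⟨g, rfl⟩
    refine Submodule.span_le.2 ?_
    rintro _ ⟨g₁, g₂, rfl, a, ha, b, hb, rfl⟩
    rw [map_add]
    exact tmul_mem_envGrading (mem_pushGrading φ rfl ha) (mem_pushGrading φ rfl hb)

theorem mem_envGrading_left [DecidableEq G] [GradedAlgebra 𝒜] (g : G) (a : A) (ha : a ∈ 𝒜 g) :
    (Algebra.TensorProduct.includeLeft : A →ₐ[k] A ⊗[k] Aᵐᵒᵖ) a ∈ envGrading 𝒜 g := by
  have := tmul_mem_envGrading ha (SetLike.GradedOne.one_mem (A := 𝒜))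
  rwa [add_zero] at this

theorem mem_envGrading_right [DecidableEq G] [GradedAlgebra 𝒜] (g : G) (a : Aᵐᵒᵖ)
    (ha : a ∈ opGrading 𝒜 g) :
    (Algebra.TensorProduct.includeRight : Aᵐᵒᵖ →ₐ[k] A ⊗[k] Aᵐᵒᵖ) a ∈ envGrading 𝒜 g := by
  obtain ⟨a, ha, rfl⟩ := ha
  have := tmul_mem_envGrading (SetLike.GradedOne.one_mem (A := 𝒜)) ha
  rwa [zero_add] at this

end Gradings

section Complexes

/-- A cochain complex is bounded. -/
def IsBoundedComplex {C : Type*} [Category* C] [Abelian C] (K : CochainComplex C ℤ) : Prop :=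
  ∃ a b : ℤ, K.IsStrictlyGE a ∧ K.IsStrictlyLE b

/-- `K` has a left bounded injective resolution that vanishes in all degrees `> n`. -/
def HasInjDimLE {C : Type*} [Category* C] [Abelian C] (K : CochainComplex C ℤ) (n : ℤ) : Prop :=
  ∃ (I : CochainComplex C ℤ) (f : K ⟶ I), QuasiIso f ∧ (∀ i, Injective (I.X i)) ∧
    (∃ a : ℤ, I.IsStrictlyGE a) ∧ I.IsStrictlyLE n

/-- The injective dimension of a complex: the least `n` such that the complex has a left bounded
injective resolution that vanishes in all degrees `> n` (`⊤` if there is no such `n`, and `⊥`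
if all `n` have this property). -/
def injDim {C : Type*} [Category* C] [Abelian C] (K : CochainComplex C ℤ) : EReal :=
  sInf {x | ∃ n : ℤ, x = ((n : ℝ) : EReal) ∧ HasInjDimLE K n}

/-- `P → K` is a right bounded projective resolution. -/
def IsProjResolution {C : Type*} [Category* C] [Abelian C] {P K : CochainComplex C ℤ}
    (f : P ⟶ K) : Prop :=
  QuasiIso f ∧ (∀ i, Projective (P.X i)) ∧ ∃ b : ℤ, P.IsStrictlyLE b

end Complexes

section NaturalMap

open CochainComplex HomComplex

variable {k : Type v} [CommRing k] {B C E : Type u} [Ring B] [Algebra k B] [Ring C] [Algebra k C]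
  [Ring E] [Algebra k E] (ι : B →ₐ[k] E) (κ : C →ₐ[k] E) (hικ : ∀ b c, Commute (ι b) (κ c))

/-- The complex of `B`-modules underlying a complex of `E`-modules. -/
abbrev resComplex (P : CochainComplex (ModuleCat.{u} E) ℤ) : CochainComplex (ModuleCat.{u} B) ℤ :=
  ((ModuleCat.restrictScalars ι.toRingHom).mapHomologicalComplex _).obj P

variable {ι κ} in
/-- The action of `c : C` on a complex of `E`-modules, as an endomorphism of the underlying complex
of `B`-modules, where the images of `B` and `C` in `E` commute. -/
def actionHom (P : CochainComplex (ModuleCat.{u} E) ℤ) (c : C) :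
    resComplex ι P ⟶ resComplex ι P where
  f p := ModuleCat.ofHom
    (X := (ModuleCat.restrictScalars ι.toRingHom).obj (P.X p))
    (Y := (ModuleCat.restrictScalars ι.toRingHom).obj (P.X p))
    { toFun := fun x : P.X p => κ c • x
      map_add' := fun x y : P.X p => smul_add (κ c) x y
      map_smul' := fun b (x : P.X p) => by
        change κ c • ι b • x = ι b • κ c • x
        rw [smul_smul, smul_smul, (hικ b c).eq] }
  comm' p q _ := by
    refine ModuleCat.hom_ext (LinearMap.ext fun x : P.X p => ?_)
    exact map_smul (P.d p q).hom (κ c) x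

theorem actionHom_zero (P : CochainComplex (ModuleCat.{u} E) ℤ) : actionHom hικ P 0 = 0 := by
  refine HomologicalComplex.hom_ext _ _ fun p =>
    ModuleCat.hom_ext (LinearMap.ext fun x : P.X p => ?_)
  change κ 0 • x = 0
  rw [map_zero, zero_smul]

theorem actionHom_add (P : CochainComplex (ModuleCat.{u} E) ℤ) (c c' : C) :
    actionHom hικ P (c + c') = actionHom hικ P c + actionHom hικ P c' := by
  refine HomologicalComplex.hom_ext _ _ fun p =>
    ModuleCat.hom_ext (LinearMap.ext fun x : P.X p => ?_)
  change κ (c + c') • x = κ c • x + κ c' • x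
  rw [map_add, add_smul]

variable {ι κ} in
/-- The natural map `C → Hom_B(P, P)`, `c ↦ (x ↦ c x)`, as a morphism of complexes, with `C`
placed in degree `0`. -/
def natMap (P : CochainComplex (ModuleCat.{u} E) ℤ) :
    (HomologicalComplex.single AddCommGrpCat.{u} (ComplexShape.up ℤ) 0).obj (AddCommGrpCat.of C) ⟶
      HomComplex (resComplex ι P) (resComplex ι P) :=
  HomologicalComplex.mkHomFromSingle
    (AddCommGrpCat.ofHom
      { toFun := fun c => Cochain.ofHom (actionHom hικ P c)
        map_zero' := by rw [actionHom_zero, Cochain.ofHom_zero]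
        map_add' := fun c c' => by rw [actionHom_add, Cochain.ofHom_add] })
    (fun _ _ => AddCommGrpCat.hom_ext (AddMonoidHom.ext fun c =>
      δ_ofHom (actionHom hικ P c)))

section Graded

variable {G : Type w} [DecidableEq G] [AddCommGroup G] {ℬ : G → Submodule k B}
  {𝒞 : G → Submodule k C} {ℰ : G → Submodule k E}

/-- The complex of modules underlying a complex of graded modules. -/
abbrev forgetComplex (K : CochainComplex (GrMod ℬ) ℤ) : CochainComplex (ModuleCat.{u} B) ℤ :=
  ((GrMod.forget ℬ).mapHomologicalComplex _).obj K

/-- The families of `B`-linear maps `K p → L (p + n)` that are homogeneous of degree `g`. -/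
def homogCochain (K L : CochainComplex (GrMod ℬ) ℤ) (n : ℤ) (g : G) :
    AddSubgroup (Cochain (forgetComplex K) (forgetComplex L) n) where
  carrier := {z | ∀ (p q : ℤ) (hpq : p + n = q) (h : G) (x : K.X p), x ∈ (K.X p).gr h →
    (z.v p q hpq).hom x ∈ (L.X q).gr (h + g)}
  zero_mem' _ _ _ _ _ _ := zero_mem _
  add_mem' hz hz' p q hpq h x hx := add_mem (hz p q hpq h x hx) (hz' p q hpq h x hx)
  neg_mem' hz p q hpq h x hx := neg_mem (hz p q hpq h x hx)

/-- The component of degree `n` of the complex `HOM_B(K, L)`: the direct sum over `g` of the groups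
of families of `B`-linear maps `K p → L (p + n)` homogeneous of degree `g`, i.e. the product
over `p` of the `HOM_B(K p, L (p + n))` in the category of graded modules. -/
def gradedCochain (K L : CochainComplex (GrMod ℬ) ℤ) (n : ℤ) :
    AddSubgroup (Cochain (forgetComplex K) (forgetComplex L) n) :=
  ⨆ g, homogCochain K L n g

theorem δ_mem_homogCochain (K L : CochainComplex (GrMod ℬ) ℤ) (n m : ℤ) (g : G)
    {z : Cochain (forgetComplex K) (forgetComplex L) n} (hz : z ∈ homogCochain K L n g) :
    δ n m z ∈ homogCochain K L m g := by
  by_cases hnm : n + 1 = m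
  · intro p q hpq h x hx
    rw [δ_v n m hnm z p q hpq (q - 1) (p + 1) rfl rfl]
    refine add_mem ?_ ?_
    · exact GrMod.lin_mem (L.d (q - 1) q) (hz p (q - 1) (by lia) h x hx)
    · have := hz (p + 1) q (by lia) h _ (GrMod.lin_mem (K.d p (p + 1)) hx)
      rcases Int.even_or_odd m with hm | hm
      · rw [Int.negOnePow_even _ hm, one_smul]
        exact this
      · rw [Int.negOnePow_odd _ hm, Units.neg_smul, one_smul]
        exact neg_mem this
  · rw [δ_shape n m hnm]
    exact zero_mem _

theorem δ_mem_gradedCochain (K L : CochainComplex (GrMod ℬ) ℤ) (n m : ℤ)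
    {z : Cochain (forgetComplex K) (forgetComplex L) n} (hz : z ∈ gradedCochain K L n) :
    δ n m z ∈ gradedCochain K L m :=
  AddSubgroup.iSup_induction (homogCochain K L n) (C := fun z => δ n m z ∈ gradedCochain K L m) hz
    (fun g _ hz => AddSubgroup.mem_iSup_of_mem g (δ_mem_homogCochain K L n m g hz))
    (by rw [δ_zero]; exact zero_mem _) (fun _ _ hx hy => by rw [δ_add]; exact add_mem hx hy)

/-- The complex `HOM_B(K, L)` of complexes of graded modules. -/
def gradedHomComplex (K L : CochainComplex (GrMod ℬ) ℤ) : CochainComplex AddCommGrpCat.{u} ℤ where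
  X n := AddCommGrpCat.of (gradedCochain K L n)
  d n m := AddCommGrpCat.ofHom
    (((δ_hom ℤ (forgetComplex K) (forgetComplex L) n m).toAddMonoidHom.comp
      (gradedCochain K L n).subtype).codRestrict (gradedCochain K L m)
      fun z => δ_mem_gradedCochain K L n m z.2)
  shape n m hnm := AddCommGrpCat.hom_ext (AddMonoidHom.ext fun z =>
    Subtype.ext (δ_shape n m hnm z.1))
  d_comp_d' n m l _ _ := AddCommGrpCat.hom_ext (AddMonoidHom.ext fun z =>
    Subtype.ext (δ_δ n m l z.1))

variable {ι κ} (hι : ∀ g, ∀ b ∈ ℬ g, ι b ∈ ℰ g)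

/-- The complex of graded `B`-modules underlying a complex of graded `E`-modules. -/
abbrev resGradedComplex (P : CochainComplex (GrMod ℰ) ℤ) : CochainComplex (GrMod ℬ) ℤ :=
  ((GrMod.restrict ι hι).mapHomologicalComplex _).obj P

/-- The action of `c : C` on a complex of graded `E`-modules, as an endomorphism of the underlying
complex of `B`-modules, where the images of `B` and `C` in `E` commute. -/
def gradedActionHom (P : CochainComplex (GrMod ℰ) ℤ) (c : C) :
    forgetComplex (resGradedComplex hι P) ⟶ forgetComplex (resGradedComplex hι P) where
  f p := ModuleCat.ofHom
    (X := (GrMod.restrict ι hι).obj (P.X p)) (Y := (GrMod.restrict ι hι).obj (P.X p))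
    { toFun := fun x : P.X p => κ c • x
      map_add' := fun x y : P.X p => smul_add (κ c) x y
      map_smul' := fun b (x : P.X p) => by
        change κ c • ι b • x = ι b • κ c • x
        rw [smul_smul, smul_smul, (hικ b c).eq] }
  comm' p q _ := by
    refine ModuleCat.hom_ext (LinearMap.ext fun x : P.X p => ?_)
    exact map_smul (GrMod.lin (P.d p q)) (κ c) x

theorem gradedActionHom_zero (P : CochainComplex (GrMod ℰ) ℤ) :
    gradedActionHom hικ hι P 0 = 0 := by
  refine HomologicalComplex.hom_ext _ _ fun p =>
    ModuleCat.hom_ext (LinearMap.ext fun x : P.X p => ?_)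
  change κ 0 • x = 0
  rw [map_zero, zero_smul]

theorem gradedActionHom_add (P : CochainComplex (GrMod ℰ) ℤ) (c c' : C) :
    gradedActionHom hικ hι P (c + c') = gradedActionHom hικ hι P c + gradedActionHom hικ hι P c' := by
  refine HomologicalComplex.hom_ext _ _ fun p =>
    ModuleCat.hom_ext (LinearMap.ext fun x : P.X p => ?_)
  change κ (c + c') • x = κ c • x + κ c' • x
  rw [map_add, add_smul]

theorem gradedActionHom_mem (hκ : ∀ g, ∀ c ∈ 𝒞 g, κ c ∈ ℰ g) (h𝒞 : ∀ c : C, c ∈ ⨆ g, 𝒞 g)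
    (P : CochainComplex (GrMod ℰ) ℤ) (c : C) :
    Cochain.ofHom (gradedActionHom hικ hι P c) ∈
      gradedCochain (resGradedComplex hι P) (resGradedComplex hι P) 0 := by
  refine Submodule.iSup_induction 𝒞 (motive := fun c => Cochain.ofHom (gradedActionHom hικ hι P c) ∈
    gradedCochain (resGradedComplex hι P) (resGradedComplex hι P) 0) (h𝒞 c) ?_ ?_ ?_
  · intro g c hc
    refine AddSubgroup.mem_iSup_of_mem g ?_
    intro p q hpq h x hx
    obtain rfl : p = q := by lia
    rw [Cochain.ofHom_v, add_comm]
    exact (P.X p).smul_mem' g h (κ c) x (hκ g c hc) hx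
  · rw [gradedActionHom_zero, Cochain.ofHom_zero]
    exact zero_mem _
  · intro c c' hc hc'
    rw [gradedActionHom_add, Cochain.ofHom_add]
    exact add_mem hc hc'

/-- The natural map `C → HOM_B(P, P)`, `c ↦ (x ↦ c x)`, as a morphism of complexes, with `C`
placed in degree `0`. -/
def gradedNatMap (hκ : ∀ g, ∀ c ∈ 𝒞 g, κ c ∈ ℰ g) (h𝒞 : ∀ c : C, c ∈ ⨆ g, 𝒞 g)
    (P : CochainComplex (GrMod ℰ) ℤ) :
    (HomologicalComplex.single AddCommGrpCat.{u} (ComplexShape.up ℤ) 0).obj (AddCommGrpCat.of C) ⟶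
      gradedHomComplex (resGradedComplex hι P) (resGradedComplex hι P) :=
  HomologicalComplex.mkHomFromSingle
    (AddCommGrpCat.ofHom
      { toFun := fun c => ⟨Cochain.ofHom (gradedActionHom hικ hι P c),
          gradedActionHom_mem hικ hι hκ h𝒞 P c⟩
        map_zero' := Subtype.ext (by
          change Cochain.ofHom (gradedActionHom hικ hι P 0) = 0
          rw [gradedActionHom_zero, Cochain.ofHom_zero])
        map_add' := fun c c' => Subtype.ext (by
          change Cochain.ofHom (gradedActionHom hικ hι P (c + c')) =
            Cochain.ofHom (gradedActionHom hικ hι P c) + Cochain.ofHom (gradedActionHom hικ hι P c')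
          rw [gradedActionHom_add, Cochain.ofHom_add]) })
    (fun _ _ => AddCommGrpCat.hom_ext (AddMonoidHom.ext fun c => Subtype.ext
      (δ_ofHom (gradedActionHom hικ hι P c))))

end Graded

end NaturalMap

section Dualizing

variable {k : Type v} [Field k] {A : Type u} [Ring A] [Algebra k A]

variable (k A) in
theorem left_right_commute (a : A) (b : Aᵐᵒᵖ) :
    Commute ((Algebra.TensorProduct.includeLeft : A →ₐ[k] A ⊗[k] Aᵐᵒᵖ) a)
      ((Algebra.TensorProduct.includeRight : Aᵐᵒᵖ →ₐ[k] A ⊗[k] Aᵐᵒᵖ) b) := by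
  simp [Commute, SemiconjBy]

variable (k A) in
/-- Restriction of complexes of `Aᵉ`-modules to left `A`-modules. -/
abbrev leftComplex (R : CochainComplex (ModuleCat.{u} (A ⊗[k] Aᵐᵒᵖ)) ℤ) :
    CochainComplex (ModuleCat.{u} A) ℤ :=
  resComplex (Algebra.TensorProduct.includeLeft : A →ₐ[k] A ⊗[k] Aᵐᵒᵖ) R

variable (k A) in
/-- Restriction of complexes of `Aᵉ`-modules to left `Aᵐᵒᵖ`-modules. -/
abbrev rightComplex (R : CochainComplex (ModuleCat.{u} (A ⊗[k] Aᵐᵒᵖ)) ℤ) :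
    CochainComplex (ModuleCat.{u} Aᵐᵒᵖ) ℤ :=
  resComplex (Algebra.TensorProduct.includeRight : Aᵐᵒᵖ →ₐ[k] A ⊗[k] Aᵐᵒᵖ) R

variable (k A) in
/-- Dualizing complexes over `A` in the ungraded sense: bounded complexes of `Aᵉ`-modules such that
* the cohomology modules are finitely generated on both sides,
* the injective dimension is finite on both sides,
* the natural maps `Aᵐᵒᵖ → RHom_A(R, R)` and `A → RHom_{Aᵐᵒᵖ}(R, R)` are isomorphisms in the
  derived category, i.e. quasi-isomorphisms. Here `RHom_A(R, R)` is `Hom_A(P, P)` for a right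
  bounded projective resolution `P → R` by `Aᵉ`-modules. -/
structure IsDualizingComplex (R : CochainComplex (ModuleCat.{u} (A ⊗[k] Aᵐᵒᵖ)) ℤ) : Prop where
  bounded : IsBoundedComplex R
  finite_left : ∀ n, Module.Finite A ((leftComplex k A R).homology n)
  finite_right : ∀ n, Module.Finite Aᵐᵒᵖ ((rightComplex k A R).homology n)
  injDim_left : ∃ n, HasInjDimLE (leftComplex k A R) n
  injDim_right : ∃ n, HasInjDimLE (rightComplex k A R) n
  nat_left : ∃ (P : CochainComplex (ModuleCat.{u} (A ⊗[k] Aᵐᵒᵖ)) ℤ) (f : P ⟶ R),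
    IsProjResolution f ∧ QuasiIso (natMap (left_right_commute k A) P)
  nat_right : ∃ (P : CochainComplex (ModuleCat.{u} (A ⊗[k] Aᵐᵒᵖ)) ℤ) (f : P ⟶ R),
    IsProjResolution f ∧ QuasiIso (natMap (fun b a => (left_right_commute k A a b).symm) P)

variable {G : Type w} [DecidableEq G] [AddCommGroup G] (𝒜 : G → Submodule k A) [GradedAlgebra 𝒜]

/-- Restriction of complexes of graded `Aᵉ`-modules to graded left `A`-modules. -/
abbrev gradedLeftComplex (R : CochainComplex (GrMod (envGrading 𝒜)) ℤ) :
    CochainComplex (GrMod 𝒜) ℤ :=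
  resGradedComplex (mem_envGrading_left (𝒜 := 𝒜)) R

/-- Restriction of complexes of graded `Aᵉ`-modules to graded left `Aᵐᵒᵖ`-modules. -/
abbrev gradedRightComplex (R : CochainComplex (GrMod (envGrading 𝒜)) ℤ) :
    CochainComplex (GrMod (opGrading 𝒜)) ℤ :=
  resGradedComplex (mem_envGrading_right (𝒜 := 𝒜)) R

theorem mem_iSup_grading (a : A) : a ∈ ⨆ g, 𝒜 g := by
  refine internal_induction (p := fun a => a ∈ ⨆ g, 𝒜 g)
    (DirectSum.Decomposition.isInternal 𝒜) a (zero_mem _)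
    (fun g _ ha => Submodule.mem_iSup_of_mem g ha) (fun _ _ hx hy => add_mem hx hy)

theorem mem_iSup_opGrading (a : Aᵐᵒᵖ) : a ∈ ⨆ g, opGrading 𝒜 g := by
  refine Submodule.iSup_induction 𝒜 (motive := fun a => MulOpposite.op a ∈ ⨆ g, opGrading 𝒜 g)
    (mem_iSup_grading 𝒜 a.unop) (fun g a ha => Submodule.mem_iSup_of_mem g ⟨a, ha, rfl⟩)
    (zero_mem _) (fun a b ha hb => ?_)
  rw [MulOpposite.op_add]
  exact add_mem ha hb

/-- `G`-graded dualizing complexes over `A`: bounded complexes of graded `Aᵉ`-modules such that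
* the cohomology modules are finitely generated on both sides,
* the injective dimension is finite on both sides,
* the natural maps `Aᵐᵒᵖ → RHOM_A(R, R)` and `A → RHOM_{Aᵐᵒᵖ}(R, R)` are isomorphisms in the
  derived category, i.e. quasi-isomorphisms. Here `RHOM_A(R, R)` is `HOM_A(P, P)` for
  a right bounded projective resolution `P → R` by graded `Aᵉ`-modules. -/
structure IsGradedDualizingComplex (R : CochainComplex (GrMod (envGrading 𝒜)) ℤ) : Prop where
  bounded : IsBoundedComplex R
  finite_left : ∀ n, Module.Finite A ((gradedLeftComplex 𝒜 R).homology n)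
  finite_right : ∀ n, Module.Finite Aᵐᵒᵖ ((gradedRightComplex 𝒜 R).homology n)
  injDim_left : ∃ n, HasInjDimLE (gradedLeftComplex 𝒜 R) n
  injDim_right : ∃ n, HasInjDimLE (gradedRightComplex 𝒜 R) n
  nat_left : ∃ (P : CochainComplex (GrMod (envGrading 𝒜)) ℤ) (f : P ⟶ R),
    IsProjResolution f ∧
    QuasiIso (gradedNatMap (left_right_commute k A) (mem_envGrading_left (𝒜 := 𝒜))
      (mem_envGrading_right (𝒜 := 𝒜)) (mem_iSup_opGrading 𝒜) P)
  nat_right : ∃ (P : CochainComplex (GrMod (envGrading 𝒜)) ℤ) (f : P ⟶ R),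
    IsProjResolution f ∧
    QuasiIso (gradedNatMap (fun b a => (left_right_commute k A a b).symm)
      (mem_envGrading_right (𝒜 := 𝒜)) (mem_envGrading_left (𝒜 := 𝒜)) (mem_iSup_grading 𝒜) P)

/-- The change of grading functor `φ_!` on complexes of graded `Aᵉ`-modules. -/
abbrev pushComplex {H : Type w} [DecidableEq H] [AddCommGroup H] (φ : G →+ H)
    (R : CochainComplex (GrMod (envGrading 𝒜)) ℤ) :
    CochainComplex (GrMod (envGrading (pushGrading φ 𝒜))) ℤ :=
  ((GrMod.push φ (envGrading (pushGrading φ 𝒜))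
    fun h => (envGrading_pushGrading φ h).le).mapHomologicalComplex _).obj R

/-- A `ℤ^r`-graded algebra `A` is connected `ℕ^r`-graded: its support is contained in `ℕ^r`
and `A_0 = k`. -/
structure IsConnectedGraded {r : ℕ} (𝒜 : (Fin r → ℤ) → Submodule k A) : Prop where
  eq_bot : ∀ g, ¬ 0 ≤ g → 𝒜 g = ⊥
  injective : Function.Injective (algebraMap k A)
  zero_eq : 𝒜 0 = LinearMap.range (Algebra.linearMap k A)

end Dualizing

end

/-!
The change of grading functor `φ_!` and the functor forgetting the grading do not change the
underlying complex of `Aᵉ`-modules. It therefore suffices to show that each condition in the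
definition of a graded dualizing complex is equivalent to its ungraded counterpart. This is done
on each side separately, for a noetherian algebra `B` with a `ℤ^r`-grading supported in `ℕ^r`
and a bounded complex `R` with finitely generated cohomology. The group `ℤ^r` is ordered
lexicographically; then `ℕ^r` is well-ordered, and elements and linear maps have leading components.

*Injective dimension.* The graded and the ungraded injective dimension of `R` are in fact equal
(`hasInjDimLE_forgetComplex_iff`), which is sharper than the bound that differs by one. In both
directions a complex has injective dimension at most `n` as soon as the cocycles of degree `n` of
its injective resolutions are injective, and this is a statement about `Ext^(n+1)`. For graded
modules a homogeneous cocycle on a graded projective resolution that is a coboundary is the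
coboundary of a homogeneous cochain, so that vanishing of `Ext` in the category of modules gives
vanishing in the category of graded modules (`HasInjDimLE.of_forget`).

The other direction is `HasInjDimLE.forgetComplex`. By Baer's criterion, only `Ext^(n+1)(B/L, R)`
has to vanish, where `L` is a left ideal that need not be homogeneous. Division with remainder
(`GrMod.exists_standard_basis`), as in the theory of Gröbner bases, gives a resolution of `B/L` by
finitely generated graded free modules whose differentials are strict for the filtrations by degree
but not homogeneous (`exists_filteredResolution`). The associated graded complex is a complex of
graded modules that is exact in negative degrees (`FilteredResolution.exactAt_gr`), and hence its
homogeneous cocycles of degree `n + 1` with values in `R` are coboundaries. Subtracting coboundaries,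
the leading component of a cocycle on the resolution itself is removed again and again
(`FilteredComplex.exists_δ_eq`). This terminates because `R` can be replaced by a subcomplex whose
modules have well-ordered sets of degrees (`exists_quasiIso_isWFGraded`).

*The natural maps.* The natural map to `Hom_B(P, P)` factors through the inclusion of `HOM_B(P, P)`.
The inclusion is a quasi-isomorphism (`quasiIso_gradedHomInclusion`): `P` is homotopy equivalent to
a resolution by finitely generated graded free modules, and all cochains from the latter to
the bounded complex `R` have only finitely many nonzero homogeneous components.
-/

noncomputable section

open CategoryTheory CategoryTheory.Limits
open scoped TensorProduct DirectSum

/-! ### Cochains and quasi-isomorphisms in abelian categories -/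

section Resolutions

open CochainComplex HomComplex

variable {C : Type*} [Category* C] [Abelian C]

theorem acyclic_mappingCone {K L : CochainComplex C ℤ} (f : K ⟶ L) [QuasiIso f] :
    (mappingCone f).Acyclic := by
  rw [← HomotopyCategory.quotient_obj_mem_subcategoryAcyclic_iff_acyclic]
  have h : (HomotopyCategory.subcategoryAcyclic C).trW ((HomotopyCategory.quotient C _).map f) := by
    rw [← HomotopyCategory.quasiIso_eq_trW_subcategoryAcyclic,
      HomotopyCategory.quotient_map_mem_quasiIso_iff, HomologicalComplex.mem_quasiIso_iff]
    infer_instance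
  exact (ObjectProperty.trW_iff_of_distinguished _ _
    (HomotopyCategory.mappingCone_triangleh_distinguished f)).1 h

/-- Cocycles of all degrees from a K-projective complex to an acyclic complex are coboundaries. -/
theorem exists_δ_eq_of_acyclic {K L : CochainComplex C ℤ} [K.IsKProjective]
    (hL : L.Acyclic) {n m : ℤ} (hm : m + 1 = n) (z : Cochain K L n)
    (hz : δ n (n + 1) z = 0) : ∃ α : Cochain K L m, δ m n α = z := by
  let z' : Cocycle (K⟦-n⟧) L 0 := (Cocycle.mk z (n + 1) rfl hz).leftShift (-n) 0 (by simp)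
  obtain ⟨φ, hφ⟩ := (Cocycle.equivHom _ _).surjective z'
  obtain ⟨h⟩ := IsKProjective.nonempty_homotopy_zero φ hL
  obtain ⟨α, hα⟩ := Cochain.equivHomotopy _ _ h
  have h1 : (Cochain.ofHom φ) = z.leftShift (-n) 0 (by simp) := congrArg Subtype.val hφ
  rw [Cochain.ofHom_zero, add_zero, h1] at hα
  refine ⟨(-n).negOnePow • α.leftUnshift m (by lia), ?_⟩
  rw [δ_units_smul, Cochain.δ_leftUnshift α m (by lia) n 0 (by simp), ← hα,
    Cochain.leftUnshift_leftShift, smul_smul, Int.units_mul_self, one_smul]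

variable {K K' L L' : CochainComplex C ℤ}

/-- Cocycles from a K-projective complex lift along quasi-isomorphisms, up to coboundaries. -/
theorem exists_lift_of_quasiIso [K.IsKProjective] (f : L ⟶ L') [QuasiIso f] {n m : ℤ}
    (hm : m + 1 = n) (z : Cochain K L' n) (hz : δ n (n + 1) z = 0) :
    ∃ (w : Cochain K L n) (u : Cochain K L' m), δ n (n + 1) w = 0 ∧
      z = w.comp (Cochain.ofHom f) (add_zero n) + δ m n u := by
  obtain ⟨α, hα⟩ := exists_δ_eq_of_acyclic (acyclic_mappingCone f) hm
    (z.comp (Cochain.ofHom (mappingCone.inr f)) (add_zero n))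
    (by rw [δ_comp_ofHom, hz, Cochain.zero_comp])
  refine ⟨α.comp (mappingCone.fst f).1 hm, α.comp (mappingCone.snd f) (add_zero m), ?_, ?_⟩
  · rw [δ_comp _ _ hm n 2 (n + 1) rfl hm rfl, hα, Cocycle.δ_eq_zero, Cochain.comp_zero, zero_add,
      Cochain.comp_assoc_of_second_is_zero_cochain, mappingCone.inr_fst, Cochain.comp_zero,
      smul_zero]
  · rw [δ_comp _ _ (add_zero m) n 1 n hm hm (zero_add 1), hα, mappingCone.δ_snd,
      Cochain.comp_neg, Int.negOnePow_zero, one_smul, Cochain.comp_assoc_of_second_is_zero_cochain,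
      mappingCone.inr_snd, Cochain.comp_id,
      Cochain.comp_assoc_of_third_is_zero_cochain]
    abel

/-- A cocycle from a K-projective complex that becomes a coboundary after composition with a
quasi-isomorphism is a coboundary. -/
theorem exists_δ_eq_of_comp_quasiIso [K.IsKProjective] (f : L ⟶ L') [QuasiIso f] {n m : ℤ}
    (hm : m + 1 = n) (z : Cochain K L n) (hz : δ n (n + 1) z = 0) (u : Cochain K L' m)
    (hu : δ m n u = z.comp (Cochain.ofHom f) (add_zero n)) :
    ∃ v : Cochain K L m, δ m n v = z := by
  have hm' : n + -1 = m := by lia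
  obtain ⟨γ, hγ⟩ := exists_δ_eq_of_acyclic (K := K) (acyclic_mappingCone f) (n := m) (m := m - 1)
    (by lia) (z.comp (mappingCone.inl f) hm' -
      u.comp (Cochain.ofHom (mappingCone.inr f)) (add_zero m)) (by
      obtain rfl : n = m + 1 := hm.symm
      rw [δ_sub, δ_comp _ _ hm' (m + 1 + 1) 0 (m + 1) rfl rfl (by lia), hz, Cochain.zero_comp,
        smul_zero, add_zero, mappingCone.δ_inl, δ_comp_ofHom, hu,
        Cochain.comp_assoc_of_second_is_zero_cochain, Cochain.ofHom_comp, sub_self])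
  refine ⟨-γ.comp (mappingCone.fst f).1 (by lia), ?_⟩
  rw [δ_neg, δ_comp _ _ (by lia : m - 1 + 1 = m) m 2 n hm (by lia) rfl, hγ, Cocycle.δ_eq_zero,
    Cochain.comp_zero, zero_add, Cochain.sub_comp, Cochain.comp_assoc _ _ _ hm' (neg_add_cancel 1) (by lia),
    mappingCone.inl_fst, Cochain.comp_id, Cochain.comp_assoc_of_second_is_zero_cochain,
    mappingCone.inr_fst, Cochain.comp_zero, sub_zero, Int.negOnePow_one, Units.neg_smul, one_smul,
    neg_neg]

/-- Cocycles to a K-injective complex extend along quasi-isomorphisms, up to coboundaries. -/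
theorem exists_extend_of_quasiIso [L.IsKInjective] (f : K ⟶ K') [QuasiIso f] {n m : ℤ}
    (hm : m + 1 = n) (z : Cochain K L n) (hz : δ n (n + 1) z = 0) :
    ∃ (w : Cochain K' L n) (u : Cochain K L m), δ n (n + 1) w = 0 ∧
      z = (Cochain.ofHom f).comp w (zero_add n) + δ m n u := by
  have h1 : 1 + n = n + 1 := add_comm _ _
  have h2 : -1 + n = m := by lia
  obtain ⟨α, hα⟩ := IsKInjective.eq_δ_of_cocycle (L := L) (Cocycle.mk
    ((mappingCone.fst f).1.comp z h1) (n + 1 + 1) rfl (by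
      rw [δ_comp _ _ h1 2 (n + 1) (n + 1 + 1) rfl rfl rfl, hz, Cochain.comp_zero,
        Cocycle.δ_eq_zero, Cochain.zero_comp, smul_zero, add_zero])) (acyclic_mappingCone f) n rfl
  rw [Cocycle.mk_coe] at hα
  refine ⟨-(n.negOnePow • (Cochain.ofHom (mappingCone.inr f)).comp α (zero_add n)),
    (mappingCone.inl f).comp α h2, ?_, ?_⟩
  · rw [δ_neg, δ_units_smul, δ_ofHom_comp, hα, mappingCone.inr_fst_assoc, smul_zero, neg_zero]
  · rw [δ_comp _ _ h2 0 (n + 1) n hm rfl (by lia), hα, mappingCone.inl_fst_assoc,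
      mappingCone.δ_inl, Cochain.comp_neg, Cochain.comp_units_smul, Cochain.ofHom_comp,
      Cochain.comp_assoc_of_first_is_zero_cochain]
    abel

/-- A cocycle to a K-injective complex that becomes a coboundary after composition with a
quasi-isomorphism is a coboundary. -/
theorem exists_δ_eq_of_quasiIso_comp [L.IsKInjective] (f : K ⟶ K') [QuasiIso f] {n m : ℤ}
    (hm : m + 1 = n) (z : Cochain K' L n) (hz : δ n (n + 1) z = 0) (u : Cochain K L m)
    (hu : δ m n u = (Cochain.ofHom f).comp z (zero_add n)) :
    ∃ v : Cochain K' L m, δ m n v = z := by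
  have h1 : 1 + m = n := by lia
  obtain ⟨γ, hγ⟩ := IsKInjective.eq_δ_of_cocycle (L := L) (Cocycle.mk
    ((mappingCone.snd f).comp z (zero_add n) + n.negOnePow • (mappingCone.fst f).1.comp u h1)
      (n + 1) rfl (by
      rw [δ_add, δ_units_smul, δ_comp _ _ h1 2 n (n + 1) rfl rfl hm, hu, Cocycle.δ_eq_zero,
        Cochain.zero_comp, smul_zero, add_zero,
        δ_comp _ _ (zero_add n) 1 (n + 1) (n + 1) rfl (zero_add 1) rfl, hz, Cochain.comp_zero,
        zero_add, mappingCone.δ_snd, Cochain.neg_comp, smul_neg,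
        Cochain.comp_assoc_of_second_is_zero_cochain, neg_add_cancel]))
    (acyclic_mappingCone f) m hm
  rw [Cocycle.mk_coe] at hγ
  refine ⟨(Cochain.ofHom (mappingCone.inr f)).comp γ (zero_add m), ?_⟩
  rw [δ_ofHom_comp, hγ, Cochain.comp_add, mappingCone.inr_snd_assoc, Cochain.comp_units_smul,
    mappingCone.inr_fst_assoc, smul_zero, add_zero]

theorem quasiIso_of_ofHom_eq_δ_add {f g : K ⟶ L} [QuasiIso f] (u : Cochain K L (-1))
    (h : Cochain.ofHom f = δ (-1) 0 u + Cochain.ofHom g) : QuasiIso g := by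
  have e : Homotopy f g := (Cochain.equivHomotopy f g).symm ⟨u, h⟩
  refine ⟨fun i => ?_⟩
  rw [quasiIsoAt_iff_isIso_homologyMap, ← e.homologyMap_eq i]
  infer_instance

/-- Morphisms to a K-injective complex extend along quasi-isomorphisms to quasi-isomorphisms, if
they are quasi-isomorphisms themselves. -/
theorem exists_quasiIso_of_quasiIso [L.IsKInjective] (f : K ⟶ K') [QuasiIso f] (g : K ⟶ L)
    [QuasiIso g] : ∃ g' : K' ⟶ L, QuasiIso g' := by
  obtain ⟨w, u, hw, hu⟩ := exists_extend_of_quasiIso f (by lia : (-1 : ℤ) + 1 = 0)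
    (Cochain.ofHom g) (δ_ofHom g)
  obtain ⟨g', hg'⟩ := (Cocycle.equivHom _ _).surjective (Cocycle.mk w _ rfl hw)
  have hg'' : Cochain.ofHom g' = w := congrArg Subtype.val hg'
  rw [← hg'', ← Cochain.ofHom_comp, add_comm] at hu
  have := quasiIso_of_ofHom_eq_δ_add u hu
  exact ⟨g', quasiIso_of_comp_left f g'⟩

theorem HasInjDimLE.of_quasiIso_comp {n : ℤ} (f : K ⟶ K') [QuasiIso f] (h : HasInjDimLE K' n) :
    HasInjDimLE K n := by
  obtain ⟨I, g, hg, h⟩ := h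
  exact ⟨I, f ≫ g, inferInstance, h⟩

theorem HasInjDimLE.of_quasiIso {n : ℤ} (f : K ⟶ K') [QuasiIso f] (h : HasInjDimLE K n) :
    HasInjDimLE K' n := by
  obtain ⟨I, g, hg, hI, ⟨a, ha⟩, hn⟩ := h
  have := isKInjective_of_injective I a
  obtain ⟨g', hg'⟩ := exists_quasiIso_of_quasiIso f g
  exact ⟨I, g', hg', hI, ⟨a, ha⟩, hn⟩

theorem HasInjDimLE.exactAt {n : ℤ} (h : HasInjDimLE K n) (i : ℤ) (hi : n < i) :
    K.ExactAt i := by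
  obtain ⟨I, g, hg, hI, ⟨a, ha⟩, hn⟩ := h
  rw [HomologicalComplex.exactAt_iff_isZero_homology]
  exact ((I.exactAt_of_isLE n i hi).isZero_homology).of_iso
    (asIso (HomologicalComplex.homologyMap g i))

/-- `Ext` in degrees greater than the injective dimension vanishes: if `P` is K-projective and
concentrated in cohomological degrees `≥ 0`, then all cocycles `P → K` of degree greater than the
injective dimension of `K` are coboundaries. -/
theorem HasInjDimLE.exists_δ_eq {n : ℤ} (h : HasInjDimLE K n) (P : CochainComplex C ℤ)
    [P.IsKProjective] [P.IsGE 0] {i m : ℤ} (hm : m + 1 = i) (hi : n < i) (z : Cochain P K i)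
    (hz : δ i (i + 1) z = 0) : ∃ u : Cochain P K m, δ m i u = z := by
  obtain ⟨I, g, hg, hI, ⟨a, ha⟩, hn⟩ := h
  have := isKInjective_of_injective I a
  have : QuasiIso (P.πTruncGE 0) := (P.quasiIso_πTruncGE_iff 0).2 inferInstance
  obtain ⟨w, u, -, hu⟩ := exists_extend_of_quasiIso (P.πTruncGE 0) hm
    (z.comp (Cochain.ofHom g) (add_zero i)) (by rw [δ_comp_ofHom, hz, Cochain.zero_comp])
  -- `w` is a cochain of degree `i > n` between complexes supported in degrees `≥ 0` and `≤ n`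
  have hw : w = 0 := by
    ext p q hpq
    by_cases hp : p < 0
    · exact (isZero_of_isStrictlyGE _ 0 p hp).eq_of_src _ _
    · exact (I.isZero_of_isStrictlyLE n q (by lia)).eq_of_tgt _ _
  rw [hw, Cochain.comp_zero, zero_add] at hu
  exact exists_δ_eq_of_comp_quasiIso g hm z hz u hu.symm

/-- The vanishing of `Ext^(n+1)(S.X₃, K)`, computed with a projective resolution of `S.X₃`,
allows to extend maps to the cocycles of degree `n` of an injective resolution of `K`. -/
theorem exists_extend_of_forall_exists_δ_eq {J : CochainComplex C ℤ} (j : K ⟶ J) [QuasiIso j]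
    (hJ : ∀ i, Injective (J.X i)) (a : ℤ) [J.IsStrictlyGE a] (S : ShortComplex C)
    (hS : S.ShortExact) {P : CochainComplex C ℤ} [P.IsKProjective]
    (p : P ⟶ (singleFunctor C 0).obj S.X₃) [QuasiIso p] (n : ℤ)
    (hP : ∀ z : Cochain P K (n + 1), δ (n + 1) (n + 1 + 1) z = 0 →
      ∃ u : Cochain P K n, δ n (n + 1) u = z)
    (f : S.X₁ ⟶ J.X n) (hf : f ≫ J.d n (n + 1) = 0) :
    ∃ g : S.X₂ ⟶ J.X n, g ≫ J.d n (n + 1) = 0 ∧ S.f ≫ g = f := by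
  have := isKInjective_of_injective J a
  have := hS.mono_f
  have := hS.epi_g
  let F : S.X₂ ⟶ J.X n := Injective.factorThru f S.f
  have hF : S.f ≫ F = f := Injective.comp_factorThru f S.f
  obtain ⟨u, hu⟩ : ∃ u : S.X₃ ⟶ J.X (n + 1), S.g ≫ u = F ≫ J.d n (n + 1) :=
    ⟨hS.exact.desc (F ≫ J.d n (n + 1)) (by rw [← Category.assoc, hF, hf]), hS.exact.g_desc _ _⟩
  have hud : u ≫ J.d (n + 1) (n + 2) = 0 := by
    rw [← cancel_epi S.g, ← Category.assoc, hu, Category.assoc, J.d_comp_d, comp_zero, comp_zero]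
  let z : Cochain ((singleFunctor C 0).obj S.X₃) J (n + 1) :=
    Cochain.fromSingleMk u (zero_add (n + 1))
  have hz : δ (n + 1) (n + 1 + 1) z = 0 := by
    rw [Cochain.δ_fromSingleMk u (zero_add (n + 1)) (n + 1 + 1) (n + 2) (by lia), hud,
      Cochain.fromSingleMk_zero]
  obtain ⟨w, t, hw, ht⟩ := exists_lift_of_quasiIso j (rfl : n + 1 = n + 1)
    ((Cochain.ofHom p).comp z (zero_add _)) (by rw [δ_ofHom_comp, hz, Cochain.comp_zero])
  obtain ⟨y, rfl⟩ := hP w hw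
  obtain ⟨v, hv⟩ := exists_δ_eq_of_quasiIso_comp p (rfl : n + 1 = n + 1) z hz
    (y.comp (Cochain.ofHom j) (add_zero n) + t) (by rw [δ_add, δ_comp_ofHom, ht])
  obtain ⟨v, rfl⟩ := Cochain.fromSingleMk_surjective v n (zero_add n)
  rw [Cochain.δ_fromSingleMk v (zero_add n) (n + 1) (n + 1) (by lia)] at hv
  have hv' : v ≫ J.d n (n + 1) = u := (Cochain.fromSingleEquiv (zero_add (n + 1))).symm.injective hv
  refine ⟨F - S.g ≫ v, ?_, ?_⟩
  · rw [Preadditive.sub_comp, Category.assoc, hv', hu, sub_self]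
  · rw [Preadditive.comp_sub, hF, S.zero_assoc, zero_comp, sub_zero]

/-- A bounded below complex has injective dimension at most `n` if it is exact in degrees `> n`
and the cocycles of degree `n` in its injective resolutions are injective. -/
theorem hasInjDimLE_of_injective_cycles [EnoughInjectives C] (a : ℤ) [K.IsStrictlyGE a] (n : ℤ)
    (hK : ∀ i, n < i → K.ExactAt i)
    (h : ∀ (J : CochainComplex C ℤ) (j : K ⟶ J), QuasiIso j → (∀ i, Injective (J.X i)) →
      J.IsStrictlyGE a → Injective (J.cycles n)) : HasInjDimLE K n := by
  obtain ⟨J, j, hj, hJ, hJa⟩ := Plus.modelCategoryQuillen.exists_quasiIso_injective K a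
  have hZ := h J j hj hJ hJa
  have hI (i : ℤ) : Injective ((J.truncLE n).X i) := by
    obtain hi | rfl | hi := lt_trichotomy i n
    · exact Injective.of_iso (J.truncLEXIso n i hi).symm (hJ i)
    · exact Injective.of_iso (J.truncLEXIsoCycles i).symm hZ
    · exact (isZero_of_isStrictlyLE _ n _ hi).injective
  have : QuasiIso (J.ιTruncLE n) := by
    rw [quasiIso_ιTruncLE_iff, isLE_iff]
    intro i hi
    rw [HomologicalComplex.exactAt_iff_isZero_homology]
    exact ((hK i hi).isZero_homology).of_iso (asIso (HomologicalComplex.homologyMap j i)).symm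
  have hIa : (J.truncLE n).IsStrictlyGE a := inferInstance
  have := isKInjective_of_injective (J.truncLE n) a
  obtain ⟨r, hr⟩ := exists_quasiIso_of_quasiIso (J.ιTruncLE n) (𝟙 (J.truncLE n))
  exact ⟨J.truncLE n, j ≫ r, inferInstance, hI, ⟨a, hIa⟩, inferInstance⟩

end Resolutions

/-! ### Graded modules: exactness and homogeneous components -/

section GradedModules

variable {k : Type v} [CommRing k] {G : Type} [DecidableEq G] [AddCommGroup G]
  {B : Type u} [Ring B] [Algebra k B] {ℬ : G → Submodule k B}

namespace GrMod

instance : (forget ℬ).Faithful where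
  map_injective h := hom_ext (congrArg ModuleCat.Hom.hom h)

theorem mono_of_injective {M N : GrMod ℬ} (f : M ⟶ N) (h : Function.Injective (lin f)) :
    Mono f := by
  have : Mono ((forget ℬ).map f) := (ModuleCat.mono_iff_injective _).2 h
  exact (forget ℬ).mono_of_mono_map this

theorem epi_of_surjective {M N : GrMod ℬ} (f : M ⟶ N) (h : Function.Surjective (lin f)) :
    Epi f := by
  have : Epi ((forget ℬ).map f) := (ModuleCat.epi_iff_surjective _).2 h
  exact (forget ℬ).epi_of_epi_map this

instance : (forget ℬ).PreservesHomology := by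
  refine ((forget ℬ).exact_tfae.out 0 2).1 fun S hS => ?_
  have := hS.mono_f
  have := hS.epi_g
  exact
    { exact := by
        rw [ShortComplex.moduleCat_exact_iff]
        intro x hx
        let l := hS.exact.lift (kerι S.g) (kerι_comp S.g)
        have hl : l ≫ S.f = kerι S.g := hS.exact.lift_f _ _
        exact ⟨lin l ⟨x, hx⟩, congrArg (fun z : ker S.g ⟶ S.X₂ => lin z ⟨x, hx⟩) hl⟩
      mono_f := (ModuleCat.mono_iff_injective _).2 (injective_of_mono S.f)
      epi_g := (ModuleCat.epi_iff_surjective _).2 (surjective_of_epi S.g) }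

theorem exact_iff (S : ShortComplex (GrMod ℬ)) :
    S.Exact ↔ ∀ x : S.X₂, lin S.g x = 0 → ∃ y : S.X₁, lin S.f y = x := by
  rw [← S.exact_map_iff_of_faithful (forget ℬ), ShortComplex.moduleCat_exact_iff]
  rfl

/-- The component of degree `g` of an element of a graded module. -/
abbrev proj (M : GrMod ℬ) (g : G) : M →+ M := internalProj M.isInternal g

variable (M : GrMod ℬ) {N P : GrMod ℬ}

theorem proj_proj (g h : G) (x : M) : M.proj h (M.proj g x) = if g = h then M.proj g x else 0 := by
  split_ifs with hgh
  · subst hgh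
    exact internalProj_same _ (internalProj_mem _ _ _)
  · exact internalProj_ne _ hgh (internalProj_mem _ _ _)

variable {M}

theorem proj_of_mem {g : G} {x : M} (hx : x ∈ M.gr g) (h : G) :
    M.proj h x = if g = h then x else 0 := by
  split_ifs with hgh
  · subst hgh
    exact internalProj_same _ hx
  · exact internalProj_ne _ hgh hx

theorem eq_zero_of_proj {x : M} (h : ∀ g, M.proj g x = 0) : x = 0 := by
  have hx := mem_closure_internalProj M.isInternal x
  have : Set.range (fun g => internalProj M.isInternal g x) ⊆ {0} := by
    rintro _ ⟨g, rfl⟩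
    exact h g
  exact (AddSubmonoid.closure_le (S := (⊥ : AddSubmonoid M))).2 this hx

theorem ext_proj {x y : M} (h : ∀ g, M.proj g x = M.proj g y) : x = y :=
  sub_eq_zero.1 (eq_zero_of_proj fun g => by rw [map_sub, h, sub_self])

theorem proj_finite (x : M) : {g | M.proj g x ≠ 0}.Finite := by
  refine internal_induction (p := fun x => {g | M.proj g x ≠ 0}.Finite) M.isInternal x
    (by simp) ?_ ?_
  · intro g x hx
    refine (Set.finite_singleton g).subset fun h hh => ?_
    by_contra hne
    exact hh (internalProj_ne _ (Ne.symm hne) hx)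
  · intro x y hx hy
    refine (hx.union hy).subset fun g hg => ?_
    by_contra hne
    simp only [Set.mem_union, Set.mem_ofPred_eq, not_or, not_not] at hne
    exact hg (by rw [map_add, hne.1, hne.2, add_zero])

theorem sum_proj (x : M) (s : Finset G) (hs : ∀ g, M.proj g x ≠ 0 → g ∈ s) :
    ∑ g ∈ s, M.proj g x = x := by
  refine ext_proj fun h => ?_
  rw [map_sum]
  simp only [proj_proj]
  rw [Finset.sum_ite_eq']
  split_ifs with hh
  · rfl
  · by_contra h2
    exact hh (hs h (Ne.symm h2))

theorem sum_proj_toFinset (x : M) : ∑ g ∈ (proj_finite x).toFinset, M.proj g x = x :=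
  sum_proj x _ fun g hg => by simpa using hg

/-- Multiplication by a homogeneous element commutes with taking components. -/
theorem proj_smul {g : G} {b : B} (hb : b ∈ ℬ g) (h : G) (x : M) :
    M.proj h (b • x) = b • M.proj (h - g) x := by
  refine internal_induction (p := fun x => M.proj h (b • x) = b • M.proj (h - g) x)
    M.isInternal x (by simp) ?_ (fun x y hx hy => by simp [hx, hy])
  intro g' x hx
  rw [proj_of_mem (M.smul_mem' g g' b x hb hx), proj_of_mem hx]
  by_cases hg : g + g' = h
  · rw [if_pos hg, if_pos (by rw [← hg]; abel)]
  · rw [if_neg hg, if_neg (by rintro rfl; exact hg (by abel)), smul_zero]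

theorem _root_.homogeneous_induction (ℬ : G → Submodule k B) [GradedAlgebra ℬ] {p : B → Prop}
    (b : B) (zero : p 0) (homog : ∀ g, ∀ x ∈ ℬ g, p x) (add : ∀ x y, p x → p y → p (x + y)) : p b :=
  internal_induction (DirectSum.Decomposition.isInternal ℬ) b zero homog add

/-- The map underlying `homComp`. -/
def homCompAux (e : G) (f : M →+ N) : M →+ N :=
  letI := M.isInternal.chooseDecomposition
  (DirectSum.toAddMonoid fun g => ((N.proj (g + e)).comp f).comp (M.gr g).subtype).comp
    (DirectSum.decomposeAddEquiv M.gr).toAddMonoidHom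

theorem homCompAux_of_mem (e : G) (f : M →+ N) {g : G} {x : M} (hx : x ∈ M.gr g) :
    homCompAux e f x = N.proj (g + e) (f x) := by
  let _ := M.isInternal.chooseDecomposition
  change DirectSum.toAddMonoid _ (DirectSum.decompose M.gr x) = _
  rw [DirectSum.decompose_of_mem M.gr hx, DirectSum.toAddMonoid_of]
  rfl

theorem hom_ext_of_homogeneous {f f' : M →ₗ[B] N} (h : ∀ g, ∀ x ∈ M.gr g, f x = f' x) : f = f' :=
  LinearMap.ext fun x => internal_induction (p := fun x => f x = f' x) M.isInternal x (by simp) h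
    (fun x y hx hy => by rw [map_add, hx, hy, map_add])

variable [GradedAlgebra ℬ]

/-- The component of degree `e` of a linear map `f` between graded modules: it maps a homogeneous
element `x` of degree `g` to the component of degree `g + e` of `f x`. -/
def homComp (e : G) (f : M →ₗ[B] N) : M →ₗ[B] N where
  toFun := homCompAux e f.toAddMonoidHom
  map_add' := map_add _
  map_smul' b x := by
    refine homogeneous_induction ℬ (p := fun b => homCompAux e f.toAddMonoidHom (b • x) =
      b • homCompAux e f.toAddMonoidHom x) b (by simp) ?_
      (fun b c hb hc => by rw [add_smul, map_add, hb, hc, add_smul])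
    intro g b hb
    refine internal_induction (p := fun x => homCompAux e f.toAddMonoidHom (b • x) =
      b • homCompAux e f.toAddMonoidHom x) M.isInternal x (by simp) ?_
      (fun x y hx hy => by rw [smul_add, map_add, hx, hy, map_add, smul_add])
    intro h x hx
    rw [homCompAux_of_mem _ _ hx, homCompAux_of_mem _ _ (M.smul_mem' _ _ _ _ hb hx)]
    change N.proj _ (f (b • x)) = b • N.proj _ (f x)
    rw [map_smul, proj_smul hb]
    congr 3
    abel

theorem homComp_of_mem (e : G) (f : M →ₗ[B] N) {g : G} {x : M} (hx : x ∈ M.gr g) :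
    homComp e f x = N.proj (g + e) (f x) := homCompAux_of_mem _ _ hx

theorem homComp_mem (e : G) (f : M →ₗ[B] N) {g : G} {x : M} (hx : x ∈ M.gr g) :
    homComp e f x ∈ N.gr (g + e) := by
  rw [homComp_of_mem e f hx]
  exact internalProj_mem _ _ _

theorem homComp_add (e : G) (f f' : M →ₗ[B] N) :
    homComp e (f + f') = homComp e f + homComp e f' :=
  hom_ext_of_homogeneous fun g x hx => by
    simp only [homComp_of_mem e _ hx, LinearMap.add_apply, map_add]

theorem homComp_zero (e : G) : homComp e (0 : M →ₗ[B] N) = 0 :=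
  hom_ext_of_homogeneous fun g x hx => by
    simp only [homComp_of_mem e _ hx, LinearMap.zero_apply, map_zero]

theorem homComp_neg (e : G) (f : M →ₗ[B] N) : homComp e (-f) = -homComp e f :=
  hom_ext_of_homogeneous fun g x hx => by
    simp only [homComp_of_mem e _ hx, LinearMap.neg_apply, map_neg]

theorem homComp_of_homogeneous {d e : G} (f : M →ₗ[B] N)
    (hf : ∀ g, ∀ x ∈ M.gr g, f x ∈ N.gr (g + d)) : homComp e f = if d = e then f else 0 := by
  refine hom_ext_of_homogeneous fun g x hx => ?_
  rw [homComp_of_mem _ _ hx, proj_of_mem (hf g x hx)]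
  by_cases h : d = e
  · rw [if_pos h, if_pos (by rw [h])]
  · rw [if_neg h, if_neg (by simpa using h), LinearMap.zero_apply]

theorem homComp_lin_comp (e : G) (f : M ⟶ N) (f' : N →ₗ[B] P) :
    homComp e (f'.comp (lin f)) = (homComp e f').comp (lin f) :=
  hom_ext_of_homogeneous fun g x hx => by
    rw [homComp_of_mem _ _ hx, LinearMap.comp_apply, LinearMap.comp_apply,
      homComp_of_mem _ _ (lin_mem f hx)]

theorem homComp_comp_lin (e : G) (f : M →ₗ[B] N) (f' : N ⟶ P) :
    homComp e ((lin f').comp f) = (lin f').comp (homComp e f) :=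
  hom_ext_of_homogeneous fun g x hx => by
    rw [homComp_of_mem _ _ hx, LinearMap.comp_apply, LinearMap.comp_apply,
      homComp_of_mem _ _ hx, lin_proj]

theorem homComp_proj (e : G) (f : M →ₗ[B] N) (g : G) (x : M) :
    N.proj (g + e) (homComp e f x) = homComp e f (M.proj g x) := by
  refine internal_induction (p := fun x => N.proj (g + e) (homComp e f x) =
    homComp e f (M.proj g x)) M.isInternal x (by simp) ?_ (fun x y hx hy => by simp [hx, hy])
  intro h x hx
  rw [proj_of_mem (homComp_mem e f hx), proj_of_mem hx]
  by_cases hh : h = g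
  · rw [if_pos hh, if_pos (by rw [hh])]
  · rw [if_neg hh, if_neg (by simpa using hh), map_zero]

/-- A linear map with finitely many nonzero components is the sum of these components. -/
theorem sum_homComp_apply (f : M →ₗ[B] N) (s : Finset G) (hs : ∀ e, homComp e f ≠ 0 → e ∈ s) :
    ∑ e ∈ s, homComp e f = f := by
  refine hom_ext_of_homogeneous fun g x hx => ?_
  rw [LinearMap.sum_apply]
  simp only [homComp_of_mem _ _ hx]
  refine ext_proj fun h => ?_
  rw [map_sum]
  simp only [proj_proj]
  by_cases hh : h - g ∈ s
  · rw [Finset.sum_eq_single (h - g)]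
    · rw [add_sub_cancel, if_pos rfl]
    · intro e _ he
      rw [if_neg]
      rintro rfl
      exact he (by abel)
    · exact fun h => absurd hh h
  · rw [Finset.sum_eq_zero]
    · have h1 : homComp (h - g) f = 0 := by_contra fun h => hh (hs _ h)
      have h2 := homComp_of_mem (h - g) f hx
      rw [h1, add_sub_cancel] at h2
      exact h2
    · intro e he
      rw [if_neg]
      rintro rfl
      exact hh (by rwa [add_sub_cancel_left])

/-- Linear maps from finitely generated graded modules have finitely many nonzero components. -/
theorem homComp_finite [Module.Finite B M] (f : M →ₗ[B] N) : {e | homComp e f ≠ 0}.Finite := by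
  classical
  obtain ⟨s, hs⟩ := Module.Finite.fg_top (R := B) (M := M)
  have hfin : (⋃ x ∈ s, ⋃ g ∈ {g | M.proj g x ≠ 0},
      (fun h => h - g) '' {h | N.proj h (f (M.proj g x)) ≠ 0}).Finite :=
    s.finite_toSet.biUnion fun x _ => (proj_finite x).biUnion fun g _ => (proj_finite _).image _
  refine hfin.subset fun e he => ?_
  by_contra hne
  refine he (LinearMap.ext_on hs fun x hx => ?_)
  rw [← sum_proj_toFinset x, map_sum, LinearMap.zero_apply]
  refine Finset.sum_eq_zero fun g hg => ?_
  rw [homComp_of_mem _ _ (internalProj_mem _ _ _)]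
  by_contra h2
  refine hne ?_
  simp only [Set.mem_iUnion]
  exact ⟨x, hx, g, by simpa using hg, g + e, h2, add_sub_cancel_left g e⟩

end GrMod

end GradedModules

/-! ### Degree shifts, free and projective graded modules -/

section GradedModules

variable {k : Type v} [CommRing k] {G : Type} [DecidableEq G] [AddCommGroup G]
  {B : Type u} [Ring B] [Algebra k B] {ℬ : G → Submodule k B}

namespace GrMod

theorem isInternal_shift (M : GrMod ℬ) (h : G) : DirectSum.IsInternal fun g => M.gr (g + h) := by
  refine isInternal_of_proj (fun g => M.gr (g + h)) (fun g => M.proj (g + h))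
    (fun _ _ hx => internalProj_same _ hx)
    (fun g g' hgg' x hx => internalProj_ne _ (fun h => hgg' (add_right_cancel h)) hx) fun x => ?_
  refine AddSubmonoid.closure_mono ?_ (mem_closure_internalProj M.isInternal x)
  rintro _ ⟨g, rfl⟩
  refine Set.mem_iUnion.2 ⟨g - h, ?_⟩
  change M.proj g x ∈ M.gr (g - h + h)
  rw [sub_add_cancel]
  exact internalProj_mem _ _ _

/-- The graded module with the components `M_(g + h)` in degree `g`. -/
def shiftObj (M : GrMod ℬ) (h : G) : GrMod ℬ where
  carrier := M
  gr g := M.gr (g + h)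
  isInternal := isInternal_shift M h
  smul_mem' g g' b m hb hm := by
    rw [add_assoc]
    exact M.smul_mem' g (g' + h) b m hb hm

/-- The degree shift: `(shift h M)_g = M_(g + h)`. -/
def shift (ℬ : G → Submodule k B) (h : G) : GrMod ℬ ⥤ GrMod ℬ where
  obj M := M.shiftObj h
  map {M N} f := ofLin (M := M.shiftObj h) (N := N.shiftObj h)
    (lin (M := M) (N := N) f) fun _ _ hx => lin_mem (M := M) (N := N) f hx

instance (h : G) : (shift ℬ h).Additive where
  map_add := rfl

instance (h : G) : (shift ℬ h).PreservesHomology := by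
  refine ((shift ℬ h).exact_tfae.out 0 2).1 fun S hS => ?_
  have := hS.mono_f
  have := hS.epi_g
  exact
    { exact := (exact_iff _).2 fun x hx => (exact_iff S).1 hS.exact x hx
      mono_f := mono_of_injective _ (injective_of_mono S.f)
      epi_g := epi_of_surjective _ (surjective_of_epi S.g) }

theorem injective_shift (h : G) (I : GrMod ℬ) [Injective I] : Injective ((shift ℬ h).obj I) where
  factors {X Y} f i _ := by
    have := mono_of_injective ((shift ℬ (-h)).map i) (injective_of_mono i)
    let f' : (shift ℬ (-h)).obj X ⟶ I := ofLin (M := (shift ℬ (-h)).obj X)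
      (lin (M := X) (N := (shift ℬ h).obj I) f) fun g x hx => by
      have := lin_mem (M := X) (N := (shift ℬ h).obj I) f (show x ∈ X.gr (g + -h) from hx)
      change _ ∈ I.gr (g + -h + h) at this
      rwa [neg_add_cancel_right] at this
    let e : (shift ℬ (-h)).obj Y ⟶ I := Injective.factorThru f' ((shift ℬ (-h)).map i)
    refine ⟨ofLin (M := Y) (N := (shift ℬ h).obj I) (lin (M := (shift ℬ (-h)).obj Y) (N := I) e)
      fun g x hx => ?_, ?_⟩
    · refine lin_mem (M := (shift ℬ (-h)).obj Y) (N := I) e (g := g + h) ?_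
      change x ∈ Y.gr (g + h + -h)
      rwa [add_neg_cancel_right]
    · exact hom_ext (congrArg (lin (M := (shift ℬ (-h)).obj X) (N := I))
        (Injective.comp_factorThru f' ((shift ℬ (-h)).map i)))

variable [GradedAlgebra ℬ]

variable (ℬ) in
/-- The component of degree `g` of an element of the algebra. -/
abbrev bproj (g : G) : B →+ B := internalProj (DirectSum.Decomposition.isInternal ℬ) g

theorem bproj_of_mem {g : G} {b : B} (hb : b ∈ ℬ g) (h : G) :
    bproj ℬ h b = if g = h then b else 0 := by
  split_ifs with hgh
  · subst hgh
    exact internalProj_same _ hb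
  · exact internalProj_ne _ hgh hb

theorem proj_smul_of_mem {M : GrMod ℬ} (g : G) {h : G} (b : B) {x : M} (hx : x ∈ M.gr h) :
    M.proj (g + h) (b • x) = bproj ℬ g b • x := by
  refine homogeneous_induction ℬ (p := fun b : B => M.proj (g + h) (b • x) =
    bproj ℬ g b • x) b ?_ ?_ ?_
  · rw [zero_smul, map_zero, map_zero, zero_smul]
  · intro g' b hb
    rw [proj_smul hb, proj_of_mem hx, bproj_of_mem hb]
    by_cases hg : g' = g
    · subst hg
      rw [if_pos (by abel), if_pos rfl]
    · rw [if_neg (fun h => hg (by rw [eq_sub_iff_add_eq, add_comm] at h; exact add_right_cancel h)),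
        if_neg hg, smul_zero, zero_smul]
  · intro b c hb hc
    rw [add_smul, map_add, hb, hc, map_add, add_smul]

/-- The free graded module with basis elements `e_i` in degree `deg i`. -/
def free (ℬ : G → Submodule k B) [GradedAlgebra ℬ] {ι : Type u} (deg : ι → G) : GrMod ℬ where
  carrier := ι →₀ B
  gr g :=
    { carrier := {x | ∀ i, x i ∈ ℬ (g - deg i)}
      add_mem' := fun hx hy i => add_mem (hx i) (hy i)
      zero_mem' := fun _ => zero_mem _
      neg_mem' := fun hx i => neg_mem (hx i) }
  isInternal := by
    classical
    refine isInternal_of_proj _ (fun g => Finsupp.liftAddHom fun i =>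
      (Finsupp.singleAddHom i).comp (bproj ℬ (g - deg i))) ?_ ?_ ?_
    · intro g x hx
      rw [Finsupp.liftAddHom_apply]
      conv_rhs => rw [← x.sum_single]
      exact Finsupp.sum_congr fun i _ => congrArg (Finsupp.single i) (internalProj_same _ (hx i))
    · intro g h hgh x hx
      rw [Finsupp.liftAddHom_apply]
      refine Finset.sum_eq_zero fun i _ => ?_
      change Finsupp.single i (bproj ℬ (h - deg i) (x i)) = 0
      rw [bproj_of_mem (hx i), if_neg (fun h => hgh (by simpa using h)), Finsupp.single_zero]
    · intro x
      induction x using Finsupp.induction_linear with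
      | zero => exact zero_mem _
      | add x y hx hy => exact add_mem hx hy
      | single i b =>
        refine homogeneous_induction ℬ (p := fun b => Finsupp.single i b ∈ AddSubmonoid.closure _)
          b (by rw [Finsupp.single_zero]; exact zero_mem _) ?_
          (fun b c hb hc => by rw [Finsupp.single_add]; exact add_mem hb hc)
        intro g b hb
        refine AddSubmonoid.subset_closure (Set.mem_iUnion.2 ⟨g + deg i, fun j => ?_⟩)
        rw [Finsupp.single_apply]
        split_ifs with hij
        · subst hij
          rwa [add_sub_cancel_right]
        · exact zero_mem _
  smul_mem' g h b x hb hx i := by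
    have := SetLike.GradedMul.mul_mem hb (hx i)
    rwa [← add_sub_assoc] at this

theorem mem_free_gr {ι : Type u} {deg : ι → G} {g : G} {x : ι →₀ B} :
    x ∈ (free ℬ deg).gr g ↔ ∀ i, x i ∈ ℬ (g - deg i) := Iff.rfl

omit [GradedAlgebra ℬ] in
theorem smul_mem_of_sub {M : GrMod ℬ} {g h : G} {b : B} {x : M} (hb : b ∈ ℬ (g - h))
    (hx : x ∈ M.gr h) : b • x ∈ M.gr g := by
  have := M.smul_mem' _ _ b x hb hx
  rwa [sub_add_cancel] at this

/-- The morphism from a free graded module given by the images of the basis elements. -/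
def freeDesc {ι : Type u} (deg : ι → G) (M : GrMod ℬ) (m : ι → M) (hm : ∀ i, m i ∈ M.gr (deg i)) :
    free ℬ deg ⟶ M :=
  ofLin (M := free ℬ deg) (Finsupp.linearCombination B m) fun _ _ hx =>
    sum_mem fun i _ => smul_mem_of_sub (mem_free_gr.1 hx i) (hm i)

instance {ι : Type u} (deg : ι → G) : Module.Free B (free ℬ deg) :=
  inferInstanceAs (Module.Free B (ι →₀ B))

instance {ι : Type u} [Finite ι] (deg : ι → G) : Module.Finite B (free ℬ deg) :=
  inferInstanceAs (Module.Finite B (ι →₀ B))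

/-- A graded module that is projective as a module is projective as a graded module: take the
component of degree `0` of a lift. -/
theorem projective_of_module_projective (P : GrMod ℬ) [Module.Projective B P] : Projective P where
  factors {X Y} f p _ := by
    obtain ⟨l, hl⟩ := Module.projective_lifting_property (lin p) (lin f) (surjective_of_epi p)
    refine ⟨ofLin (homComp 0 l) fun g x hx => ?_, hom_ext ?_⟩
    · have := homComp_mem 0 l hx
      rwa [add_zero] at this
    · rw [lin_comp, lin_ofLin, ← homComp_comp_lin, hl,
        homComp_of_homogeneous (d := 0) _ (fun g x hx => by rw [add_zero]; exact lin_mem f hx),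
        if_pos rfl]

/-- Each graded module is a quotient of a free graded module, with basis the homogeneous
elements of the module. -/
theorem exists_free_epi (M : GrMod ℬ) :
    ∃ (ι : Type u) (deg : ι → G) (p : free ℬ deg ⟶ M), Epi p := by
  refine ⟨M × ULift.{u} G, fun i => i.2.down, freeDesc _ M (fun i => M.proj i.2.down i.1)
    (fun i => internalProj_mem _ _ _), epi_of_surjective _ fun x => ?_⟩
  refine internal_induction (p := fun x => ∃ y, lin (freeDesc _ M
    (fun i : M × ULift.{u} G => M.proj i.2.down i.1) _) y = x) M.isInternal x
    ⟨0, map_zero _⟩ ?_ ?_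
  · intro g x hx
    refine ⟨(Finsupp.single (x, ⟨g⟩) 1 : M × ULift.{u} G →₀ B), ?_⟩
    refine (Finsupp.linearCombination_single B _ _).trans ?_
    rw [one_smul]
    exact internalProj_same _ hx
  · rintro x y ⟨x', hx⟩ ⟨y', hy⟩
    exact ⟨x' + y', by rw [map_add, hx, hy]⟩

instance : EnoughProjectives (GrMod ℬ) where
  presentation M := by
    obtain ⟨ι, deg, p, hp⟩ := exists_free_epi M
    have := projective_of_module_projective (free ℬ deg)
    exact ⟨{ p := free ℬ deg, f := p }⟩

theorem module_projective_of_projective (P : GrMod ℬ) [Projective P] : Module.Projective B P := by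
  obtain ⟨ι, deg, p, hp⟩ := exists_free_epi P
  let s : P ⟶ free ℬ deg := Projective.factorThru (𝟙 P) p
  exact Module.Projective.of_split (lin s) (lin p)
    (congrArg lin (Projective.factorThru_comp (𝟙 P) p))

theorem projective_iff (P : GrMod ℬ) : Projective P ↔ Module.Projective B P :=
  ⟨fun _ => module_projective_of_projective P, fun _ => projective_of_module_projective P⟩

end GrMod

end GradedModules

/-! ### Cofree graded modules and injective graded modules -/

section Cofree

variable {k : Type v} [CommRing k] {G : Type} [DecidableEq G] [AddCommGroup G]
  {B : Type u} [Ring B] [Algebra k B] (ℬ : G → Submodule k B) [GradedAlgebra ℬ]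

namespace GrMod

/-- The carrier of the cofree graded module on `E`: finitely supported families in `E`. It is not
given the componentwise action of `B`, but the action in which homogeneous elements of degree `g`
also shift the index by `g`. -/
def CofreeCarrier (_ : G → Submodule k B) (E : Type u) [AddCommGroup E] : Type u := G →₀ E

variable (E : Type u) [AddCommGroup E]

instance : AddCommGroup (CofreeCarrier ℬ E) := inferInstanceAs (AddCommGroup (G →₀ E))

variable [Module B E]

/-- The map `Σ x_h e_h ↦ Σ (b x_h) e_(g + h)`. -/
def shiftSMul (E : Type u) [AddCommGroup E] [Module B E] (g : G) (b : B) : (G →₀ E) →+ (G →₀ E) :=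
  (Finsupp.mapDomain.addMonoidHom (g + ·)).comp
    (Finsupp.mapRange.addMonoidHom (DistribSMul.toAddMonoidHom E b))

omit [DecidableEq G] in
theorem shiftSMul_single (g : G) (b : B) (h : G) (x : E) :
    shiftSMul E g b (Finsupp.single h x) = Finsupp.single (g + h) (b • x) := by
  simp [shiftSMul]

/-- The action of `⨁ g, ℬ g` on the cofree graded module. -/
def cofreeActionAux : (⨁ g, ℬ g) →+* AddMonoid.End (G →₀ E) :=
  DirectSum.toSemiring (R := AddMonoid.End (G →₀ E))
    (fun g =>
      { toFun := fun b : ℬ g => shiftSMul E g (b : B)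
        map_zero' := Finsupp.addHom_ext (N := G →₀ E) fun h x => by
          rw [shiftSMul_single, ZeroMemClass.coe_zero, zero_smul, Finsupp.single_zero]
          rfl
        map_add' := fun b c => Finsupp.addHom_ext (N := G →₀ E) fun h x => by
          change _ = shiftSMul E g (b : B) _ + shiftSMul E g (c : B) _
          rw [shiftSMul_single, shiftSMul_single, shiftSMul_single, Submodule.coe_add, add_smul,
            Finsupp.single_add] })
    (Finsupp.addHom_ext (N := G →₀ E) fun h x => by
      change shiftSMul E 0 (1 : B) _ = Finsupp.single h x
      rw [shiftSMul_single, one_smul, zero_add])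
    (fun {g g'} b b' => Finsupp.addHom_ext (N := G →₀ E) fun h x => by
      change shiftSMul E (g + g') (b * b' : B) _ = shiftSMul E g (b : B) (shiftSMul E g' (b' : B) _)
      rw [shiftSMul_single, shiftSMul_single, shiftSMul_single, smul_smul, add_assoc])

/-- The action of `B` on the cofree graded module. -/
def cofreeAction : B →+* AddMonoid.End (CofreeCarrier ℬ E) :=
  (cofreeActionAux ℬ E).comp (DirectSum.decomposeRingEquiv ℬ).toRingHom

instance : Module B (CofreeCarrier ℬ E) := Module.compHom _ (cofreeAction ℬ E)

variable {ℬ E}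

/-- The element of the cofree graded module with the single component `x` at `h`. -/
def cofreeSingle (ℬ : G → Submodule k B) (h : G) : E →+ CofreeCarrier ℬ E :=
  Finsupp.singleAddHom h

theorem smul_cofreeSingle {g : G} {b : B} (hb : b ∈ ℬ g) (h : G) (x : E) :
    b • cofreeSingle ℬ h x = cofreeSingle ℬ (g + h) (b • x) := by
  have h1 : cofreeAction ℬ E b = shiftSMul E g b := by
    refine (congrArg (cofreeActionAux ℬ E) (DirectSum.decompose_of_mem ℬ hb)).trans ?_
    exact DirectSum.toSemiring_of _ _ _ _ _
  exact (congrArg (fun F : (G →₀ E) →+ (G →₀ E) => F (Finsupp.single h x)) h1).trans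
    (shiftSMul_single E g b h x)

variable (ℬ E) in
/-- The cofree graded module on a module `E`. -/
def cofree : GrMod ℬ where
  carrier := CofreeCarrier ℬ E
  gr g := (cofreeSingle ℬ g : E →+ CofreeCarrier ℬ E).range
  isInternal := by
    refine isInternal_of_proj _ (fun g => (Finsupp.singleAddHom g).comp
      (Finsupp.applyAddHom g : (G →₀ E) →+ E)) ?_ ?_ ?_
    · rintro g _ ⟨x, rfl⟩
      exact congrArg (Finsupp.single g) Finsupp.single_eq_same
    · rintro g h hgh _ ⟨x, rfl⟩
      refine (congrArg (Finsupp.single h) ?_).trans (Finsupp.single_zero h)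
      exact Finsupp.single_eq_of_ne (Ne.symm hgh)
    · intro x
      refine Finsupp.induction_linear (motive := fun x : G →₀ E => (show CofreeCarrier ℬ E from x) ∈
        AddSubmonoid.closure _) x (zero_mem _) (fun x y hx hy => add_mem hx hy) fun g x => ?_
      exact AddSubmonoid.subset_closure (Set.mem_iUnion.2 ⟨g, ⟨x, rfl⟩⟩)
  smul_mem' := by
    rintro g h b _ hb ⟨x, rfl⟩
    exact ⟨b • x, (smul_cofreeSingle hb h x).symm⟩

/-- The counit `Σ x_g e_g ↦ Σ x_g` of the adjunction between `forget` and `cofree`. -/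
def cofreeSum (ℬ : G → Submodule k B) [GradedAlgebra ℬ] (E : Type u) [AddCommGroup E] [Module B E] :
    CofreeCarrier ℬ E →ₗ[B] E where
  toFun := Finsupp.liftAddHom (α := G) (M := E) (N := E) fun _ => AddMonoidHom.id E
  map_add' := map_add _
  map_smul' b x := by
    refine Finsupp.induction_linear (motive := fun x : G →₀ E => Finsupp.liftAddHom
      (fun _ => AddMonoidHom.id E) ((b • (show CofreeCarrier ℬ E from x) : CofreeCarrier ℬ E)) =
      b • Finsupp.liftAddHom (fun _ => AddMonoidHom.id E) x) x ?_ ?_ ?_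
    · refine (congrArg _ (smul_zero (A := CofreeCarrier ℬ E) b)).trans ?_
      rw [map_zero, smul_zero]
      exact map_zero _
    · intro x y hx hy
      refine (congrArg _ (smul_add (A := CofreeCarrier ℬ E) b x y)).trans ?_
      refine (map_add _ _ _).trans ?_
      rw [hx, hy, map_add, smul_add]
    · intro h x
      refine homogeneous_induction ℬ (p := fun b => Finsupp.liftAddHom (α := G) (M := E) (N := E)
        (fun _ => AddMonoidHom.id E) ((b • cofreeSingle ℬ h x : CofreeCarrier ℬ E)) =
        b • Finsupp.liftAddHom (fun _ => AddMonoidHom.id E) (Finsupp.single h x)) b ?_ ?_ ?_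
      · rw [zero_smul, zero_smul]
        exact map_zero _
      · intro g b hb
        rw [smul_cofreeSingle hb]
        exact (Finsupp.liftAddHom_apply_single _ _ _).trans
          (congrArg (b • ·) (Finsupp.liftAddHom_apply_single (fun _ => AddMonoidHom.id E) h x).symm)
      · intro b c hb hc
        rw [add_smul, add_smul, ← hb, ← hc]
        exact map_add _ _ _

theorem cofreeSum_single (g : G) (x : E) : cofreeSum ℬ E (cofreeSingle ℬ g x) = x :=
  Finsupp.liftAddHom_apply_single _ _ _

/-- The map `x ↦ Σ f(x_g) e_g` to the cofree graded module. -/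
def cofreeLiftAux {M : GrMod ℬ} (f : M →ₗ[B] E) : M →+ CofreeCarrier ℬ E :=
  letI := M.isInternal.chooseDecomposition
  (DirectSum.toAddMonoid fun g =>
    (cofreeSingle ℬ g).comp (f.toAddMonoidHom.comp (M.gr g).subtype)).comp
    (DirectSum.decomposeAddEquiv M.gr).toAddMonoidHom

omit [GradedAlgebra ℬ] in
theorem cofreeLiftAux_apply {M : GrMod ℬ} (f : M →ₗ[B] E) {g : G} {x : M} (hx : x ∈ M.gr g) :
    cofreeLiftAux f x = cofreeSingle ℬ g (f x) := by
  let _ := M.isInternal.chooseDecomposition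
  change DirectSum.toAddMonoid _ (DirectSum.decompose M.gr x) = _
  rw [DirectSum.decompose_of_mem M.gr hx, DirectSum.toAddMonoid_of]
  rfl

/-- The morphism `x ↦ Σ f(x_g) e_g` to the cofree graded module. -/
def cofreeLift {M : GrMod ℬ} (f : M →ₗ[B] E) : M ⟶ cofree ℬ E :=
  ofLin (N := cofree ℬ E)
    { toFun := cofreeLiftAux f
      map_add' := map_add _
      map_smul' := fun b x => by
        refine homogeneous_induction ℬ (p := fun b => cofreeLiftAux f (b • x) =
          b • cofreeLiftAux f x) b (by simp) ?_
          (fun b c hb hc => by rw [add_smul, map_add, hb, hc, add_smul])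
        intro g b hb
        refine internal_induction (p := fun x => cofreeLiftAux f (b • x) =
          b • cofreeLiftAux f x) M.isInternal x (by simp) ?_
          (fun x y hx hy => by rw [smul_add, map_add, hx, hy, map_add, smul_add])
        intro h x hx
        rw [cofreeLiftAux_apply f hx, cofreeLiftAux_apply f (M.smul_mem' _ _ _ _ hb hx),
          smul_cofreeSingle hb, map_smul] }
    fun g x hx => ⟨f x, (cofreeLiftAux_apply f hx).symm⟩

/-- The cofree graded module on an injective module is injective. -/
theorem injective_cofree [Module.Injective B E] : Injective (cofree ℬ E) where
  factors {X Y} f i _ := by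
    obtain ⟨l, hl⟩ := Module.Injective.out (lin i) (injective_of_mono i)
      ((cofreeSum ℬ E).comp (lin f))
    refine ⟨cofreeLift l, hom_ext (hom_ext_of_homogeneous fun g x hx => ?_)⟩
    refine (cofreeLiftAux_apply l (lin_mem i hx)).trans ?_
    rw [hl]
    obtain ⟨y, hy⟩ := lin_mem f hx
    refine Eq.trans ?_ hy
    exact congrArg _ ((congrArg (cofreeSum ℬ E) hy.symm).trans (cofreeSum_single g y))

instance : EnoughInjectives (GrMod ℬ) where
  presentation M := by
    let J := Injective.under ((forget ℬ).obj M)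
    let j : M →ₗ[B] J := (Injective.ι ((forget ℬ).obj M)).hom
    have hj : Function.Injective j := (ModuleCat.mono_iff_injective _).1 inferInstance
    have : Module.Injective B J := (Module.injective_iff_injective_object B J).2
      (inferInstanceAs (Injective (Injective.under ((forget ℬ).obj M))))
    have := injective_cofree (ℬ := ℬ) (E := J)
    refine ⟨{ J := cofree ℬ J, f := cofreeLift j, mono := mono_of_injective _ ?_ }⟩
    have h (x : M) : cofreeSum ℬ J (cofreeLiftAux j x) = j x := by
      refine internal_induction (p := fun x => cofreeSum ℬ J (cofreeLiftAux j x) = j x)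
        M.isInternal x (by simp) ?_ (fun x y hx hy => by rw [map_add, map_add, hx, hy, map_add])
      intro g x hx
      rw [cofreeLiftAux_apply j hx, cofreeSum_single]
    intro x y hxy
    exact hj (by rw [← h, ← h]; exact congrArg (cofreeSum ℬ J) hxy)

end GrMod

end Cofree

/-! ### Homogeneous components of cochains -/

section GradedCochains

open CochainComplex HomComplex

variable {k : Type v} [CommRing k] {G : Type} [DecidableEq G] [AddCommGroup G]
  {B : Type u} [Ring B] [Algebra k B] {ℬ : G → Submodule k B}
  {K L M : CochainComplex (GrMod ℬ) ℤ}

/-- The degree shift of a complex of graded modules. -/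
abbrev gradingShift (g : G) (L : CochainComplex (GrMod ℬ) ℤ) : CochainComplex (GrMod ℬ) ℤ :=
  ((GrMod.shift ℬ g).mapHomologicalComplex _).obj L

/-- The degree shift of a morphism of complexes of graded modules. -/
abbrev gradingShiftMap (g : G) (f : L ⟶ M) : gradingShift g L ⟶ gradingShift g M :=
  ((GrMod.shift ℬ g).mapHomologicalComplex _).map f

instance (g : G) : (GrMod.shift ℬ g).ReflectsIsomorphisms where
  reflects {M N} f _ := by
    have h1 := GrMod.injective_of_mono ((GrMod.shift ℬ g).map f)
    have h2 := GrMod.surjective_of_epi ((GrMod.shift ℬ g).map f)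
    have := GrMod.mono_of_injective f h1
    have := GrMod.epi_of_surjective f h2
    exact isIso_of_mono_of_epi f

instance (g : G) (f : L ⟶ M) [QuasiIso f] : QuasiIso (gradingShiftMap g f) :=
  (HomologicalComplex.quasiIso_map_iff_of_preservesHomology f (GrMod.shift ℬ g)).2 inferInstance

/-- The morphism of complexes of modules underlying a morphism of complexes of graded modules. -/
abbrev forgetMap (f : L ⟶ M) : forgetComplex L ⟶ forgetComplex M :=
  ((GrMod.forget ℬ).mapHomologicalComplex _).map f

instance (f : L ⟶ M) [QuasiIso f] : QuasiIso (forgetMap f) :=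
  (HomologicalComplex.quasiIso_map_iff_of_preservesHomology f (GrMod.forget ℬ)).2 inferInstance

/-- The homogeneous cochain of degree `g` given by a cochain to the degree shift by `g`. -/
def unshiftCochain (g : G) {n : ℤ} (w : Cochain K (gradingShift g L) n) :
    Cochain (forgetComplex K) (forgetComplex L) n :=
  w.map (GrMod.forget ℬ)

theorem unshiftCochain_mem (g : G) {n : ℤ} (w : Cochain K (gradingShift g L) n) :
    unshiftCochain g w ∈ homogCochain K L n g :=
  fun p q hpq _ _ hx => GrMod.lin_mem (w.v p q hpq) hx

theorem exists_unshiftCochain_eq {g : G} {n : ℤ}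
    {z : Cochain (forgetComplex K) (forgetComplex L) n} (hz : z ∈ homogCochain K L n g) :
    ∃ w : Cochain K (gradingShift g L) n, unshiftCochain g w = z :=
  ⟨Cochain.mk fun p q hpq => GrMod.ofLin (M := K.X p) (N := (GrMod.shift ℬ g).obj (L.X q))
    (z.v p q hpq).hom (hz p q hpq), rfl⟩

theorem unshiftCochain_injective (g : G) (n : ℤ) :
    Function.Injective (unshiftCochain g : Cochain K (gradingShift g L) n → _) := by
  intro w w' h
  ext p q hpq
  exact (GrMod.forget ℬ).map_injective (Cochain.congr_v h p q hpq)

theorem δ_unshiftCochain (g : G) (n m : ℤ) (w : Cochain K (gradingShift g L) n) :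
    δ n m (unshiftCochain g w) = unshiftCochain g (δ n m w) :=
  δ_map n m w (GrMod.forget ℬ)

variable [GradedAlgebra ℬ]

/-- The homogeneous component of degree `g` of a cochain: take components of degree `g` of all its
linear maps. -/
def cochainComp (g : G) {n : ℤ} (z : Cochain (forgetComplex K) (forgetComplex L) n) :
    Cochain (forgetComplex K) (forgetComplex L) n :=
  Cochain.mk fun p q hpq => ModuleCat.ofHom (X := K.X p) (Y := L.X q)
    (GrMod.homComp (M := K.X p) (N := L.X q) g (z.v p q hpq).hom)

theorem cochainComp_v (g : G) {n : ℤ} (z : Cochain (forgetComplex K) (forgetComplex L) n)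
    (p q : ℤ) (hpq : p + n = q) : ((cochainComp g z).v p q hpq).hom =
      GrMod.homComp (M := K.X p) (N := L.X q) g (z.v p q hpq).hom := rfl

theorem cochainComp_mem (g : G) {n : ℤ} (z : Cochain (forgetComplex K) (forgetComplex L) n) :
    cochainComp g z ∈ homogCochain K L n g :=
  fun p q hpq _ _ hx => GrMod.homComp_mem (M := K.X p) (N := L.X q) g (z.v p q hpq).hom hx

theorem cochainComp_of_mem {g h : G} {n : ℤ} {z : Cochain (forgetComplex K) (forgetComplex L) n}
    (hz : z ∈ homogCochain K L n g) : cochainComp h z = if g = h then z else 0 := by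
  have H (p q : ℤ) (hpq : p + n = q) := GrMod.homComp_of_homogeneous (d := g) (e := h) (M := K.X p)
    (N := L.X q) (z.v p q hpq).hom (hz p q hpq)
  split_ifs with hgh
  · ext p q hpq : 2
    exact (H p q hpq).trans (if_pos hgh)
  · ext p q hpq : 2
    exact (H p q hpq).trans (if_neg hgh)

theorem cochainComp_add (g : G) {n : ℤ} (z z' : Cochain (forgetComplex K) (forgetComplex L) n) :
    cochainComp g (z + z') = cochainComp g z + cochainComp g z' := by
  ext p q hpq : 2
  exact GrMod.homComp_add (M := K.X p) (N := L.X q) g (z.v p q hpq).hom (z'.v p q hpq).hom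

theorem cochainComp_zero (g : G) {n : ℤ} :
    cochainComp g (0 : Cochain (forgetComplex K) (forgetComplex L) n) = 0 := by
  ext p q hpq : 2
  exact GrMod.homComp_zero (M := K.X p) (N := L.X q) g

theorem δ_cochainComp (g : G) (n m : ℤ) (z : Cochain (forgetComplex K) (forgetComplex L) n) :
    δ n m (cochainComp g z) = cochainComp g (δ n m z) := by
  by_cases hnm : n + 1 = m
  · ext p q hpq : 2
    rw [cochainComp_v, δ_v n m hnm _ p q hpq (q - 1) (p + 1) rfl rfl,
      δ_v n m hnm _ p q hpq (q - 1) (p + 1) rfl rfl]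
    have h1 := GrMod.homComp_comp_lin (M := K.X p) g (z.v p (q - 1) (by lia)).hom (L.d (q - 1) q)
    have h2 := GrMod.homComp_lin_comp (P := L.X q) g (K.d p (p + 1)) (z.v (p + 1) q (by lia)).hom
    obtain hm | hm := Int.even_or_odd m
    · rw [Int.negOnePow_even _ hm, one_smul, one_smul]
      exact ((GrMod.homComp_add (M := K.X p) (N := L.X q) g _ _).trans
        (congrArg₂ (· + ·) h1 h2)).symm
    · rw [Int.negOnePow_odd _ hm, Units.neg_smul, one_smul, Units.neg_smul, one_smul]
      refine ((GrMod.homComp_add (M := K.X p) (N := L.X q) g _ _).trans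
        (congrArg₂ (· + ·) h1 ?_)).symm
      exact (GrMod.homComp_neg (M := K.X p) (N := L.X q) g _).trans (congrArg _ h2)
  · rw [δ_shape n m hnm, δ_shape n m hnm, cochainComp_zero]

theorem sum_cochainComp {n : ℤ} {z : Cochain (forgetComplex K) (forgetComplex L) n}
    (s : Finset G) (hs : ∀ g, cochainComp g z ≠ 0 → g ∈ s) : ∑ g ∈ s, cochainComp g z = z := by
  ext p q hpq : 2
  have h1 := GrMod.sum_homComp_apply (M := K.X p) (N := L.X q) (z.v p q hpq).hom s fun g hg =>
    hs g fun h => hg (congrArg (fun u => (u.v p q hpq).hom) h)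
  refine Eq.trans ?_ h1
  have h2 : ∀ t : Finset G, ((∑ g ∈ t, cochainComp g z).v p q hpq).hom =
      ∑ g ∈ t, GrMod.homComp (M := K.X p) (N := L.X q) g (z.v p q hpq).hom := by
    intro t
    induction t using Finset.induction_on with
    | empty => rfl
    | insert a t ha ih =>
      rw [Finset.sum_insert ha, Finset.sum_insert ha, ← ih]
      rfl
  exact h2 s

theorem cochainComp_finite {n : ℤ} {z : Cochain (forgetComplex K) (forgetComplex L) n}
    (hz : z ∈ gradedCochain K L n) : {g | cochainComp g z ≠ 0}.Finite := by
  refine AddSubgroup.iSup_induction (homogCochain K L n)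
    (C := fun z => {g | cochainComp g z ≠ 0}.Finite) hz ?_ ?_ ?_
  · intro g z hz
    refine (Set.finite_singleton g).subset fun h hh => ?_
    by_contra hne
    refine hh ?_
    rw [cochainComp_of_mem hz, if_neg (Ne.symm hne)]
  · simp [cochainComp_zero]
  · intro x y hx hy
    refine (hx.union hy).subset fun g hg => ?_
    by_contra hne
    simp only [Set.mem_union, Set.mem_ofPred_eq, not_or, not_not] at hne
    exact hg (by rw [cochainComp_add, hne.1, hne.2, add_zero])

/-- If a homogeneous cochain is the coboundary of a cochain, then it is the coboundary of a
homogeneous cochain. -/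
theorem exists_homogeneous_δ_eq {g : G} {n m : ℤ} {z : Cochain (forgetComplex K) (forgetComplex L) n}
    (hz : z ∈ homogCochain K L n g) (u : Cochain (forgetComplex K) (forgetComplex L) m)
    (hu : δ m n u = z) : ∃ v ∈ homogCochain K L m g, δ m n v = z :=
  ⟨cochainComp g u, cochainComp_mem g u, by
    rw [δ_cochainComp, hu, cochainComp_of_mem hz, if_pos rfl]⟩

instance (P : GrMod ℬ) [Projective P] : Projective ((GrMod.forget ℬ).obj P) := by
  have := GrMod.module_projective_of_projective P
  exact (IsProjective.iff_projective (R := B) P).1 inferInstance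

instance (a : ℤ) [K.IsStrictlyGE a] : (forgetComplex K).IsStrictlyGE a := inferInstance
instance (a : ℤ) [K.IsStrictlyLE a] : (forgetComplex K).IsStrictlyLE a := inferInstance

theorem isKProjective_forgetComplex (b : ℤ) [K.IsStrictlyLE b] (hK : ∀ i, Projective (K.X i)) :
    (forgetComplex K).IsKProjective :=
  have (i : ℤ) : Projective ((forgetComplex K).X i) :=
    inferInstanceAs (Projective ((GrMod.forget ℬ).obj (K.X i)))
  isKProjective_of_projective _ b

omit [GradedAlgebra ℬ] in
theorem forgetComplex_exactAt_iff (i : ℤ) : (forgetComplex K).ExactAt i ↔ K.ExactAt i :=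
  (K.sc i).exact_map_iff_of_faithful (GrMod.forget ℬ)

/-- If a cochain in the category of graded modules is the coboundary of a cochain in the category
of modules, then it is a coboundary in the category of graded modules. -/
theorem exists_δ_eq_of_map_forget {n m : ℤ} (z : Cochain K L n)
    (u : Cochain (forgetComplex K) (forgetComplex L) m)
    (hu : δ m n u = z.map (GrMod.forget ℬ)) : ∃ v : Cochain K L m, δ m n v = z := by
  have hz : z.map (GrMod.forget ℬ) ∈ homogCochain K L n 0 := by
    intro p q hpq h x hx
    rw [add_zero]
    exact GrMod.lin_mem (z.v p q hpq) hx
  obtain ⟨v, hv, hvz⟩ := exists_homogeneous_δ_eq hz u hu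
  refine ⟨Cochain.mk fun p q hpq => GrMod.ofLin (M := K.X p) (N := L.X q)
    (v.v p q hpq).hom fun g x hx => ?_, ?_⟩
  · have := hv p q hpq g x hx
    rwa [add_zero] at this
  · ext p q hpq
    refine (GrMod.forget ℬ).map_injective (Eq.trans ?_ (Cochain.congr_v hvz p q hpq))
    exact Cochain.congr_v (δ_map m n _ (GrMod.forget ℬ)).symm p q hpq

omit [GradedAlgebra ℬ] in
theorem isGE_forgetComplex (a : ℤ) [K.IsGE a] : (forgetComplex K).IsGE a := by
  rw [isGE_iff]
  intro i hi
  exact (forgetComplex_exactAt_iff i).2 (K.exactAt_of_isGE a i hi)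

/-- The injective dimension in the category of graded modules is at most the one in the category
of modules. -/
theorem HasInjDimLE.of_forget (a : ℤ) [K.IsStrictlyGE a] {n : ℤ}
    (h : HasInjDimLE (forgetComplex K) n) : HasInjDimLE K n := by
  refine hasInjDimLE_of_injective_cycles a n
    (fun i hi => (forgetComplex_exactAt_iff i).1 (h.exactAt i hi)) fun J j hj hJ hJa => ⟨?_⟩
  intro X Y f i _
  let S : ShortComplex (GrMod ℬ) := ShortComplex.mk i (cokernel.π i) (cokernel.condition i)
  have hS : S.ShortExact := { exact := ShortComplex.exact_of_g_is_cokernel _ (cokernelIsCokernel i) }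
  let Q := ProjectiveResolution.of S.X₃
  obtain ⟨g, hg, hg'⟩ := exists_extend_of_forall_exists_δ_eq j hJ a S hS Q.π' n (fun z hz => by
    have := isKProjective_forgetComplex (K := Q.cochainComplex) 0 inferInstance
    have := isGE_forgetComplex (K := Q.cochainComplex) 0
    obtain ⟨u, hu⟩ := h.exists_δ_eq (forgetComplex Q.cochainComplex) rfl (lt_add_one n)
      (z.map (GrMod.forget ℬ)) (by rw [δ_map, hz]; rfl)
    exact exists_δ_eq_of_map_forget z u hu) (f ≫ J.iCycles n) (by simp)
  exact ⟨J.liftCycles g (n + 1) (by simp) hg, by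
    rw [← cancel_mono (J.iCycles n), Category.assoc, J.liftCycles_i]; exact hg'⟩

end GradedCochains

/-! ### Filtrations by ordered degrees and division with remainder -/

section Filtration

variable {k : Type v} [CommRing k] {G : Type} [DecidableEq G] [AddCommGroup G]
  {B : Type u} [Ring B] [Algebra k B] {ℬ : G → Submodule k B}
  {Γ : Type} [AddCommGroup Γ] [LinearOrder Γ] [IsOrderedAddMonoid Γ] {ω : G →+ Γ}

namespace GrMod

/-- The elements of a graded module all of whose components have degrees `g` with `ω g ≤ γ`. -/
def fil (M : GrMod ℬ) (ω : G →+ Γ) (γ : Γ) : AddSubgroup M where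
  carrier := {x | ∀ g, M.proj g x ≠ 0 → ω g ≤ γ}
  zero_mem' g hg := absurd (map_zero _) hg
  add_mem' {x y} hx hy g hg := by
    by_contra h
    refine hg ?_
    rw [map_add, not_not.1 (mt (hx g) h), not_not.1 (mt (hy g) h), add_zero]
  neg_mem' hx g hg := hx g fun h => hg (by rw [map_neg, h, neg_zero])

variable {M N : GrMod ℬ}

omit [IsOrderedAddMonoid Γ] in
theorem fil_mono {γ γ' : Γ} (h : γ ≤ γ') {x : M} (hx : x ∈ M.fil ω γ) : x ∈ M.fil ω γ' :=
  fun g hg => (hx g hg).trans h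

omit [IsOrderedAddMonoid Γ] in
theorem mem_fil_of_mem {g : G} {x : M} (hx : x ∈ M.gr g) : x ∈ M.fil ω (ω g) := by
  intro h hh
  rw [proj_of_mem hx] at hh
  by_cases hgh : g = h
  · rw [hgh]
  · exact absurd (if_neg hgh) hh

omit [IsOrderedAddMonoid Γ] in
theorem proj_mem_fil {γ : Γ} {x : M} (hx : x ∈ M.fil ω γ) (g : G) : M.proj g x ∈ M.fil ω γ := by
  by_cases h : M.proj g x = 0
  · rw [h]
    exact zero_mem _
  · exact fil_mono (hx g h) (mem_fil_of_mem (internalProj_mem _ _ _))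

omit [IsOrderedAddMonoid Γ] in
/-- Each nonzero element has a leading component. -/
theorem exists_leading (ω : G →+ Γ) {x : M} (hx : x ≠ 0) :
    ∃ g, M.proj g x ≠ 0 ∧ x ∈ M.fil ω (ω g) := by
  have hne : (proj_finite x).toFinset.Nonempty := by
    by_contra h
    rw [Finset.not_nonempty_iff_eq_empty] at h
    refine hx ?_
    rw [← sum_proj_toFinset x, h, Finset.sum_empty]
  obtain ⟨g, hg, hmax⟩ := Finset.exists_max_image _ ω hne
  exact ⟨g, by simpa using hg, fun h hh => hmax h (by simpa using hh)⟩

theorem smul_mem_fil {g : G} {b : B} (hb : b ∈ ℬ g) {γ : Γ} {x : M} (hx : x ∈ M.fil ω γ) :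
    b • x ∈ M.fil ω (ω g + γ) := by
  intro h hh
  rw [proj_smul hb] at hh
  have := hx (h - g) fun h0 => hh (by rw [h0, smul_zero])
  rwa [map_sub, sub_le_iff_le_add'] at this

omit [IsOrderedAddMonoid Γ] in
theorem map_mem_fil {F : M →+ N} (hF : ∀ g, ∀ x ∈ M.gr g, F x ∈ N.fil ω (ω g)) {γ : Γ} {x : M}
    (hx : x ∈ M.fil ω γ) : F x ∈ N.fil ω γ := by
  rw [← sum_proj_toFinset x, map_sum]
  exact sum_mem fun g hg => fil_mono (hx g (by simpa using hg)) (hF g _ (internalProj_mem _ _ _))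

variable (M ω) in
/-- The degrees of a graded module are well-ordered. -/
def IsWFGraded : Prop := (ω '' {g | M.gr g ≠ ⊥}).IsWF

omit [IsOrderedAddMonoid Γ] in
/-- Induction on the leading degree. -/
theorem fil_induction (hM : M.IsWFGraded ω) {p : M → Prop} (zero : p 0)
    (step : ∀ g x, M.proj g x ≠ 0 → x ∈ M.fil ω (ω g) →
      (∀ y, (∀ h, M.proj h y ≠ 0 → ω h < ω g) → p y) → p x) (x : M) : p x := by
  have key : ∀ γ ∈ ω '' {g | M.gr g ≠ ⊥}, ∀ g x, ω g = γ → M.proj g x ≠ 0 → x ∈ M.fil ω (ω g) →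
      p x := by
    intro γ hγ
    refine hM.induction hγ (P := fun γ => ∀ g x, ω g = γ → M.proj g x ≠ 0 →
      x ∈ M.fil ω (ω g) → p x) fun γ _ ih => ?_
    rintro g x rfl hx hx'
    refine step g x hx hx' fun y hy => ?_
    by_cases h0 : y = 0
    · rw [h0]
      exact zero
    · obtain ⟨h, hh, hh'⟩ := exists_leading ω h0
      refine ih (ω h) ⟨h, fun h0 => hh ?_, rfl⟩ (hy h hh) h y rfl hh hh'
      have := internalProj_mem M.isInternal h y
      rwa [h0, AddSubgroup.mem_bot] at this
  by_cases h0 : x = 0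
  · rw [h0]
    exact zero
  · obtain ⟨h, hh, hh'⟩ := exists_leading ω h0
    refine key (ω h) ⟨h, fun h0 => hh ?_, rfl⟩ h x rfl hh hh'
    have := internalProj_mem M.isInternal h x
    rwa [h0, AddSubgroup.mem_bot] at this

variable {H : Type} [DecidableEq H] [AddCommGroup H] {φ : G →+ H} {ℬ' : H → Submodule k B}
  {hℬ' : ∀ h, ℬ' h ≤ pushGrading φ ℬ h}

variable (φ ℬ' hℬ') in
/-- The projections to the components of the grading by `H` obtained by change of grading. -/
def pushProj (M : GrMod ℬ) (h : H) : M →+ M := ((push φ ℬ' hℬ').obj M).proj h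

theorem mem_pushObj {g : G} {x : M} (hx : x ∈ M.gr g) : x ∈ (pushObj φ ℬ' hℬ' M).gr (φ g) :=
  AddSubgroup.mem_iSup_of_mem (⟨g, rfl⟩ : {g' // φ g' = φ g}) hx

theorem pushProj_of_mem {g : G} {x : M} (hx : x ∈ M.gr g) (h : H) :
    pushProj φ ℬ' hℬ' M h x = if φ g = h then x else 0 :=
  proj_of_mem (M := pushObj φ ℬ' hℬ' M) (mem_pushObj hx) h

theorem proj_pushProj (x : M) (g : G) (h : H) :
    M.proj g (pushProj φ ℬ' hℬ' M h x) = if φ g = h then M.proj g x else 0 := by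
  refine internal_induction (p := fun x => M.proj g (pushProj φ ℬ' hℬ' M h x) =
    if φ g = h then M.proj g x else 0) M.isInternal x (by simp) ?_ ?_
  · intro g' x hx
    rw [pushProj_of_mem hx]
    by_cases hg : g' = g
    · rw [hg]
      split_ifs <;> simp
    · have h1 : M.proj g x = 0 := by rw [proj_of_mem hx, if_neg hg]
      split_ifs <;> simp [h1]
  · intro x y hx hy
    rw [map_add, map_add, hx, hy, map_add]
    split_ifs <;> simp

omit [IsOrderedAddMonoid Γ] in
theorem pushProj_mem_fil {γ : Γ} {x : M} (hx : x ∈ M.fil ω γ) (h : H) :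
    pushProj φ ℬ' hℬ' M h x ∈ M.fil ω γ := by
  intro g hg
  refine hx g fun h0 => hg ?_
  rw [proj_pushProj, h0, ite_self]

variable [GradedAlgebra ℬ]

variable (ℬ) in
/-- The linear map from a free graded module given by the images of the basis elements, which need
not be homogeneous. -/
def freeLin {ι : Type u} (deg : ι → G) (b : ι → M) : free ℬ deg →ₗ[B] M :=
  Finsupp.linearCombination B b

theorem linearCombination_mem_fil {ι : Type u} {deg : ι → G} {b : ι → M}
    (hb : ∀ i, b i ∈ M.fil ω (ω (deg i))) {g : G} {x : ι →₀ B} (hx : x ∈ (free ℬ deg).gr g) :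
    Finsupp.linearCombination B b x ∈ M.fil ω (ω g) := by
  refine sum_mem fun i _ => ?_
  have := smul_mem_fil (mem_free_gr.1 hx i) (hb i)
  rwa [← map_add, sub_add_cancel] at this

theorem proj_linearCombination {ι : Type u} {deg : ι → G} {b : ι → M} {g : G} {x : ι →₀ B}
    (hx : x ∈ (free ℬ deg).gr g) : M.proj g (Finsupp.linearCombination B b x) =
      Finsupp.linearCombination B (fun i => M.proj (deg i) (b i)) x := by
  rw [Finsupp.linearCombination_apply, Finsupp.linearCombination_apply, Finsupp.sum, Finsupp.sum,
    map_sum]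
  refine Finset.sum_congr rfl fun i _ => ?_
  rw [proj_smul (mem_free_gr.1 hx i), sub_sub_cancel]

/-- Division with remainder: each submodule `S` has a finite family of generators, homogeneous for
the grading by `H` if `S` is, whose leading components generate all leading components of elements
of `S`. Therefore an element of `S` is a combination of the generators in which no summand
has larger degree than the element. -/
theorem exists_standard_basis (hω : Function.Injective ω) [IsNoetherianRing B]
    [Module.Finite B M] (hM : M.IsWFGraded ω) (S : Submodule B M)
    (hS : ∀ h, ∀ x ∈ S, pushProj φ ℬ' hℬ' M h x ∈ S) :
    ∃ (ι : Type u) (_ : Finite ι) (deg : ι → G) (b : ι → M), (∀ i, b i ∈ S) ∧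
      (∀ i, b i ∈ (pushObj φ ℬ' hℬ' M).gr (φ (deg i))) ∧
      (∀ i, b i ∈ M.fil ω (ω (deg i))) ∧
      ∀ x ∈ S, ∀ γ, x ∈ M.fil ω γ →
        ∃ y ∈ (free ℬ deg).fil ω γ, freeLin ℬ deg b y = x := by
  -- finitely many leading components of elements of `S` generate all leading components
  obtain ⟨s, hs, hspan⟩ := Submodule.fg_span_iff_fg_span_finset_subset _ |>.1
    (IsNoetherian.noetherian (Submodule.span B
      {m : M | ∃ g, ∃ b ∈ S, b ∈ M.fil ω (ω g) ∧ M.proj g b = m}))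
  choose deg b hbS hbω hb using fun i : s => hs i.2
  -- passing to components for the grading by `H` does not change the leading components
  let c (i : s) : M := pushProj φ ℬ' hℬ' M (φ (deg i)) (b i)
  have hcω (i : s) : c i ∈ M.fil ω (ω (deg i)) := pushProj_mem_fil (hbω i) _
  have hc (i : s) : M.proj (deg i) (c i) = i := by
    rw [proj_pushProj, if_pos rfl, hb]
  refine ⟨s, inferInstance, deg, c, fun i => hS _ _ (hbS i), fun i => internalProj_mem _ _ _,
    hcω, ?_⟩
  intro x
  refine fil_induction hM (p := fun x => x ∈ S → ∀ γ, x ∈ M.fil ω γ → ∃ y ∈ (free ℬ deg).fil ω γ,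
    freeLin ℬ deg c y = x) ?_ ?_ x
  · exact fun _ γ _ => ⟨0, zero_mem _, map_zero _⟩
  · intro g x hxg hx ih hxS γ hγ
    -- the leading component of `x` is cancelled by the combination of the `c i` given by `y₀`
    have h1 : M.proj g x ∈ Submodule.span B (Set.range fun i : s => (i : M)) := by
      rw [Subtype.range_coe_subtype, Finset.setOfPred_mem, ← hspan]
      exact Submodule.subset_span ⟨g, x, hxS, hx, rfl⟩
    obtain ⟨y, hy⟩ := (Finsupp.mem_span_range_iff_exists_finsupp).1 h1
    let y₀ : s →₀ B := (free ℬ deg).proj g y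
    have hy₀ : y₀ ∈ (free ℬ deg).gr g := internalProj_mem _ _ _
    have h2 : Finsupp.linearCombination B (fun i : s => (i : M)) y₀ = M.proj g x := by
      have h3 := lin_proj (freeDesc deg M (fun i : s => (i : M)) fun i => by
        rw [← hc i]
        exact internalProj_mem _ _ _) g y
      refine h3.trans ((congrArg (M.proj g) hy).trans ?_)
      rw [proj_proj, if_pos rfl]
    have h4 : Finsupp.linearCombination B c y₀ ∈ M.fil ω (ω g) := linearCombination_mem_fil hcω hy₀
    have h5 : M.proj g (Finsupp.linearCombination B c y₀) = M.proj g x := by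
      rw [proj_linearCombination hy₀, ← h2]
      simp only [hc]
    have h6 : Finsupp.linearCombination B c y₀ ∈ S :=
      sum_mem fun i _ => S.smul_mem _ (hS _ _ (hbS i))
    have h7 : x - Finsupp.linearCombination B c y₀ ∈ M.fil ω (ω g) := sub_mem hx h4
    obtain ⟨y', hy', hxy'⟩ := ih (x - Finsupp.linearCombination B c y₀) (fun h hh => by
      refine lt_of_le_of_ne (h7 h hh) fun heq => hh ?_
      rw [hω heq, map_sub, h5, sub_self]) (sub_mem hxS h6) (ω g) h7
    refine ⟨y' + (show free ℬ deg from y₀), fil_mono (hγ g hxg) (add_mem hy' (mem_fil_of_mem hy₀)), ?_⟩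
    refine (map_add (Finsupp.linearCombination B c) y' y₀).trans ?_
    exact (congrArg (· + Finsupp.linearCombination B c y₀) hxy').trans (sub_add_cancel _ _)

theorem isWFGraded_free (hℬ : (ω '' {g | ℬ g ≠ ⊥}).IsWF) {ι : Type u} [Finite ι]
    (deg : ι → G) : (free ℬ deg).IsWFGraded ω := by
  have := Fintype.ofFinite ι
  have h1 : (Finset.univ.sup fun i => (· + ω (deg i)) '' (ω '' {g | ℬ g ≠ ⊥})).IsWF := by
    refine (Finset.isWF_sup _).2 fun i _ => ?_
    rw [← Set.isPWO_iff_isWF] at hℬ ⊢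
    exact hℬ.image_of_monotone fun _ _ h => by gcongr
  refine h1.mono ?_
  rintro _ ⟨g, hg, rfl⟩
  obtain ⟨x, hx, hx0⟩ : ∃ x : ι →₀ B, x ∈ (free ℬ deg).gr g ∧ x ≠ 0 :=
    (AddSubgroup.bot_or_exists_ne_zero _).resolve_left hg
  obtain ⟨i, hi⟩ := Finsupp.ne_iff.1 hx0
  rw [Finset.sup_eq_iSup]
  refine Set.mem_iUnion.2 ⟨i, Set.mem_iUnion.2 ⟨Finset.mem_univ i, ω (g - deg i),
    ⟨g - deg i, fun h0 => hi ?_, rfl⟩, (map_add ω _ _).symm.trans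
      (congrArg ω (sub_add_cancel g (deg i)))⟩⟩
  have := mem_free_gr.1 hx i
  rwa [h0, Submodule.mem_bot] at this

end GrMod

end Filtration

/-! ### Filtered free resolutions -/

section Descend

variable {S : ℤ → Type*} (R : ∀ n, S n → S (n + 1) → Prop) (b : ℤ) (top : ∀ n, b ≤ n → S n)
  (step : ∀ n (t : S (n + 1)), ∃ s, R n s t)

/-- Descending recursion on the integers, starting with given values in the degrees `≥ b`. -/
def descend (n : ℤ) : S n :=
  if h : b ≤ n then top n h else Classical.choose (step n (descend (n + 1)))
termination_by (b - n).toNat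
decreasing_by lia

theorem descend_of_le (n : ℤ) (h : b ≤ n) : descend R b top step n = top n h := by
  rw [descend, dif_pos h]

theorem descend_rel (htop : ∀ n h h', R n (top n h) (top (n + 1) h')) (n : ℤ) :
    R n (descend R b top step n) (descend R b top step (n + 1)) := by
  by_cases h : b ≤ n
  · rw [descend_of_le R b top step n h, descend_of_le R b top step (n + 1) (Int.le_add_one h)]
    exact htop n h _
  · have h1 : descend R b top step n = Classical.choose (step n (descend R b top step (n + 1))) := by
      rw [descend, dif_neg h]
    rw [h1]
    exact Classical.choose_spec (step n (descend R b top step (n + 1)))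

end Descend

section FilteredResolution

variable {k : Type v} [CommRing k] {G : Type} [DecidableEq G] [AddCommGroup G]
  {B : Type u} [Ring B] [Algebra k B] {ℬ : G → Submodule k B} [GradedAlgebra ℬ]
  {Γ : Type} [AddCommGroup Γ] [LinearOrder Γ] [IsOrderedAddMonoid Γ] (ω : G →+ Γ)
  {H : Type} [DecidableEq H] [AddCommGroup H] (φ : G →+ H) (ℬ' : H → Submodule k B)
  (hℬ' : ∀ h, ℬ' h ≤ pushGrading φ ℬ h) (hφ : ∀ g, ℬ g ≤ ℬ' (φ g))

open GrMod

/-- The morphism of `H`-graded modules from a free `G`-graded module given by the images of the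
basis elements. -/
def pushFreeDesc {ι : Type u} (deg : ι → G) (M : GrMod ℬ') (m : ι → M)
    (hm : ∀ i, m i ∈ M.gr (φ (deg i))) : pushObj φ ℬ' hℬ' (free ℬ deg) ⟶ M :=
  ofLin (M := pushObj φ ℬ' hℬ' (free ℬ deg)) (Finsupp.linearCombination B m) fun h x hx => by
    refine AddSubgroup.iSup_induction (fun g : {g // φ g = h} => (free ℬ deg).gr g)
      (C := fun x => Finsupp.linearCombination B m x ∈ M.gr h) hx ?_
      ((congrArg (· ∈ M.gr h) (map_zero (Finsupp.linearCombination B m))).mpr (zero_mem _))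
      (fun x y hx hy => (congrArg (· ∈ M.gr h)
        (map_add (Finsupp.linearCombination B m) x y)).mpr (add_mem hx hy))
    rintro ⟨g, rfl⟩ x hx
    refine sum_mem fun i _ => smul_mem_of_sub (h := φ (deg i)) ?_ (hm i)
    rw [← map_sub]
    exact hφ _ (mem_free_gr.1 hx i)

theorem free_hom_ext {ι : Type u} {deg : ι → G} {M : GrMod ℬ'}
    {f f' : pushObj φ ℬ' hℬ' (free ℬ deg) ⟶ M}
    (h : ∀ i, lin f (Finsupp.single i 1 : ι →₀ B) = lin f' (Finsupp.single i 1 : ι →₀ B)) :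
    f = f' :=
  hom_ext (Finsupp.lhom_ext' (M := B) fun i => LinearMap.ext_ring (h i))

variable (K : CochainComplex (GrMod ℬ') ℤ)

/-- The part of a filtered free resolution of `K` in degree `n`: a free module `F` with a map `f` to
`K.X n`, and a submodule `Z`, the future kernel of the differential, such that each cycle of `K` is
homologous to the image of an element of `Z`. -/
structure ResolutionStage (n : ℤ) where
  ι : Type u
  fin : Finite ι
  deg : ι → G
  f : pushObj φ ℬ' hℬ' (free ℬ deg) ⟶ K.X n
  Z : Submodule B (free ℬ deg)
  proj_mem : ∀ h, ∀ x ∈ Z, pushProj φ ℬ' hℬ' (free ℬ deg) h x ∈ Z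
  exists_eq : ∀ x, lin (K.d n (n + 1)) x = 0 →
    ∃ z ∈ Z, ∃ w : K.X (n - 1), x = lin f z + lin (K.d (n - 1) n) w

variable {φ ℬ' hℬ' K}

/-- The differential between two consecutive parts of a filtered free resolution. -/
structure ResolutionLink {n : ℤ} (s : ResolutionStage φ ℬ' hℬ' K n)
    (t : ResolutionStage φ ℬ' hℬ' K (n + 1)) where
  d : pushObj φ ℬ' hℬ' (free ℬ s.deg) ⟶ pushObj φ ℬ' hℬ' (free ℬ t.deg)
  eq_zero_iff : ∀ x, lin d x = 0 ↔ x ∈ s.Z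
  exists_eq_iff : ∀ y, (∃ x, lin d x = y) ↔
    y ∈ t.Z ∧ ∃ w : K.X n, lin (K.d n (n + 1)) w = lin t.f y
  comm : d ≫ t.f = s.f ≫ K.d n (n + 1)
  mem_fil : ∀ g, ∀ x ∈ (free ℬ s.deg).gr g, lin d x ∈ (free ℬ t.deg).fil ω (ω g)
  strict : ∀ x γ, lin d x ∈ (free ℬ t.deg).fil ω γ →
    ∃ y ∈ (free ℬ s.deg).fil ω γ, lin d y = lin d x

omit [GradedAlgebra ℬ] [IsOrderedAddMonoid Γ] in
theorem exists_mem_fil {M : GrMod ℬ} (x : M) : ∃ γ, x ∈ M.fil ω γ := by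
  by_cases hx : x = 0
  · exact ⟨0, by rw [hx]; exact zero_mem _⟩
  · obtain ⟨g, -, h⟩ := exists_leading ω hx
    exact ⟨ω g, h⟩

variable (K) in
/-- The cohomology of `K` in degree `n` is generated by finitely many homogeneous elements of
degrees in the image of `φ`. -/
def HasFiniteGenerators (φ : G →+ H) (n : ℤ) : Prop :=
  ∃ (ι : Type u) (_ : Finite ι) (deg : ι → G) (c : ι → K.X n),
    (∀ i, c i ∈ (K.X n).gr (φ (deg i))) ∧ (∀ i, lin (K.d n (n + 1)) (c i) = 0) ∧
    ∀ x, lin (K.d n (n + 1)) x = 0 →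
      ∃ (a : ι →₀ B) (w : K.X (n - 1)), x = Finsupp.linearCombination B c a + lin (K.d (n - 1) n) w

omit [IsOrderedAddMonoid Γ] in
theorem mapDomain_inl_mem_fil {ι₁ ι₂ : Type u} {deg₁ : ι₁ → G} (deg₂ : ι₂ → G) {x : ι₁ →₀ B}
    {γ : Γ} (hx : x ∈ (free ℬ deg₁).fil ω γ) :
    (Finsupp.mapDomain Sum.inl x : ι₁ ⊕ ι₂ →₀ B) ∈ (free ℬ (Sum.elim deg₁ deg₂)).fil ω γ := by
  refine map_mem_fil (M := free ℬ deg₁) (N := free ℬ (Sum.elim deg₁ deg₂))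
    (F := (Finsupp.mapDomain.addMonoidHom Sum.inl : (ι₁ →₀ B) →+ (ι₁ ⊕ ι₂ →₀ B)))
    (fun g x hx => mem_fil_of_mem (M := free ℬ (Sum.elim deg₁ deg₂)) ?_) hx
  rintro (i | i)
  · have := mem_free_gr.1 hx i
    rwa [← Finsupp.mapDomain_apply Sum.inl_injective x i] at this
  · have h : (Finsupp.mapDomain Sum.inl x : ι₁ ⊕ ι₂ →₀ B) (Sum.inr i) = 0 :=
      Finsupp.mapDomain_of_notMem_range x _ (by simp)
    exact h ▸ zero_mem _

theorem linearCombination_single_one {ι M : Type*} [AddCommGroup M] [Module B M] (v : ι → M)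
    (i : ι) : Finsupp.linearCombination B v (Finsupp.single i 1) = v i := by simp

theorem linearCombination_inl {ι₁ ι₂ M : Type*} [AddCommGroup M] [Module B M] (b : ι₁ → M)
    (c : ι₂ → M) (x : ι₁ →₀ B) : Finsupp.linearCombination B (Sum.elim b c)
      (Finsupp.mapDomain Sum.inl x) = Finsupp.linearCombination B b x := by
  rw [Finsupp.linearCombination_mapDomain, Sum.elim_comp_inl]

theorem linearCombination_inr {ι₁ ι₂ M : Type*} [AddCommGroup M] [Module B M] (b : ι₁ → M)
    (c : ι₂ → M) (x : ι₂ →₀ B) : Finsupp.linearCombination B (Sum.elim b c)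
      (Finsupp.mapDomain Sum.inr x) = Finsupp.linearCombination B c x := by
  rw [Finsupp.linearCombination_mapDomain, Sum.elim_comp_inr]

include hφ in
/-- Each part of a filtered free resolution can be extended by one step. The basis consists of a
standard basis of the submodule that the differential has to hit, and of generators of
the cohomology, on which the differential vanishes. -/
theorem exists_link (hω : Function.Injective ω) (hℬ : (ω '' {g | ℬ g ≠ ⊥}).IsWF)
    [IsNoetherianRing B] {n : ℤ} (hK : HasFiniteGenerators K φ n)
    (t : ResolutionStage φ ℬ' hℬ' K (n + 1)) :
    ∃ s : ResolutionStage φ ℬ' hℬ' K n, Nonempty (ResolutionLink ω s t) := by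
  have := t.fin
  -- the elements which have to be killed by the differential of the resolution
  let S : Submodule B (free ℬ t.deg) :=
    t.Z ⊓ (LinearMap.range (lin (K.d n (n + 1)))).comap
      (show free ℬ t.deg →ₗ[B] K.X (n + 1) from lin t.f)
  have hSproj (h : H) (x : free ℬ t.deg) (hx : x ∈ S) :
      pushProj φ ℬ' hℬ' (free ℬ t.deg) h x ∈ S := by
    obtain ⟨w, hw⟩ := hx.2
    refine ⟨t.proj_mem h x hx.1, (K.X n).proj h w, ?_⟩
    exact (lin_proj _ _ _).trans ((congrArg _ hw).trans (lin_proj t.f h x).symm)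
  obtain ⟨ι₁, _, deg₁, b, hbS, hb, hbω, hdiv⟩ := exists_standard_basis (φ := φ) (hℬ' := hℬ') hω
    (isWFGraded_free hℬ t.deg) S hSproj
  have hw (i : ι₁) : ∃ w ∈ (K.X n).gr (φ (deg₁ i)), lin (K.d n (n + 1)) w = lin t.f (b i) := by
    obtain ⟨w, hw⟩ := (hbS i).2
    refine ⟨(K.X n).proj (φ (deg₁ i)) w, internalProj_mem _ _ _, ?_⟩
    rw [lin_proj, hw]
    exact internalProj_same _ (lin_mem t.f (hb i))
  choose w hwmem hw using hw
  obtain ⟨ι₂, _, deg₂, c, hcmem, hc, hgen⟩ := hK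
  obtain ⟨d, hd⟩ : ∃ d : pushObj φ ℬ' hℬ' (free ℬ (Sum.elim deg₁ deg₂)) ⟶
      pushObj φ ℬ' hℬ' (free ℬ t.deg), ∀ x : ι₁ ⊕ ι₂ →₀ B,
        lin d x = Finsupp.linearCombination B (M := free ℬ t.deg) (Sum.elim b 0) x :=
    ⟨pushFreeDesc φ ℬ' hℬ' hφ _ _ (Sum.elim b 0) (by
      rintro (i | i)
      · exact hb i
      · exact zero_mem _), fun _ => rfl⟩
  obtain ⟨f, hf⟩ : ∃ f : pushObj φ ℬ' hℬ' (free ℬ (Sum.elim deg₁ deg₂)) ⟶ K.X n,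
      ∀ x : ι₁ ⊕ ι₂ →₀ B, lin f x = Finsupp.linearCombination B (Sum.elim w c) x :=
    ⟨pushFreeDesc φ ℬ' hℬ' hφ _ _ (Sum.elim w c) (by
      rintro (i | i)
      · exact hwmem i
      · exact hcmem i), fun _ => rfl⟩
  have hd₁ (i) : lin d (Finsupp.single i 1 : ι₁ ⊕ ι₂ →₀ B) = Sum.elim b 0 i :=
    (hd _).trans (linearCombination_single_one (M := free ℬ t.deg) _ i)
  have hf₁ (i) : lin f (Finsupp.single i 1 : ι₁ ⊕ ι₂ →₀ B) = Sum.elim w c i :=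
    (hf _).trans (linearCombination_single_one _ i)
  have hcomm : d ≫ t.f = f ≫ K.d n (n + 1) := by
    refine free_hom_ext _ _ _ fun i => (congrArg (lin t.f) (hd₁ i)).trans
      (Eq.trans ?_ (congrArg (lin (K.d n (n + 1))) (hf₁ i)).symm)
    obtain i | i := i
    · exact (hw i).symm
    · exact (map_zero (lin t.f)).trans (hc i).symm
  have hdS (x : ι₁ ⊕ ι₂ →₀ B) : (show free ℬ t.deg from lin d x) ∈ S := by
    rw [hd]
    refine sum_mem fun i _ => S.smul_mem _ ?_
    obtain i | i := i
    · exact hbS i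
    · exact zero_mem _
  have hS (y : free ℬ t.deg) (hy : y ∈ S) (γ : Γ) (hγ : y ∈ (free ℬ t.deg).fil ω γ) :
      ∃ x ∈ (free ℬ (Sum.elim deg₁ deg₂)).fil ω γ, lin d x = y := by
    obtain ⟨x, hx, hxy⟩ := hdiv y hy γ hγ
    exact ⟨Finsupp.mapDomain Sum.inl (x : ι₁ →₀ B), mapDomain_inl_mem_fil ω deg₂ hx,
      (hd _).trans ((linearCombination_inl (M := free ℬ t.deg) b 0 x).trans hxy)⟩
  have hex (x) (hx : lin (K.d n (n + 1)) x = 0) : ∃ z, lin d z = 0 ∧ ∃ w' : K.X (n - 1),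
      x = lin f z + lin (K.d (n - 1) n) w' := by
    obtain ⟨a, w', rfl⟩ := hgen x hx
    refine ⟨(Finsupp.mapDomain Sum.inr a : ι₁ ⊕ ι₂ →₀ B), ?_, w', ?_⟩
    · refine (hd _).trans ((linearCombination_inr (M := free ℬ t.deg) b 0 a).trans ?_)
      exact Finset.sum_eq_zero fun i _ => smul_zero (A := free ℬ t.deg) (a i)
    · exact congrArg (· + lin (K.d (n - 1) n) w')
        ((hf _).trans (linearCombination_inr w c a)).symm
  let Z : Submodule B (free ℬ (Sum.elim deg₁ deg₂)) :=
    LinearMap.ker (lin (M := pushObj φ ℬ' hℬ' (free ℬ (Sum.elim deg₁ deg₂))) d)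
  have hZ (h : H) (x : free ℬ (Sum.elim deg₁ deg₂)) (hx : x ∈ Z) :
      pushProj φ ℬ' hℬ' (free ℬ (Sum.elim deg₁ deg₂)) h x ∈ Z := ker_proj d h x hx
  let s : ResolutionStage φ ℬ' hℬ' K n :=
    { ι := ι₁ ⊕ ι₂
      fin := inferInstance
      deg := Sum.elim deg₁ deg₂
      f := f
      Z := Z
      proj_mem := hZ
      exists_eq := hex }
  refine ⟨s, ⟨{
    d := d
    eq_zero_iff := fun x => Iff.rfl
    exists_eq_iff := fun y => ⟨?_, fun hy => ?_⟩
    comm := hcomm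
    mem_fil := fun g x hx => (hd x).symm ▸ linearCombination_mem_fil (M := free ℬ t.deg) ?_ hx
    strict := fun x γ hγ => hS _ (hdS x) γ hγ }⟩⟩
  · rintro ⟨x, rfl⟩
    exact hdS x
  · obtain ⟨γ, hγ⟩ := exists_mem_fil ω (M := free ℬ t.deg) y
    obtain ⟨x, -, hx⟩ := hS y hy γ hγ
    exact ⟨x, hx⟩
  · rintro (i | i)
    · exact hbω i
    · exact zero_mem _

variable (φ ℬ' hℬ' K) in
/-- A filtered free resolution of a complex `K` of `H`-graded modules: a complex of finitely
generated free `G`-graded modules with a quasi-isomorphism to `K`. The maps are homogeneous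
for the grading by `H`, and the differentials `d` do not increase the `ω`-degrees; moreover
elements of the image of `d` are images of elements of at most the same degree. -/
structure FilteredResolution where
  ι : ℤ → Type u
  fin : ∀ n, Finite (ι n)
  deg : ∀ n, ι n → G
  d : ∀ n, pushObj φ ℬ' hℬ' (free ℬ (deg n)) ⟶ pushObj φ ℬ' hℬ' (free ℬ (deg (n + 1)))
  d_comp_d : ∀ n, d n ≫ d (n + 1) = 0
  f : ∀ n, pushObj φ ℬ' hℬ' (free ℬ (deg n)) ⟶ K.X n
  comm : ∀ n, f n ≫ K.d n (n + 1) = d n ≫ f (n + 1)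
  exists_eq : ∀ n x, lin (K.d n (n + 1)) x = 0 →
    ∃ z, lin (d n) z = 0 ∧ ∃ w : K.X (n - 1), x = lin (f n) z + lin (K.d (n - 1) n) w
  exact : ∀ n z, lin (d (n + 1)) z = 0 →
    (∃ w : K.X n, lin (K.d n (n + 1)) w = lin (f (n + 1)) z) → ∃ y, lin (d n) y = z
  mem_fil : ∀ n g, ∀ x ∈ (free ℬ (deg n)).gr g, lin (d n) x ∈ (free ℬ (deg (n + 1))).fil ω (ω g)
  strict : ∀ n x γ, lin (d n) x ∈ (free ℬ (deg (n + 1))).fil ω γ →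
    ∃ y ∈ (free ℬ (deg n)).fil ω γ, lin (d n) y = lin (d n) x

include hφ in
/-- Filtered free resolutions exist for bounded above complexes with finitely generated
cohomology. -/
theorem exists_filteredResolution (hω : Function.Injective ω) (hℬ : (ω '' {g | ℬ g ≠ ⊥}).IsWF)
    [IsNoetherianRing B] (hK : ∀ n, HasFiniteGenerators K φ n) (b : ℤ)
    (hb : ∀ n, b ≤ n → ∀ x : K.X n, x = 0) :
    ∃ F : FilteredResolution ω φ ℬ' hℬ' K, ∀ n, b ≤ n → IsEmpty (F.ι n) := by
  -- the resolution is zero in the degrees in which `K` is zero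
  let top (n : ℤ) (hn : b ≤ n) : ResolutionStage φ ℬ' hℬ' K n :=
    { ι := PEmpty
      fin := inferInstance
      deg := PEmpty.elim
      f := 0
      Z := ⊤
      proj_mem := fun _ _ _ => trivial
      exists_eq := fun x _ => ⟨0, trivial, 0, by
        rw [hb n hn x, map_zero]
        exact (add_zero 0).symm⟩ }
  have hsub (x y : PEmpty →₀ B) : x = y := Subsingleton.elim x y
  have htop (n : ℤ) (h : b ≤ n) (h' : b ≤ n + 1) :
      Nonempty (ResolutionLink ω (top n h) (top (n + 1) h')) := ⟨{
    d := 0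
    eq_zero_iff := fun x => ⟨fun _ => trivial, fun _ => rfl⟩
    exists_eq_iff := fun y => ⟨fun _ => ⟨trivial, 0, map_zero _⟩, fun _ => ⟨0, hsub _ _⟩⟩
    comm := by rw [zero_comp]; exact zero_comp.symm
    mem_fil := fun _ _ _ => zero_mem _
    strict := fun x γ _ => ⟨0, zero_mem _, rfl⟩ }⟩
  let s : ∀ n, ResolutionStage φ ℬ' hℬ' K n := descend (fun n s t => Nonempty (ResolutionLink ω s t)) b top
    fun n t => exists_link ω hφ hω hℬ (hK n) t
  have hs (n : ℤ) : Nonempty (ResolutionLink ω (s n) (s (n + 1))) :=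
    descend_rel (fun n s t => Nonempty (ResolutionLink ω s t)) b top _ htop n
  let l (n : ℤ) := (hs n).some
  refine ⟨{
    ι := fun n => (s n).ι
    fin := fun n => (s n).fin
    deg := fun n => (s n).deg
    d := fun n => (l n).d
    d_comp_d := fun n => hom_ext' fun x =>
      ((l (n + 1)).eq_zero_iff _).2 (((l n).exists_eq_iff _).1 ⟨x, rfl⟩).1
    f := fun n => (s n).f
    comm := fun n => (l n).comm.symm
    exists_eq := fun n x hx => by
      obtain ⟨z, hz, w, h⟩ := (s n).exists_eq x hx
      exact ⟨z, ((l n).eq_zero_iff z).2 hz, w, h⟩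
    exact := fun n z hz hz' => ((l n).exists_eq_iff z).2 ⟨((l (n + 1)).eq_zero_iff z).1 hz, hz'⟩
    mem_fil := fun n => (l n).mem_fil
    strict := fun n => (l n).strict }, fun n hn => ?_⟩
  change IsEmpty (s n).ι
  have : s n = top n hn := descend_of_le _ b top _ n hn
  rw [this]
  exact inferInstanceAs (IsEmpty PEmpty)

end FilteredResolution

/-! ### Cochains from filtered complexes -/

section FilteredComplexes

open CochainComplex HomComplex GrMod

variable {k : Type v} [CommRing k] {G : Type} [DecidableEq G] [AddCommGroup G]
  {B : Type u} [Ring B] [Algebra k B] {ℬ : G → Submodule k B} [GradedAlgebra ℬ]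
  {Γ : Type} [AddCommGroup Γ] [LinearOrder Γ] [IsOrderedAddMonoid Γ] {ω : G →+ Γ}

namespace GrMod

variable {M N P : GrMod ℬ}

/-- The linear map given by a morphism between underlying modules. -/
abbrev homLin (f : ModuleCat.of B M ⟶ ModuleCat.of B N) : M →ₗ[B] N := f.hom

variable (ω) in
/-- A linear map raises the `ω`-degree by at most `ω e`. -/
def IsFilMap (e : G) (f : M →ₗ[B] N) : Prop := ∀ g, ∀ x ∈ M.gr g, f x ∈ N.fil ω (ω (g + e))

omit [GradedAlgebra ℬ] in
theorem IsFilMap.apply {e : G} {f : M →ₗ[B] N} (hf : IsFilMap ω e f) {γ : Γ} {x : M}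
    (hx : x ∈ M.fil ω γ) : f x ∈ N.fil ω (γ + ω e) := by
  rw [← sum_proj_toFinset x, map_sum]
  refine sum_mem fun g hg => fil_mono ?_ (hf g _ (internalProj_mem _ _ _))
  rw [map_add]
  have := hx g (by simpa using hg)
  gcongr

omit [GradedAlgebra ℬ] in
theorem IsFilMap.comp {d e : G} {f : M →ₗ[B] N} {f' : N →ₗ[B] P} (hf : IsFilMap ω d f)
    (hf' : IsFilMap ω e f') : IsFilMap ω (d + e) (f'.comp f) := by
  intro g x hx
  have := hf'.apply (hf g x hx)
  rwa [← map_add, add_assoc] at this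

theorem isFilMap_of_homComp {e : G} {f : M →ₗ[B] N} (h : ∀ d, homComp d f ≠ 0 → ω d ≤ ω e) :
    IsFilMap ω e f := by
  intro g x hx g' hg'
  have h1 := h (g' - g) fun h0 => hg' (by
    have := homComp_of_mem (g' - g) f hx
    rw [add_sub_cancel, h0] at this
    exact this.symm)
  rw [map_sub, sub_le_iff_le_add'] at h1
  rwa [map_add]

theorem IsFilMap.le {e : G} {f : M →ₗ[B] N} (hf : IsFilMap ω e f) {d : G} (hd : homComp d f ≠ 0) :
    ω d ≤ ω e := by
  by_contra hlt
  refine hd (hom_ext_of_homogeneous fun g x hx => ?_)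
  rw [homComp_of_mem d f hx, LinearMap.zero_apply]
  by_contra h0
  have := hf g x hx _ h0
  rw [map_add, map_add] at this
  exact hlt (le_of_add_le_add_left this)

omit [AddCommGroup Γ] [LinearOrder Γ] [IsOrderedAddMonoid Γ] in
theorem homComp_zsmul (e : G) (n : ℤ) (f : M →ₗ[B] N) : homComp e (n • f) = n • homComp e f :=
  hom_ext_of_homogeneous fun g x hx => by
    simp only [homComp_of_mem e _ hx, LinearMap.smul_apply, map_zsmul]

/-- The leading component of `f` determines the leading component of the values of `f`. -/
theorem IsFilMap.proj_apply (hω : Function.Injective ω) {e : G} {f : M →ₗ[B] N}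
    (hf : IsFilMap ω e f) {g : G} {x : M} (hx : x ∈ M.fil ω (ω g)) :
    N.proj (g + e) (f x) = homComp e f (M.proj g x) := by
  rw [homComp_of_mem e f (internalProj_mem _ _ _), ← sub_eq_zero, ← map_sub, ← map_sub]
  -- all components of the argument of `f` have degree less than `g`
  set y := x - M.proj g x with hy
  have hlt : ∀ h, M.proj h y ≠ 0 → ω h < ω g := by
    intro h hh
    refine lt_of_le_of_ne (sub_mem hx (proj_mem_fil hx _) h hh) fun heq => hh ?_
    rw [hω heq, hy, map_sub, proj_proj, if_pos rfl, sub_self]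
  rw [← sum_proj_toFinset y, map_sum, map_sum]
  refine Finset.sum_eq_zero fun h hh => by_contra fun h0 => ?_
  have h1 := hf h _ (internalProj_mem _ _ _) _ h0
  have h2 := hlt h (by simpa using hh)
  rw [map_add, map_add ω h e] at h1
  exact absurd (le_of_add_le_add_right h1) (not_le.2 h2)

/-- Leading components are multiplicative. -/
theorem homComp_comp (hω : Function.Injective ω) {d e : G} {f : M →ₗ[B] N} {f' : N →ₗ[B] P}
    (hf : IsFilMap ω d f) (hf' : IsFilMap ω e f') :
    homComp (d + e) (f'.comp f) = (homComp e f').comp (homComp d f) :=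
  hom_ext_of_homogeneous fun g x hx => by
    rw [homComp_of_mem _ _ hx, LinearMap.comp_apply, LinearMap.comp_apply, homComp_of_mem d f hx,
      ← add_assoc, hf'.proj_apply hω (hf g x hx)]

/-- The degrees of the components of linear maps from a finitely generated graded module to a graded
module with well-ordered degrees are well-ordered. -/
theorem isWF_homComp [Module.Finite B M] (hN : N.IsWFGraded ω) :
    (ω '' {e | ∃ f : M →ₗ[B] N, homComp e f ≠ 0}).IsWF := by
  obtain ⟨s, hs⟩ := Module.Finite.fg_top (R := B) (M := M)
  let t : Finset G := s.biUnion fun x => (proj_finite x).toFinset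
  have h1 : (t.sup fun g => (· + -ω g) '' (ω '' {g | N.gr g ≠ ⊥})).IsWF := by
    refine (Finset.isWF_sup _).2 fun i _ => ?_
    have hN : (ω '' {g | N.gr g ≠ ⊥}).IsWF := hN
    rw [← Set.isPWO_iff_isWF] at hN ⊢
    exact hN.image_of_monotone fun _ _ h => by gcongr
  refine h1.mono ?_
  rintro _ ⟨e, ⟨f, hf⟩, rfl⟩
  obtain ⟨g, hg, hge⟩ : ∃ g ∈ t, N.gr (g + e) ≠ ⊥ := by
    by_contra! hne
    refine hf (LinearMap.ext_on hs fun x hx => ?_)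
    rw [← sum_proj_toFinset x, map_sum, LinearMap.zero_apply]
    refine Finset.sum_eq_zero fun g hg => ?_
    have := homComp_mem e f (internalProj_mem M.isInternal g x)
    rwa [hne g (Finset.mem_biUnion.2 ⟨x, hx, hg⟩), AddSubgroup.mem_bot] at this
  rw [Finset.sup_eq_iSup]
  refine Set.mem_iUnion.2 ⟨g, Set.mem_iUnion.2 ⟨hg, ω (g + e), ⟨g + e, hge, rfl⟩, ?_⟩⟩
  change ω (g + e) + -ω g = ω e
  rw [map_add]
  abel

end GrMod

omit [GradedAlgebra ℬ] in
theorem eq_zero_of_isZero {M : GrMod ℬ} (hM : IsZero M) (x : M) : x = 0 :=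
  congrArg (fun f : M ⟶ M => lin f x) (hM.eq_of_src (𝟙 M) 0)

variable {K L : CochainComplex (GrMod ℬ) ℤ}

omit [AddCommGroup Γ] [LinearOrder Γ] [IsOrderedAddMonoid Γ] in
theorem cochainComp_eq_zero_iff {e : G} {n : ℤ} {z : Cochain (forgetComplex K) (forgetComplex L) n} :
    cochainComp e z = 0 ↔ ∀ p q hpq,
      homComp (M := K.X p) (N := L.X q) e (z.v p q hpq).hom = 0 := by
  refine ⟨fun h p q hpq => congrArg (fun u => (u.v p q hpq).hom) h, fun h => ?_⟩
  ext p q hpq : 2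
  exact h p q hpq

/-- If the modules `K p` are finitely generated and nonzero in a bounded above range, then
cochains to bounded below complexes have finitely many nonzero components. -/
theorem finite_cochainComp (hK : ∀ p, Module.Finite B (K.X p)) (a b : ℤ)
    (hb : ∀ p, b ≤ p → ∀ x : K.X p, x = 0) (ha : ∀ p, p < a → ∀ x : L.X p, x = 0) {n : ℤ}
    (z : Cochain (forgetComplex K) (forgetComplex L) n) : {e | cochainComp e z ≠ 0}.Finite := by
  have hfin : (⋃ p ∈ Set.Icc (a - n) b,
      {e | homComp (M := K.X p) (N := L.X (p + n)) e (z.v p (p + n) rfl).hom ≠ 0}).Finite := by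
    refine (Set.finite_Icc _ _).biUnion fun p _ => ?_
    have := hK p
    exact homComp_finite (M := K.X p) (N := L.X (p + n)) _
  refine hfin.subset fun e he => ?_
  by_contra hne
  simp only [Set.mem_iUnion, Set.mem_ofPred_eq, not_exists, not_not] at hne
  refine he (cochainComp_eq_zero_iff.2 ?_)
  rintro p _ rfl
  by_cases h1 : b ≤ p
  · exact LinearMap.ext fun x => (congrArg _ (hb p h1 x)).trans ((map_zero _).trans
      (LinearMap.zero_apply _).symm)
  by_cases h2 : p + n < a
  · exact LinearMap.ext fun x => ha _ h2 _
  · exact hne p ⟨by lia, by lia⟩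

variable (ω ℬ) in
/-- A complex of modules whose terms are graded, with differentials that do not increase the
`ω`-degrees. -/
structure FilteredComplex where
  X : ℤ → GrMod ℬ
  d : ∀ n, X n →ₗ[B] X (n + 1)
  d_comp_d : ∀ n, (d (n + 1)).comp (d n) = 0
  isFilMap : ∀ n, IsFilMap ω 0 (d n)

namespace FilteredComplex

variable (C : FilteredComplex ℬ ω)

/-- The underlying complex of modules. -/
def complex : CochainComplex (ModuleCat.{u} B) ℤ :=
  CochainComplex.of (fun n => ModuleCat.of B (C.X n)) (fun n => ModuleCat.ofHom (C.d n))
    fun n => ModuleCat.hom_ext (C.d_comp_d n)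

variable (hω : Function.Injective ω)

/-- The associated graded complex, whose differentials are the components of degree `0` of
the differentials. -/
def gr : CochainComplex (GrMod ℬ) ℤ :=
  CochainComplex.of C.X (fun n => ofLin (homComp 0 (C.d n)) fun g x hx => by
      have := homComp_mem 0 (C.d n) hx
      rwa [add_zero] at this)
    fun n => hom_ext (by
      have := homComp_comp hω (C.isFilMap n) (C.isFilMap (n + 1))
      rw [C.d_comp_d, homComp_zero] at this
      exact this.symm)

omit [GradedAlgebra ℬ] [IsOrderedAddMonoid Γ] in
theorem complex_d (n : ℤ) : C.complex.d n (n + 1) = ModuleCat.ofHom (C.d n) :=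
  CochainComplex.of_d (fun n => ModuleCat.of B (C.X n)) (fun n => ModuleCat.ofHom (C.d n)) n

theorem gr_d (n : ℤ) : lin ((C.gr hω).d n (n + 1)) = homComp 0 (C.d n) :=
  congrArg lin (CochainComplex.of_d C.X _ n)

variable {R : CochainComplex (GrMod ℬ) ℤ} {n m : ℤ}

/-- A cochain on a filtered complex as a cochain on the associated graded complex. -/
def toGr (z : Cochain C.complex (forgetComplex R) n) :
    Cochain (forgetComplex (C.gr hω)) (forgetComplex R) n :=
  Cochain.mk fun p q hpq => ModuleCat.ofHom (X := C.X p) (Y := R.X q) (z.v p q hpq).hom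

/-- A cochain on the associated graded complex as a cochain on a filtered complex. -/
def ofGr (z : Cochain (forgetComplex (C.gr hω)) (forgetComplex R) n) :
    Cochain C.complex (forgetComplex R) n :=
  Cochain.mk fun p q hpq => ModuleCat.ofHom (X := C.X p) (Y := R.X q) (z.v p q hpq).hom

omit [GradedAlgebra ℬ] [IsOrderedAddMonoid Γ] in
theorem δ_v_hom (z : Cochain C.complex (forgetComplex R) n) (p q : ℤ) (hpq : p + m = q)
    (hnm : n + 1 = m) : (((δ n m z).v p q hpq).hom : C.X p →ₗ[B] R.X q) =
      (lin (R.d (q - 1) q)).comp (homLin (M := C.X p) (N := R.X (q - 1))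
        (z.v p (q - 1) (by lia))) +
        (m.negOnePow : ℤ) • (homLin (M := C.X (p + 1)) (N := R.X q)
          (z.v (p + 1) q (by lia))).comp (C.d p) := by
  rw [δ_v n m hnm z p q hpq (q - 1) (p + 1) rfl rfl, complex_d]
  rfl

theorem δ_v_hom_gr (z : Cochain (forgetComplex (C.gr hω)) (forgetComplex R) n) (p q : ℤ)
    (hpq : p + m = q) (hnm : n + 1 = m) : (((δ n m z).v p q hpq).hom : C.X p →ₗ[B] R.X q) =
      (lin (R.d (q - 1) q)).comp (homLin (M := C.X p) (N := R.X (q - 1))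
        (z.v p (q - 1) (by lia))) +
        (m.negOnePow : ℤ) • (homLin (M := C.X (p + 1)) (N := R.X q)
          (z.v (p + 1) q (by lia))).comp (homComp 0 (C.d p)) := by
  rw [δ_v n m hnm z p q hpq (q - 1) (p + 1) rfl rfl, ← gr_d C hω]
  rfl

theorem cochainComp_toGr_v (e : G) (z : Cochain C.complex (forgetComplex R) n) (p q : ℤ)
    (hpq : p + n = q) : ((cochainComp e (C.toGr hω z)).v p q hpq).hom =
      homComp (M := C.X p) (N := R.X q) e (z.v p q hpq).hom := rfl

/-- The leading component of a coboundary is the coboundary of the leading component. -/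
theorem cochainComp_δ (hnm : n + 1 = m) (z : Cochain C.complex (forgetComplex R) n) (e : G)
    (hz : ∀ p q hpq, IsFilMap (M := C.X p) (N := R.X q) ω e (z.v p q hpq).hom) :
    cochainComp e (C.toGr hω (δ n m z)) = δ n m (cochainComp e (C.toGr hω z)) := by
  ext p q hpq : 2
  rw [δ_v_hom_gr C hω _ p q hpq hnm, cochainComp_toGr_v, δ_v_hom C z p q hpq hnm, homComp_add,
    homComp_zsmul]
  refine congrArg₂ (· + ·) ?_ (congrArg _ ?_)
  · exact homComp_comp_lin (M := C.X p) (N := R.X (q - 1)) e (z.v p (q - 1) _).hom (R.d (q - 1) q)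
  · have := homComp_comp (P := R.X q) hω (C.isFilMap p) (hz (p + 1) q (by lia))
    rwa [zero_add] at this

omit [GradedAlgebra ℬ] in
theorem isFilMap_δ (hnm : n + 1 = m) (z : Cochain C.complex (forgetComplex R) n) (e : G)
    (hz : ∀ p q hpq, IsFilMap (M := C.X p) (N := R.X q) ω e (z.v p q hpq).hom) (p q : ℤ)
    (hpq : p + m = q) : IsFilMap (M := C.X p) (N := R.X q) ω e ((δ n m z).v p q hpq).hom := by
  rw [δ_v_hom C z p q hpq hnm]
  intro g x hx
  refine add_mem ?_ (zsmul_mem ?_ _)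
  · have := hz p (q - 1) (by lia) g x hx
    exact map_mem_fil (M := R.X (q - 1)) (F := (lin (R.d (q - 1) q)).toAddMonoidHom)
      (fun h y hy => mem_fil_of_mem (lin_mem _ hy)) this
  · have := (C.isFilMap p).comp (hz (p + 1) q (by lia)) g x hx
    rwa [zero_add] at this

/-- If all homogeneous cocycles on the associated graded complex are coboundaries, then so are the
cocycles on the filtered complex: successively, the leading component of a cocycle is
removed by adding a coboundary. -/
theorem exists_δ_eq (hX : ∀ p, Module.Finite B (C.X p)) (a b : ℤ)
    (hb : ∀ p, b ≤ p → ∀ x : C.X p, x = 0) (ha : ∀ p, p < a → ∀ x : R.X p, x = 0)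
    (hR : ∀ p, (R.X p).IsWFGraded ω) (hmn : m + 1 = n)
    (hgr : ∀ e, ∀ z ∈ homogCochain (C.gr hω) R n e, δ n (n + 1) z = 0 →
      ∃ u ∈ homogCochain (C.gr hω) R m e, δ m n u = z)
    (z : Cochain C.complex (forgetComplex R) n) (hz : δ n (n + 1) z = 0) :
    ∃ u, δ m n u = z := by
  -- the degrees in which cochains can have nonzero components
  let E : Set G := ⋃ p ∈ Finset.Icc (a - n) b,
    {e | ∃ f : C.X p →ₗ[B] R.X (p + n), homComp e f ≠ 0}
  have hE : (ω '' E).IsWF := by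
    rw [Set.image_iUnion₂]
    refine (Finset.isWF_bUnion _).2 fun p _ => ?_
    have := hX p
    exact isWF_homComp (hR _)
  have hmemE (z : Cochain C.complex (forgetComplex R) n) (e : G)
      (he : cochainComp e (C.toGr hω z) ≠ 0) : e ∈ E := by
    by_contra hne
    simp only [E, Set.mem_iUnion, Set.mem_ofPred_eq, not_exists, not_not] at hne
    refine he (cochainComp_eq_zero_iff.2 ?_)
    rintro p _ rfl
    by_cases h1 : b ≤ p
    · exact LinearMap.ext fun x => (congrArg _ (hb p h1 x)).trans ((map_zero _).trans
      (LinearMap.zero_apply _).symm)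
    by_cases h2 : p + n < a
    · exact LinearMap.ext fun x => ha _ h2 _
    · exact hne p (Finset.mem_Icc.2 ⟨by lia, by lia⟩) _
  -- either a cochain vanishes, or it has a leading component
  have hlead (z : Cochain C.complex (forgetComplex R) n) : z = 0 ∨ ∃ e ∈ E,
      (∀ d, cochainComp d (C.toGr hω z) ≠ 0 → ω d ≤ ω e) ∧ cochainComp e (C.toGr hω z) ≠ 0 := by
    have hfin := finite_cochainComp (K := C.gr hω) (L := R) hX a b hb ha (C.toGr hω z)
    by_cases hne : hfin.toFinset.Nonempty
    · obtain ⟨e, he, hmax⟩ := Finset.exists_max_image _ ω hne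
      have he' : cochainComp e (C.toGr hω z) ≠ 0 := by simpa using he
      exact Or.inr ⟨e, hmemE z e he', fun d hd => hmax d (by simpa using hd), he'⟩
    · rw [Finset.not_nonempty_iff_eq_empty] at hne
      have h0 : C.toGr hω z = 0 := by
        rw [← sum_cochainComp (z := C.toGr hω z) hfin.toFinset (fun g hg => by simpa using hg), hne,
          Finset.sum_empty]
      exact Or.inl (by ext p q hpq : 1; exact Cochain.congr_v h0 p q hpq)
  -- induction on the degree of the leading component
  have key : ∀ γ ∈ ω '' E, ∀ z : Cochain C.complex (forgetComplex R) n, δ n (n + 1) z = 0 →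
      (∀ d, cochainComp d (C.toGr hω z) ≠ 0 → ω d ≤ γ) → ∃ u, δ m n u = z := by
    intro γ hγ
    refine hE.induction hγ (P := fun γ => ∀ z : Cochain C.complex (forgetComplex R) n,
      δ n (n + 1) z = 0 → (∀ d, cochainComp d (C.toGr hω z) ≠ 0 → ω d ≤ γ) →
      ∃ u, δ m n u = z) ?_
    rintro _ ⟨e, he, rfl⟩ ih z hz hze
    have hfil : ∀ p q hpq, IsFilMap (M := C.X p) (N := R.X q) ω e (z.v p q hpq).hom :=
      fun p q hpq => isFilMap_of_homComp fun d hd => hze d fun h0 =>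
        hd (cochainComp_eq_zero_iff.1 h0 p q hpq)
    obtain ⟨u, hu, huz⟩ := hgr e (cochainComp e (C.toGr hω z)) (cochainComp_mem _ _) (by
      rw [← cochainComp_δ C hω rfl z e hfil, hz]
      exact cochainComp_zero e)
    have hufil : ∀ p q hpq, IsFilMap (M := C.X p) (N := R.X q) ω e ((C.ofGr hω u).v p q hpq).hom :=
      fun p q hpq g x hx => mem_fil_of_mem (hu p q hpq g x hx)
    have hcomp : cochainComp e (C.toGr hω (δ m n (C.ofGr hω u))) = cochainComp e (C.toGr hω z) := by
      rw [cochainComp_δ C hω hmn _ e hufil, ← huz]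
      exact congrArg _ ((cochainComp_of_mem hu).trans (if_pos rfl))
    have hsub (d : G) : cochainComp d (C.toGr hω (z - δ m n (C.ofGr hω u))) =
        cochainComp d (C.toGr hω z) - cochainComp d (C.toGr hω (δ m n (C.ofGr hω u))) := by
      rw [eq_sub_iff_add_eq, ← cochainComp_add]
      refine congrArg (cochainComp d) (Eq.trans ?_ (congrArg (C.toGr hω)
        (sub_add_cancel z (δ m n (C.ofGr hω u)))))
      rfl
    have hδ : δ n (n + 1) (z - δ m n (C.ofGr hω u)) = 0 := by
      rw [δ_sub, hz, δ_δ, sub_zero]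
    have hlt (d : G) (hd : cochainComp d (C.toGr hω (z - δ m n (C.ofGr hω u))) ≠ 0) :
        ω d < ω e := by
      refine lt_of_le_of_ne ?_ fun heq => hd ?_
      · by_contra hle
        refine hd ?_
        rw [hsub, by_contra fun h => hle (hze d h), zero_sub, neg_eq_zero]
        refine cochainComp_eq_zero_iff.2 fun p q hpq => by_contra fun h => hle ?_
        exact (isFilMap_δ C hmn _ e hufil p q hpq).le h
      · rw [hω heq, hsub, hcomp, sub_self]
    obtain h0 | ⟨d, hd, hd', hd0⟩ := hlead (z - δ m n (C.ofGr hω u))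
    · exact ⟨C.ofGr hω u, (sub_eq_zero.1 h0).symm⟩
    · obtain ⟨v, hv⟩ := ih (ω d) ⟨d, hd, rfl⟩ (hlt d hd0) _ hδ hd'
      exact ⟨v + C.ofGr hω u, by rw [δ_add, hv, sub_add_cancel]⟩
  obtain rfl | ⟨e, he, hze, -⟩ := hlead z
  · exact ⟨0, δ_zero _ _⟩
  · exact key (ω e) ⟨e, he, rfl⟩ z hz hze

end FilteredComplex

end FilteredComplexes

/-! ### Quasi-isomorphisms and cohomology in terms of elements -/

section Elements

open CochainComplex

theorem epi_of_surjective_ab {X Y : AddCommGrpCat.{u}} (f : X ⟶ Y)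
    (h : ∀ y, ∃ x, f x = y) : Epi f :=
  (AddCommGrpCat.epi_iff_surjective f).2 h

/-- A morphism of complexes of abelian groups is a quasi-isomorphism if each cycle is homologous
to the image of a cycle, and cycles with image homologous to zero are homologous to zero. -/
theorem quasiIso_of_elements {K L : CochainComplex AddCommGrpCat.{u} ℤ} (f : K ⟶ L)
    (h1 : ∀ n (x : L.X n), L.d n (n + 1) x = 0 →
      ∃ z, K.d n (n + 1) z = 0 ∧ ∃ w : L.X (n - 1), x = f.f n z + L.d (n - 1) n w)
    (h2 : ∀ n (z : K.X n), K.d n (n + 1) z = 0 → (∃ w : L.X (n - 1), L.d (n - 1) n w = f.f n z) →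
      ∃ y : K.X (n - 1), K.d (n - 1) n y = z) : QuasiIso f := by
  refine ⟨fun n => ?_⟩
  rw [quasiIsoAt_iff_isIso_homologyMap]
  have : Mono (HomologicalComplex.homologyMap f n) := by
    rw [HomologicalComplex.mono_homologyMap_iff_up_to_refinements f (n - 1) n (n + 1) (by simp)
      (by simp)]
    intro A x hx y hxy
    let S : AddSubgroup (A × K.X (n - 1)) :=
      (x.hom.comp (AddMonoidHom.fst _ _)).eqLocus ((K.d (n - 1) n).hom.comp (AddMonoidHom.snd _ _))
    refine ⟨AddCommGrpCat.of S, AddCommGrpCat.ofHom ((AddMonoidHom.fst _ _).comp S.subtype),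
      epi_of_surjective_ab _ fun a => ?_,
      AddCommGrpCat.ofHom ((AddMonoidHom.snd _ _).comp S.subtype), ?_⟩
    · obtain ⟨w, hw⟩ := h2 n (x a) (ConcreteCategory.congr_hom hx a)
        ⟨y a, (ConcreteCategory.congr_hom hxy a).symm⟩
      exact ⟨⟨(a, w), hw.symm⟩, rfl⟩
    · ext s
      exact s.2
  have : Epi (HomologicalComplex.homologyMap f n) := by
    rw [HomologicalComplex.epi_homologyMap_iff_up_to_refinements f (n - 1) n (n + 1) (by simp)
      (by simp)]
    intro A y hy
    let p : A × K.X n × L.X (n - 1) →+ K.X n := (AddMonoidHom.fst _ _).comp (AddMonoidHom.snd _ _)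
    let q : A × K.X n × L.X (n - 1) →+ L.X (n - 1) :=
      (AddMonoidHom.snd _ _).comp (AddMonoidHom.snd _ _)
    let S : AddSubgroup (A × K.X n × L.X (n - 1)) :=
      ((y.hom.comp (AddMonoidHom.fst _ _)).eqLocus
        ((f.f n).hom.comp p + (L.d (n - 1) n).hom.comp q)) ⊓ ((K.d n (n + 1)).hom.comp p).ker
    refine ⟨AddCommGrpCat.of S, AddCommGrpCat.ofHom ((AddMonoidHom.fst _ _).comp S.subtype),
      epi_of_surjective_ab _ fun a => ?_, AddCommGrpCat.ofHom (p.comp S.subtype), ?_,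
      AddCommGrpCat.ofHom (q.comp S.subtype), ?_⟩
    · obtain ⟨z, hz, w, hw⟩ := h1 n (y a) (ConcreteCategory.congr_hom hy a)
      exact ⟨⟨(a, z, w), hw, hz⟩, rfl⟩
    · ext s
      exact s.2.2
    · ext s
      exact s.2.1
  exact isIso_of_mono_of_epi _

variable {k : Type v} [CommRing k] {G : Type} [DecidableEq G] [AddCommGroup G]
  {B : Type u} [Ring B] [Algebra k B] {ℬ : G → Submodule k B}

namespace GrMod

instance : (forget ℬ).ReflectsIsomorphisms where
  reflects {M N} f _ := by
    have := mono_of_injective f ((ModuleCat.mono_iff_injective ((forget ℬ).map f)).1 inferInstance)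
    have := epi_of_surjective f ((ModuleCat.epi_iff_surjective ((forget ℬ).map f)).1 inferInstance)
    exact isIso_of_mono_of_epi f

theorem quasiIso_of_forgetMap {K L : CochainComplex (GrMod ℬ) ℤ} (f : K ⟶ L)
    (h : QuasiIso (forgetMap f)) : QuasiIso f :=
  (HomologicalComplex.quasiIso_map_iff_of_preservesHomology f (forget ℬ)).1 h

theorem quasiIso_of_elements {K L : CochainComplex (GrMod ℬ) ℤ} (f : K ⟶ L)
    (h1 : ∀ n (x : L.X n), lin (L.d n (n + 1)) x = 0 →
      ∃ z, lin (K.d n (n + 1)) z = 0 ∧ ∃ w : L.X (n - 1), x = lin (f.f n) z + lin (L.d (n - 1) n) w)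
    (h2 : ∀ n (z : K.X n), lin (K.d n (n + 1)) z = 0 →
      (∃ w : L.X (n - 1), lin (L.d (n - 1) n) w = lin (f.f n) z) →
      ∃ y : K.X (n - 1), lin (K.d (n - 1) n) y = z) : QuasiIso f := by
  have h : QuasiIso (((forget₂ (ModuleCat.{u} B) AddCommGrpCat.{u}).mapHomologicalComplex _).map
      (forgetMap f)) := _root_.quasiIso_of_elements _ h1 h2
  rw [HomologicalComplex.quasiIso_map_iff_of_preservesHomology] at h
  exact quasiIso_of_forgetMap f h

theorem exactAt_iff {K : CochainComplex (GrMod ℬ) ℤ} (n : ℤ) :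
    K.ExactAt n ↔ ∀ x, lin (K.d n (n + 1)) x = 0 → ∃ y : K.X (n - 1), lin (K.d (n - 1) n) y = x := by
  rw [K.exactAt_iff' (n - 1) n (n + 1) (by simp) (by simp), exact_iff]
  rfl

end GrMod

/-- Finitely generated homology is generated by the classes of finitely many cycles. -/
theorem exists_generators_of_shortComplex (S : ShortComplex (ModuleCat.{u} B))
    [Module.Finite B S.homology] : ∃ s : Finset S.X₂, (∀ c ∈ s, S.g c = 0) ∧
      ∀ x, S.g x = 0 → ∃ y ∈ Submodule.span B (s : Set S.X₂), ∃ w, x = y + S.f w := by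
  have h : Module.Finite B (LinearMap.ker S.g.hom ⧸ LinearMap.range S.moduleCatToCycles) :=
    Module.Finite.equiv S.moduleCatHomologyIso.toLinearEquiv
  obtain ⟨s, hs⟩ := h.fg_top
  choose c hc using fun x => (LinearMap.range S.moduleCatToCycles).mkQ_surjective x
  classical
  refine ⟨s.image fun x => (c x).1, ?_, fun x hx => ?_⟩
  · intro y hy
    obtain ⟨x, -, rfl⟩ := Finset.mem_image.1 hy
    exact (c x).2
  · have h1 : (LinearMap.range S.moduleCatToCycles).mkQ ⟨x, hx⟩ ∈ Submodule.span B (s : Set _) :=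
      hs ▸ Submodule.mem_top
    have h2 : (s : Set _) = (LinearMap.range S.moduleCatToCycles).mkQ '' (c '' s) := by
      rw [Set.image_image]
      simp only [hc, Set.image_id']
    rw [h2, ← Submodule.map_span] at h1
    obtain ⟨y, hy, hyx⟩ := h1
    rw [← sub_eq_zero, ← map_sub, Submodule.mkQ_apply, Submodule.Quotient.mk_eq_zero] at hyx
    obtain ⟨w, hw⟩ := hyx
    refine ⟨y.1, ?_, -w, ?_⟩
    · have := Submodule.mem_map_of_mem (f := (LinearMap.ker S.g.hom).subtype) hy
      rw [Submodule.map_span, Set.image_image] at this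
      rw [Finset.coe_image]
      exact this
    · have h3 : S.f w = y.1 - x := congrArg Subtype.val hw
      rw [map_neg, h3]
      abel

theorem exists_generators (K : CochainComplex (ModuleCat.{u} B) ℤ) (n : ℤ)
    [Module.Finite B (K.homology n)] : ∃ s : Finset (K.X n), (∀ c ∈ s, K.d n (n + 1) c = 0) ∧
      ∀ x, K.d n (n + 1) x = 0 →
        ∃ y ∈ Submodule.span B (s : Set (K.X n)), ∃ w : K.X (n - 1), x = y + K.d (n - 1) n w := by
  have : Module.Finite B (K.sc' (n - 1) n (n + 1)).homology := Module.Finite.equiv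
    (K.homologyIsoSc' (n - 1) n (n + 1) (by simp) (by simp)).toLinearEquiv
  exact exists_generators_of_shortComplex (K.sc' (n - 1) n (n + 1))

/-- Finite generation of cohomology does not depend on the grading. -/
theorem finite_homology_forgetComplex_iff (K : CochainComplex (GrMod ℬ) ℤ) (n : ℤ) :
    Module.Finite B ((forgetComplex K).homology n) ↔ Module.Finite B (K.homology n) := by
  let e : (forgetComplex K).homology n ≅ (GrMod.forget ℬ).obj (K.homology n) :=
    (K.sc n).mapHomologyIso (GrMod.forget ℬ)
  exact Module.Finite.equiv_iff e.toLinearEquiv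

theorem hasFiniteGenerators (K : CochainComplex (GrMod ℬ) ℤ) (n : ℤ)
    [Module.Finite B ((forgetComplex K).homology n)] :
    HasFiniteGenerators K (AddMonoidHom.id G) n := by
  classical
  obtain ⟨s, hs, h⟩ : ∃ s : Finset (K.X n), (∀ c ∈ s, GrMod.lin (K.d n (n + 1)) c = 0) ∧
      ∀ x, GrMod.lin (K.d n (n + 1)) x = 0 → ∃ y ∈ Submodule.span B (s : Set (K.X n)),
        ∃ w : K.X (n - 1), x = y + GrMod.lin (K.d (n - 1) n) w :=
    exists_generators (forgetComplex K) n
  let t : Finset (K.X n × G) := s.biUnion fun x => (GrMod.proj_finite x).toFinset.image fun g => (x, g)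
  refine ⟨t, inferInstance, fun i => i.1.2, fun i => (K.X n).proj i.1.2 i.1.1,
    fun i => internalProj_mem _ _ _, fun i => ?_, fun x hx => ?_⟩
  · obtain ⟨x, hx, hi⟩ := Finset.mem_biUnion.1 i.2
    obtain ⟨g, -, hg⟩ := Finset.mem_image.1 hi
    rw [GrMod.lin_proj, ← hg]
    exact (congrArg _ (hs x hx)).trans (map_zero _)
  · obtain ⟨y, hy, w, rfl⟩ := h x hx
    have hy' : (y : K.X n) ∈ Submodule.span B (Set.range fun i : t => (K.X n).proj i.1.2 i.1.1) := by
      refine Submodule.span_le.2 (fun c hc => ?_) hy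
      rw [SetLike.mem_coe, ← GrMod.sum_proj_toFinset (M := K.X n) c]
      refine sum_mem fun g hg => Submodule.subset_span ⟨⟨(c, g), ?_⟩, rfl⟩
      exact Finset.mem_biUnion.2 ⟨c, hc, Finset.mem_image.2 ⟨g, hg, rfl⟩⟩
    obtain ⟨a, ha⟩ := (Finsupp.mem_span_range_iff_exists_finsupp).1 hy'
    exact ⟨a, w, by rw [← ha]; rfl⟩

end Elements

/-! ### Truncation with respect to the grading -/

section GradingTruncation

open CochainComplex GrMod

variable {k : Type v} [CommRing k] {G : Type} [DecidableEq G] [AddCommGroup G]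
  {B : Type u} [Ring B] [Algebra k B] {ℬ : G → Submodule k B} [GradedAlgebra ℬ]

namespace GrMod

omit [GradedAlgebra ℬ] in
/-- The part of an element in the degrees belonging to `T`. -/
theorem exists_restrict {M : GrMod ℬ} (x : M) (T : Set G) :
    ∃ y : M, ∀ g, (g ∈ T → M.proj g y = M.proj g x) ∧ (g ∉ T → M.proj g y = 0) := by
  classical
  refine ⟨∑ g ∈ (proj_finite x).toFinset with g ∈ T, M.proj g x, fun g => ?_⟩
  rw [map_sum]
  simp only [proj_proj]
  rw [Finset.sum_ite_eq']
  refine ⟨fun hg => ?_, fun hg => if_neg fun h => hg (Finset.mem_filter.1 h).2⟩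
  split_ifs with h
  · rfl
  · by_contra h'
    exact h (Finset.mem_filter.2 ⟨by simpa using Ne.symm h', hg⟩)

/-- The submodule of the elements with components in degrees belonging to a set `T` which is closed
under addition of the degrees of the algebra. -/
def truncSubmodule (M : GrMod ℬ) (T : Set G) (hT : ∀ g, ℬ g ≠ ⊥ → ∀ t ∈ T, g + t ∈ T) :
    Submodule B M where
  carrier := {x | ∀ g, g ∉ T → M.proj g x = 0}
  add_mem' hx hy g hg := by rw [map_add, hx g hg, hy g hg, add_zero]
  zero_mem' _ _ := map_zero _
  smul_mem' b x hx g hg := by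
    refine homogeneous_induction ℬ (p := fun b => M.proj g (b • x) = 0) b (by simp) ?_
      (fun b c hb hc => by rw [add_smul, map_add, hb, hc, add_zero])
    intro h b hb
    rw [proj_smul hb]
    by_cases hh : ℬ h = ⊥
    · rw [hh, Submodule.mem_bot] at hb
      rw [hb, zero_smul]
    · rw [hx (g - h) fun hgh => hg ?_, smul_zero]
      have := hT h hh _ hgh
      rwa [add_sub_cancel] at this

/-- The submodule `truncSubmodule` as a graded module. -/
def trunc (M : GrMod ℬ) (T : Set G) (hT : ∀ g, ℬ g ≠ ⊥ → ∀ t ∈ T, g + t ∈ T) : GrMod ℬ :=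
  M.sub (M.truncSubmodule T hT) fun g x hx h hh => by
    rw [proj_proj]
    split_ifs with hgh
    · exact hx g (hgh ▸ hh)
    · rfl

end GrMod

variable (K : CochainComplex (GrMod ℬ) ℤ) (T : Set G) (hT : ∀ g, ℬ g ≠ ⊥ → ∀ t ∈ T, g + t ∈ T)

/-- The subcomplex of the elements with components in degrees belonging to `T`. -/
def gradingTrunc : CochainComplex (GrMod ℬ) ℤ where
  X n := (K.X n).trunc T hT
  d n m := ofLin (M := (K.X n).trunc T hT) (N := (K.X m).trunc T hT)
    ((lin (K.d n m)).restrict (p := (K.X n).truncSubmodule T hT)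
      (q := (K.X m).truncSubmodule T hT) fun x hx g hg => by
        rw [← lin_proj, hx g hg, map_zero]) fun g x hx => lin_mem (K.d n m) hx
  shape n m hnm := hom_ext' fun x =>
    Subtype.ext (congrArg (fun f : K.X n ⟶ K.X m => lin f x.1) (K.shape n m hnm))
  d_comp_d' n m l _ _ := hom_ext' fun x =>
    Subtype.ext (congrArg (fun f : K.X n ⟶ K.X l => lin f x.1) (K.d_comp_d n m l))

/-- The inclusion of `gradingTrunc`. -/
def gradingTruncι : gradingTrunc K T hT ⟶ K where
  f n := ofLin (M := (K.X n).trunc T hT) ((K.X n).truncSubmodule T hT).subtype fun _ _ hx => hx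
  comm' _ _ _ := rfl

variable {K T}

theorem isStrictlyGE_gradingTrunc (a : ℤ) [K.IsStrictlyGE a] :
    (gradingTrunc K T hT).IsStrictlyGE a := by
  rw [isStrictlyGE_iff]
  intro i hi
  have h := K.isZero_of_isStrictlyGE a i hi
  exact (IsZero.iff_id_eq_zero _).2 (hom_ext' fun x => Subtype.ext (eq_zero_of_isZero h x.1))

/-- The subcomplex `gradingTrunc` is quasi-isomorphic to `K` if the cohomology of `K` lives in
degrees belonging to `T`. -/
theorem quasiIso_gradingTruncι (h : ∀ n, ∀ g, g ∉ T → ∀ x ∈ (K.X n).gr g,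
    lin (K.d n (n + 1)) x = 0 → ∃ w : K.X (n - 1), lin (K.d (n - 1) n) w = x) :
    QuasiIso (gradingTruncι K T hT) := by
  refine GrMod.quasiIso_of_elements _ (fun n x hx => ?_) ?_
  · obtain ⟨y, hy⟩ := exists_restrict x T
    have hd (g : G) : lin (K.d n (n + 1)) ((K.X n).proj g x) = 0 := by rw [lin_proj, hx, map_zero]
    have hw : x - y ∈ LinearMap.range (lin (K.d (n - 1) n)) := by
      rw [← sum_proj_toFinset (x - y)]
      refine sum_mem fun g _ => ?_
      rw [map_sub]
      by_cases hg : g ∈ T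
      · rw [(hy g).1 hg, sub_self]
        exact zero_mem _
      · rw [(hy g).2 hg, sub_zero]
        exact h n g hg _ (internalProj_mem _ _ _) (hd g)
    obtain ⟨w, hw⟩ := hw
    refine ⟨⟨y, fun g hg => (hy g).2 hg⟩, Subtype.ext ?_, w, ?_⟩
    · refine (ext_proj fun g => ?_ : lin (K.d n (n + 1)) y = 0)
      rw [← lin_proj, map_zero]
      by_cases hg : g ∈ T
      · rw [(hy g).1 hg, hd]
      · rw [(hy g).2 hg, map_zero]
    · rw [hw]
      exact (add_sub_cancel y x).symm
  · rintro n z - ⟨w, hw⟩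
    obtain ⟨y, hy⟩ := exists_restrict w T
    refine ⟨⟨y, fun g hg => (hy g).2 hg⟩, Subtype.ext ?_⟩
    change lin (K.d (n - 1) n) y = z.1
    change lin (K.d (n - 1) n) w = z.1 at hw
    refine ext_proj fun g => ?_
    rw [← lin_proj]
    by_cases hg : g ∈ T
    · rw [(hy g).1 hg, lin_proj, hw]
    · rw [(hy g).2 hg, map_zero]
      exact (z.2 g hg).symm

variable {Γ : Type} [AddCommGroup Γ] [LinearOrder Γ] [IsOrderedAddMonoid Γ] {ω : G →+ Γ}

/-- A bounded below complex with finitely generated cohomology, nonzero in finitely many degrees,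
is quasi-isomorphic to a subcomplex whose modules have well-ordered sets of degrees. -/
theorem exists_quasiIso_isWFGraded (S : AddSubmonoid G) (hS : ∀ g, ℬ g ≠ ⊥ → g ∈ S)
    (hSω : (ω '' (S : Set G)).IsWF) (a b : ℤ) [K.IsStrictlyGE a] [K.IsStrictlyLE b]
    (hK : ∀ n, Module.Finite B ((forgetComplex K).homology n)) :
    ∃ (K' : CochainComplex (GrMod ℬ) ℤ) (f : K' ⟶ K), QuasiIso f ∧ K'.IsStrictlyGE a ∧
      ∀ n, (K'.X n).IsWFGraded ω := by
  have hgen (n : ℤ) := hasFiniteGenerators K n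
  choose ι hι deg c hc hdc hc' using hgen
  -- the degrees of the generators of the cohomology
  let D : Set G := ⋃ n ∈ Set.Icc a b, Set.range (deg n)
  have hD : D.Finite := (Set.finite_Icc a b).biUnion fun n _ => by
    have := hι n
    exact Set.finite_range _
  let T : Set G := {g | ∃ d ∈ D, g - d ∈ S}
  have hT (g : G) (hg : ℬ g ≠ ⊥) (t : G) (ht : t ∈ T) : g + t ∈ T := by
    obtain ⟨d, hd, h⟩ := ht
    refine ⟨d, hd, ?_⟩
    rw [add_sub_assoc]
    exact add_mem (hS g hg) h
  refine ⟨gradingTrunc K T hT, gradingTruncι K T hT, quasiIso_gradingTruncι hT ?_,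
    isStrictlyGE_gradingTrunc hT a, fun n => ?_⟩
  · intro n g hg x hx hdx
    by_cases hn : n ∈ Set.Icc a b
    · obtain ⟨y, w, hyw⟩ := hc' n x hdx
      refine ⟨(K.X (n - 1)).proj g w, ?_⟩
      rw [lin_proj, ← internalProj_same (K.X n).isInternal hx]
      conv_rhs => rw [hyw, map_add]
      rw [right_eq_add, Finsupp.linearCombination_apply, Finsupp.sum, map_sum]
      refine Finset.sum_eq_zero fun i _ => ?_
      have h1 := proj_smul_of_mem (g - deg n i) (y i) (hc n i)
      rw [AddMonoidHom.id_apply, sub_add_cancel] at h1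
      rw [h1]
      have h2 : ℬ (g - deg n i) = ⊥ := by
        by_contra h
        exact hg ⟨deg n i, Set.mem_biUnion hn ⟨i, rfl⟩, hS _ h⟩
      have h3 : bproj ℬ (g - deg n i) (y i) ∈ ℬ (g - deg n i) := internalProj_mem _ _ _
      rw [h2, Submodule.mem_bot] at h3
      rw [h3, zero_smul]
    · have h0 : IsZero (K.X n) := by
        obtain h | h : n < a ∨ b < n := by
          by_contra! h
          exact hn h
        · exact K.isZero_of_isStrictlyGE a n h
        · exact K.isZero_of_isStrictlyLE b n h
      exact ⟨0, by rw [map_zero, eq_zero_of_isZero h0 x]⟩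
  · have h1 : (hD.toFinset.sup fun d => (· + ω d) '' (ω '' (S : Set G))).IsWF := by
      refine (Finset.isWF_sup _).2 fun i _ => ?_
      rw [← Set.isPWO_iff_isWF] at hSω ⊢
      exact hSω.image_of_monotone fun _ _ h => by gcongr
    refine h1.mono ?_
    rintro _ ⟨g, hg, rfl⟩
    have hgT : g ∈ T := by
      by_contra hgT
      refine hg ((AddSubgroup.eq_bot_iff_forall _).2 fun x hx => Subtype.ext ?_)
      exact (internalProj_same (K.X n).isInternal hx).symm.trans (x.2 g hgT)
    obtain ⟨d, hd, hgd⟩ := hgT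
    rw [Finset.sup_eq_iSup]
    refine Set.mem_iUnion.2 ⟨d, Set.mem_iUnion.2 ⟨by simpa using hd, ω (g - d), ⟨g - d, hgd, rfl⟩, ?_⟩⟩
    exact (map_add ω _ _).symm.trans (congrArg ω (sub_add_cancel g d))

end GradingTruncation

/-! ### Injective dimension after forgetting the grading -/

section InjectiveDimension

open CochainComplex HomComplex GrMod

variable {k : Type v} [CommRing k] {G : Type} [DecidableEq G] [AddCommGroup G]
  {B : Type u} [Ring B] [Algebra k B] {ℬ : G → Submodule k B} [GradedAlgebra ℬ]
  {Γ : Type} [AddCommGroup Γ] [LinearOrder Γ] {ω : G →+ Γ}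
  {H : Type} [DecidableEq H] [AddCommGroup H] {φ : G →+ H} {ℬ' : H → Submodule k B}
  {hℬ' : ∀ h, ℬ' h ≤ pushGrading φ ℬ h} {K : CochainComplex (GrMod ℬ') ℤ}

omit [GradedAlgebra ℬ] in
theorem HasInjDimLE.gradingShift {K : CochainComplex (GrMod ℬ) ℤ} {n : ℤ} (h : HasInjDimLE K n)
    (g : G) : HasInjDimLE (gradingShift g K) n := by
  obtain ⟨I, f, hf, hI, ⟨a, ha⟩, hn⟩ := h
  exact ⟨_root_.gradingShift g I, gradingShiftMap g f, inferInstance,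
    fun i => have := hI i; injective_shift g (I.X i), ⟨a, inferInstance⟩, inferInstance⟩

namespace FilteredComplex

omit [GradedAlgebra ℬ] in
theorem isKProjective_complex (C : FilteredComplex ℬ ω) (hC : ∀ n, Module.Projective B (C.X n))
    (b : ℤ) (hb : ∀ n, b ≤ n → ∀ x : C.X n, x = 0) : C.complex.IsKProjective := by
  have (i : ℤ) : Projective (C.complex.X i) :=
    (IsProjective.iff_projective (R := B) (C.X i)).1 (hC i)
  have : C.complex.IsStrictlyLE b := by
    rw [isStrictlyLE_iff]
    intro i hi
    exact (IsZero.iff_id_eq_zero _).2 (ModuleCat.hom_ext (LinearMap.ext fun x => hb i hi.le x))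
  exact isKProjective_of_projective _ b

theorem isKProjective_gr [IsOrderedAddMonoid Γ] (hω : Function.Injective ω)
    (C : FilteredComplex ℬ ω) (hC : ∀ n, Module.Projective B (C.X n))
    (b : ℤ) (hb : ∀ n, b ≤ n → ∀ x : C.X n, x = 0) : (C.gr hω).IsKProjective := by
  have (i : ℤ) : Projective ((C.gr hω).X i) :=
    have := hC i
    projective_of_module_projective (C.X i)
  have : (C.gr hω).IsStrictlyLE b := by
    rw [isStrictlyLE_iff]
    intro i hi
    exact (IsZero.iff_id_eq_zero _).2 (GrMod.hom_ext' fun x => hb i hi.le x)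
  exact isKProjective_of_projective _ b

end FilteredComplex

namespace FilteredResolution

variable (F : FilteredResolution ω φ ℬ' hℬ' K)

/-- The complex of `H`-graded modules underlying a filtered resolution. -/
def complex : CochainComplex (GrMod ℬ') ℤ :=
  CochainComplex.of (fun n => pushObj φ ℬ' hℬ' (free ℬ (F.deg n))) F.d F.d_comp_d

theorem complex_d (n : ℤ) : F.complex.d n (n + 1) = F.d n :=
  CochainComplex.of_d (fun n => pushObj φ ℬ' hℬ' (free ℬ (F.deg n))) F.d n

/-- The quasi-isomorphism from a filtered resolution to the given complex. -/
def map : F.complex ⟶ K where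
  f := F.f
  comm' i j hij := by
    obtain rfl : i + 1 = j := hij
    rw [complex_d]
    exact F.comm i

instance : QuasiIso F.map := by
  refine GrMod.quasiIso_of_elements _ (fun n x hx => ?_) (fun n z hz hw => ?_)
  · rw [complex_d]
    exact F.exists_eq n x hx
  · obtain ⟨n, rfl⟩ : ∃ m, m + 1 = n := ⟨n - 1, by lia⟩
    rw [complex_d] at hz
    obtain ⟨m, hm⟩ : ∃ m, m = n + 1 - 1 := ⟨_, rfl⟩
    rw [← hm] at hw ⊢
    obtain rfl : m = n := by lia
    rw [complex_d]
    exact F.exact m z hz hw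

theorem module_projective_X (n : ℤ) : Module.Projective B (F.complex.X n) :=
  inferInstanceAs (Module.Projective B (free ℬ (F.deg n)))

theorem module_finite_X (n : ℤ) : Module.Finite B (F.complex.X n) :=
  have := F.fin n
  inferInstanceAs (Module.Finite B (free ℬ (F.deg n)))

theorem eq_zero_of_isEmpty {n : ℤ} (hn : IsEmpty (F.ι n)) (x : F.complex.X n) : x = 0 :=
  Finsupp.ext (f := (show F.ι n →₀ B from x)) (g := 0) fun i => hn.elim i

theorem isStrictlyLE (b : ℤ) (hb : ∀ n, b ≤ n → IsEmpty (F.ι n)) : F.complex.IsStrictlyLE b := by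
  rw [isStrictlyLE_iff]
  intro i hi
  exact (IsZero.iff_id_eq_zero _).2 (hom_ext' fun x => F.eq_zero_of_isEmpty (hb i hi.le) x)

variable [IsOrderedAddMonoid Γ]

/-- The filtered complex of `G`-graded modules given by a filtered resolution. -/
def filtered : FilteredComplex ℬ ω where
  X n := free ℬ (F.deg n)
  d n := lin (M := pushObj φ ℬ' hℬ' (free ℬ (F.deg n)))
    (N := pushObj φ ℬ' hℬ' (free ℬ (F.deg (n + 1)))) (F.d n)
  d_comp_d n := congrArg lin (F.d_comp_d n)
  isFilMap n g x hx := by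
    rw [add_zero]
    exact F.mem_fil n g x hx

/-- The complexes of modules underlying a filtered resolution agree. -/
def filteredIso : F.filtered.complex ≅ forgetComplex F.complex :=
  HomologicalComplex.Hom.isoOfComponents (fun n => Iso.refl (ModuleCat.of B (free ℬ (F.deg n)))) (by
    intro i j hij
    obtain rfl : i + 1 = j := hij
    rw [FilteredComplex.complex_d]
    change 𝟙 _ ≫ (GrMod.forget ℬ').map (F.complex.d i (i + 1)) = _ ≫ 𝟙 _
    rw [complex_d]
    rfl)

/-- The associated graded complex of a filtered resolution is exact in the degrees in which `K` is
zero. -/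
theorem exactAt_gr (hω : Function.Injective ω) (n : ℤ) (hn : ∀ x : K.X n, x = 0) :
    (F.filtered.gr hω).ExactAt n := by
  obtain ⟨n, rfl⟩ : ∃ m, m + 1 = n := ⟨n - 1, by lia⟩
  rw [GrMod.exactAt_iff]
  obtain ⟨m, hm⟩ : ∃ m, m = n + 1 - 1 := ⟨_, rfl⟩
  rw [← hm]
  obtain rfl : m = n := by lia
  rw [FilteredComplex.gr_d, FilteredComplex.gr_d]
  have hd (i : ℤ) : ∃ d : free ℬ (F.deg i) →ₗ[B] free ℬ (F.deg (i + 1)),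
    (∀ x, d x = lin (F.d i) x) ∧ F.filtered.d i = d :=
      ⟨F.filtered.d i, fun _ => rfl, rfl⟩
  choose d hd hd' using hd
  rw [hd', hd']
  have hfil (i : ℤ) : IsFilMap (M := free ℬ (F.deg i)) (N := free ℬ (F.deg (i + 1))) ω 0 (d i) :=
    hd' i ▸ F.filtered.isFilMap i
  have hstrict (i : ℤ) (x : free ℬ (F.deg i)) (γ) (hx : d i x ∈ (free ℬ (F.deg (i + 1))).fil ω γ) :
      ∃ y ∈ (free ℬ (F.deg i)).fil ω γ, d i y = d i x := by
    rw [hd] at hx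
    obtain ⟨y, hy, h⟩ := F.strict i x γ hx
    exact ⟨y, hy, by rw [hd, hd, h]⟩
  have hexact (x : free ℬ (F.deg (m + 1))) (hx : d (m + 1) x = 0) : ∃ y, d m y = x := by
    rw [hd] at hx
    obtain ⟨y, hy⟩ := F.exact m x hx ⟨0, by rw [map_zero]; exact (hn _).symm⟩
    exact ⟨y, (hd m y).trans hy⟩
  have hrange (x : free ℬ (F.deg (m + 1))) (hx : homComp 0 (d (m + 1)) x = 0) :
      x ∈ LinearMap.range (homComp 0 (d m)) := by
    rw [← sum_proj_toFinset x]
    refine sum_mem fun g _ => ?_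
    set y := (free ℬ (F.deg (m + 1))).proj g x with hy
    have hyg : y ∈ (free ℬ (F.deg (m + 1))).gr g := internalProj_mem _ _ _
    have hdy : (free ℬ (F.deg (m + 1 + 1))).proj g (d (m + 1) y) = 0 := by
      have := homComp_of_mem 0 (d (m + 1)) hyg
      rw [add_zero] at this
      rw [← this, hy, ← homComp_proj, hx, map_zero]
    -- subtracting an element of lower degree turns `y` into a cycle of the filtered complex
    obtain ⟨y', hy', hyy', h0⟩ : ∃ y' ∈ (free ℬ (F.deg (m + 1))).fil ω (ω g),
        d (m + 1) y' = d (m + 1) y ∧ (free ℬ (F.deg (m + 1))).proj g y' = 0 := by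
      by_cases h0 : d (m + 1) y = 0
      · exact ⟨0, zero_mem _, by rw [map_zero, h0], map_zero _⟩
      · obtain ⟨h, hh, hh'⟩ := exists_leading ω h0
        obtain ⟨y', hy', hyy'⟩ := hstrict (m + 1) y _ hh'
        have hle : ω h ≤ ω g := by
          have := hfil (m + 1) g y hyg h hh
          rwa [add_zero] at this
        refine ⟨y', fil_mono hle hy', hyy', by_contra fun hg => hh ?_⟩
        rw [hω (le_antisymm hle (hy' g hg)), hdy]
    obtain ⟨w, hw⟩ := hexact (y - y') (by rw [map_sub, hyy', sub_self])
    obtain ⟨w', hw', hww'⟩ := hstrict m w (ω g) (by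
      rw [hw]
      exact sub_mem (mem_fil_of_mem hyg) hy')
    refine ⟨(free ℬ (F.deg m)).proj g w', ?_⟩
    rw [← (hfil m).proj_apply hω hw', add_zero, hww', hw, map_sub, h0, sub_zero]
    exact internalProj_same _ hyg
  exact fun x hx => hrange x hx

end FilteredResolution

section Trivial

variable (ℬ) in
/-- A module as a module with the grading by the trivial group. -/
def GrMod.ofModule (N : Type u) [AddCommGroup N] [Module B N] :
    GrMod (pushGrading (0 : G →+ PUnit.{1}) ℬ) where
  carrier := N
  gr _ := ⊤
  isInternal := isInternal_of_proj _ (fun _ => AddMonoidHom.id N) (fun _ _ _ => rfl)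
    (fun _ _ h => absurd rfl h) fun x =>
      AddSubmonoid.subset_closure (Set.mem_iUnion.2 ⟨0, AddSubgroup.mem_top x⟩)
  smul_mem' _ _ _ _ _ _ := AddSubgroup.mem_top _

omit [DecidableEq G] [GradedAlgebra ℬ] in
/-- The cohomology of a cyclic module placed in degree `0` is generated by one element. -/
theorem hasFiniteGenerators_single (N : Type u) [AddCommGroup N] [Module B N] (e : N)
    (he : ∀ x : N, ∃ b : B, b • e = x) (n : ℤ) :
    HasFiniteGenerators ((HomologicalComplex.single _ (ComplexShape.up ℤ) 0).obj
      (ofModule ℬ N)) (0 : G →+ PUnit.{1}) n := by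
  by_cases hn : n = 0
  · subst hn
    let i := HomologicalComplex.singleObjXSelf (ComplexShape.up ℤ) (0 : ℤ) (ofModule ℬ N)
    refine ⟨PUnit, inferInstance, fun _ => 0, fun _ => lin i.inv e,
      fun _ => lin_mem i.inv (AddSubgroup.mem_top e), fun _ => by
        rw [HomologicalComplex.single_obj_d]
        rfl, fun x _ => ?_⟩
    obtain ⟨b, hb⟩ := he (lin i.hom x)
    refine ⟨Finsupp.single PUnit.unit b, 0, ?_⟩
    rw [map_zero, add_zero, Finsupp.linearCombination_single]
    exact (congrArg (fun f : _ ⟶ _ => lin f x) i.hom_inv_id).symm.trans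
      ((congrArg (lin i.inv) hb.symm).trans (map_smul (lin i.inv) b (show ofModule ℬ N from e)))
  · have h0 := HomologicalComplex.isZero_single_obj_X (ComplexShape.up ℤ) 0 (ofModule ℬ N) n hn
    exact ⟨PEmpty, inferInstance, PEmpty.elim, PEmpty.elim, fun i => i.elim, fun i => i.elim,
      fun x _ => ⟨0, 0, by rw [map_zero, map_zero, add_zero, eq_zero_of_isZero h0 x]⟩⟩

variable [IsOrderedAddMonoid Γ]

/-- Forgetting the grading does not increase the injective dimension of a complex of graded
modules with well-ordered sets of degrees: by Baer's criterion it suffices to consider cocycles on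
free resolutions of cyclic modules; these are filtered complexes, and the cocycles on the
associated graded complexes are coboundaries. -/
theorem HasInjDimLE.forgetComplex_of_isWFGraded [IsNoetherianRing B]
    {R : CochainComplex (GrMod ℬ) ℤ} (hω : Function.Injective ω)
    (hℬ : (ω '' {g | ℬ g ≠ ⊥}).IsWF) (hR : ∀ n, (R.X n).IsWFGraded ω) (a : ℤ) [R.IsStrictlyGE a]
    {n : ℤ} (h : HasInjDimLE R n) : HasInjDimLE (forgetComplex R) n := by
  refine hasInjDimLE_of_injective_cycles a n
    (fun i hi => (forgetComplex_exactAt_iff i).2 (h.exactAt i hi)) fun J j hj hJ hJa => ?_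
  refine (Module.injective_iff_injective_object B (J.cycles n)).1 (Module.Baer.injective ?_)
  intro L f
  let S : ShortComplex (ModuleCat.{u} B) :=
    ShortComplex.mk (ModuleCat.ofHom L.subtype) (ModuleCat.ofHom L.mkQ)
      (ModuleCat.hom_ext (LinearMap.ext fun x => (Submodule.Quotient.mk_eq_zero L).2 x.2))
  have hS : S.ShortExact :=
    { exact := (ShortComplex.moduleCat_exact_iff _).2 fun x hx =>
        ⟨⟨x, (Submodule.Quotient.mk_eq_zero L).1 hx⟩, rfl⟩
      mono_f := (ModuleCat.mono_iff_injective _).2 L.injective_subtype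
      epi_g := (ModuleCat.epi_iff_surjective _).2 L.mkQ_surjective }
  obtain ⟨F, hF⟩ := exists_filteredResolution ω (φ := (0 : G →+ PUnit.{1}))
    (ℬ' := pushGrading (0 : G →+ PUnit.{1}) ℬ) (hℬ' := fun _ => le_rfl)
    (K := (HomologicalComplex.single _ (ComplexShape.up ℤ) 0).obj (ofModule ℬ (B ⧸ L)))
    (fun g b hb => mem_pushGrading _ rfl hb) hω hℬ
    (hasFiniteGenerators_single (B ⧸ L) (L.mkQ 1) fun x => by
      obtain ⟨b, rfl⟩ := L.mkQ_surjective x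
      exact ⟨b, by rw [← map_smul, smul_eq_mul, mul_one]⟩) 1
    fun i hi x => eq_zero_of_isZero
      (HomologicalComplex.isZero_single_obj_X (ComplexShape.up ℤ) 0 _ i (by lia)) x
  have hle := F.isStrictlyLE 1 hF
  obtain ⟨q, hq⟩ : ∃ q : _root_.forgetComplex ((HomologicalComplex.single _ (ComplexShape.up ℤ) 0).obj
      (ofModule ℬ (B ⧸ L))) ⟶ (singleFunctor (ModuleCat.{u} B) 0).obj S.X₃, IsIso q :=
    ⟨_, ((HomologicalComplex.singleMapHomologicalComplex
      (GrMod.forget (pushGrading (0 : G →+ PUnit.{1}) ℬ)) (ComplexShape.up ℤ) 0).app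
        (ofModule ℬ (B ⧸ L))).isIso_hom⟩
  have hP : F.filtered.complex.IsKProjective :=
    F.filtered.isKProjective_complex F.module_projective_X 1
      fun i hi x => F.eq_zero_of_isEmpty (hF i hi) x
  have hP' : (F.filtered.gr hω).IsKProjective :=
    F.filtered.isKProjective_gr hω F.module_projective_X 1
      fun i hi x => F.eq_zero_of_isEmpty (hF i hi) x
  have hGE : (F.filtered.gr hω).IsGE 0 := by
    rw [isGE_iff]
    intro i hi
    exact F.exactAt_gr hω i fun x => eq_zero_of_isZero
      (HomologicalComplex.isZero_single_obj_X (ComplexShape.up ℤ) 0 _ i (by lia)) x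
  obtain ⟨g, hg, hg'⟩ := exists_extend_of_forall_exists_δ_eq j hJ a S hS
    (F.filteredIso.hom ≫ forgetMap F.map ≫ q) n
    (F.filtered.exists_δ_eq hω F.module_finite_X a 1 (fun i hi x => F.eq_zero_of_isEmpty (hF i hi) x)
      (fun i hi x => eq_zero_of_isZero (R.isZero_of_isStrictlyGE a i hi) x) hR rfl
      fun e z hz hδ => by
        obtain ⟨w, rfl⟩ := exists_unshiftCochain_eq hz
        rw [δ_unshiftCochain] at hδ
        obtain ⟨u, rfl⟩ := (h.gradingShift e).exists_δ_eq (F.filtered.gr hω) rfl (lt_add_one n) w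
          (unshiftCochain_injective e _ (hδ.trans rfl))
        exact ⟨unshiftCochain e u, unshiftCochain_mem e u, δ_unshiftCochain e _ _ u⟩)
    (ModuleCat.ofHom f ≫ J.iCycles n) (by rw [Category.assoc, J.iCycles_d, comp_zero])
  refine ⟨(J.liftCycles g (n + 1) (by simp) hg).hom, fun x hx => ?_⟩
  have h1 : S.f ≫ J.liftCycles g (n + 1) (by simp) hg = ModuleCat.ofHom f := by
    rw [← cancel_mono (J.iCycles n), Category.assoc, J.liftCycles_i, hg']
  exact ConcreteCategory.congr_hom h1 ⟨x, hx⟩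

/-- Forgetting the grading does not increase the injective dimension of a bounded complex
with finitely generated cohomology. -/
theorem HasInjDimLE.forgetComplex [IsNoetherianRing B] {R : CochainComplex (GrMod ℬ) ℤ}
    (hω : Function.Injective ω) (S : AddSubmonoid G) (hS : ∀ g, ℬ g ≠ ⊥ → g ∈ S)
    (hSω : (ω '' (S : Set G)).IsWF) (a b : ℤ) [R.IsStrictlyGE a] [R.IsStrictlyLE b]
    (hR : ∀ n, Module.Finite B ((_root_.forgetComplex R).homology n))
    {n : ℤ} (h : HasInjDimLE R n) : HasInjDimLE (_root_.forgetComplex R) n := by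
  obtain ⟨R', f, hf, hR', hwf⟩ := exists_quasiIso_isWFGraded (K := R) S hS hSω a b hR
  exact ((h.of_quasiIso_comp f).forgetComplex_of_isWFGraded hω
    (hSω.mono (Set.image_mono hS)) hwf a).of_quasiIso (forgetMap f)

end Trivial

end InjectiveDimension

/-! ### Comparison of graded and ungraded derived endomorphisms -/

section Comparison

open CochainComplex HomComplex GrMod

variable {k : Type v} [CommRing k] {G : Type} [DecidableEq G] [AddCommGroup G]
  {B : Type u} [Ring B] [Algebra k B] {ℬ : G → Submodule k B}
  {K L M : CochainComplex (GrMod ℬ) ℤ}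

variable (K L) in
/-- The inclusion of the complex of graded homomorphisms in the complex of all homomorphisms. -/
def gradedHomInclusion :
    gradedHomComplex K L ⟶ HomComplex (forgetComplex K) (forgetComplex L) where
  f n := AddCommGrpCat.ofHom (gradedCochain K L n).subtype
  comm' _ _ _ := rfl

theorem ofHom_comp_mem_gradedCochain (f : K ⟶ L) {n : ℤ}
    {z : Cochain (forgetComplex L) (forgetComplex M) n} (hz : z ∈ gradedCochain L M n) :
    (Cochain.ofHom (forgetMap f)).comp z (zero_add n) ∈ gradedCochain K M n := by
  refine AddSubgroup.iSup_induction (homogCochain L M n) (C := fun z =>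
    (Cochain.ofHom (forgetMap f)).comp z (zero_add n) ∈ gradedCochain K M n) hz ?_ ?_ ?_
  · refine fun g z hz => AddSubgroup.mem_iSup_of_mem g fun p q hpq h x hx => ?_
    rw [Cochain.zero_cochain_comp_v, Cochain.ofHom_v]
    exact hz p q hpq h _ (lin_mem (f.f p) hx)
  · rw [Cochain.comp_zero]
    exact zero_mem _
  · intro z z' hz hz'
    rw [Cochain.comp_add]
    exact add_mem hz hz'

variable [GradedAlgebra ℬ]

theorem sum_cochainComp_mem {n : ℤ} (z : Cochain (forgetComplex K) (forgetComplex L) n)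
    (s : Finset G) : ∑ g ∈ s, cochainComp g z ∈ gradedCochain K L n :=
  sum_mem fun g _ => AddSubgroup.mem_iSup_of_mem g (cochainComp_mem g z)

theorem δ_sum_cochainComp {n : ℤ} (z : Cochain (forgetComplex K) (forgetComplex L) n)
    (s : Finset G) (m : ℤ) :
    δ n m (∑ g ∈ s, cochainComp g z) = ∑ g ∈ s, cochainComp g (δ n m z) := by
  refine (map_sum (δ_hom ℤ (forgetComplex K) (forgetComplex L) n m) _ _).trans
    (Finset.sum_congr rfl fun g _ => δ_cochainComp g n m z)

theorem cochainComp_comp_ofHom (g : G) {n : ℤ} (z : Cochain (forgetComplex K) (forgetComplex L) n)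
    (f : L ⟶ M) : cochainComp g (z.comp (Cochain.ofHom (forgetMap f)) (add_zero n)) =
      (cochainComp g z).comp (Cochain.ofHom (forgetMap f)) (add_zero n) := by
  ext p q hpq : 2
  rw [cochainComp_v, Cochain.comp_zero_cochain_v, Cochain.comp_zero_cochain_v, Cochain.ofHom_v]
  exact homComp_comp_lin (M := K.X p) (N := L.X q) g (z.v p q hpq).hom (f.f q)

theorem sum_cochainComp_comp_ofHom (s : Finset G) {n : ℤ}
    (z : Cochain (forgetComplex K) (forgetComplex L) n) (f : L ⟶ M) :
    (∑ g ∈ s, cochainComp g z).comp (Cochain.ofHom (forgetMap f)) (add_zero n) =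
      ∑ g ∈ s, cochainComp g (z.comp (Cochain.ofHom (forgetMap f)) (add_zero n)) := by
  simp only [cochainComp_comp_ofHom]
  exact map_sum (AddMonoidHom.mk' (fun z : Cochain (forgetComplex K) (forgetComplex L) n =>
    z.comp (Cochain.ofHom (forgetMap f)) (add_zero n)) fun _ _ => Cochain.add_comp _ _ _ _)
    (fun g => cochainComp g z) s

/-- A graded cochain that is a coboundary is the coboundary of a graded cochain. -/
theorem exists_mem_gradedCochain_δ_eq {n m : ℤ}
    {z : Cochain (forgetComplex K) (forgetComplex L) n} (hz : z ∈ gradedCochain K L n)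
    (u : Cochain (forgetComplex K) (forgetComplex L) m) (hu : δ m n u = z) :
    ∃ v ∈ gradedCochain K L m, δ m n v = z := by
  refine ⟨_, sum_cochainComp_mem u (cochainComp_finite hz).toFinset, ?_⟩
  rw [δ_sum_cochainComp, hu]
  exact sum_cochainComp _ fun g hg => by simpa using hg

variable {Γ : Type} [AddCommGroup Γ] [LinearOrder Γ] [IsOrderedAddMonoid Γ] {ω : G →+ Γ}

/-- The graded endomorphisms of a projective resolution `P` of a bounded complex with finitely
generated cohomology are quasi-isomorphic to all endomorphisms: `P` is homotopy equivalent to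
a resolution by finitely generated modules, and all cochains from such a resolution to
a bounded complex are graded. -/
theorem quasiIso_gradedHomInclusion [IsNoetherianRing B] (hω : Function.Injective ω)
    (hℬ : (ω '' {g | ℬ g ≠ ⊥}).IsWF) {P R : CochainComplex (GrMod ℬ) ℤ}
    (hP : ∀ i, Projective (P.X i)) (b : ℤ) [P.IsStrictlyLE b] (f : P ⟶ R) [QuasiIso f] (a : ℤ)
    [R.IsStrictlyGE a] (hR : ∀ n, Module.Finite B ((forgetComplex R).homology n)) :
    QuasiIso (gradedHomInclusion P P) := by
  have hfin (n : ℤ) : Module.Finite B ((forgetComplex P).homology n) :=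
    (Module.Finite.equiv_iff
      (asIso (HomologicalComplex.homologyMap (forgetMap f) n)).toLinearEquiv).2 (hR n)
  obtain ⟨F, hF⟩ := exists_filteredResolution ω (φ := AddMonoidHom.id G) (ℬ' := ℬ)
    (hℬ' := fun g b hb => mem_pushGrading _ rfl hb) (K := P) (fun _ => le_rfl) hω hℬ
    (fun n => hasFiniteGenerators P n) (b + 1)
    fun i hi x => eq_zero_of_isZero (P.isZero_of_isStrictlyLE b i (by lia)) x
  have hle := F.isStrictlyLE (b + 1) hF
  have hQ : (forgetComplex F.complex).IsKProjective := isKProjective_forgetComplex (b + 1) fun i =>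
    have := F.module_projective_X i
    projective_of_module_projective _
  have hP' : P.IsKProjective := isKProjective_of_projective P b
  -- a right inverse of `F.map` up to homotopy
  obtain ⟨w, u₀, hw, hu⟩ := exists_lift_of_quasiIso F.map (by lia : (-1 : ℤ) + 1 = 0)
    (Cochain.ofHom (𝟙 P)) (δ_ofHom _)
  obtain ⟨p, hp⟩ := (Cocycle.equivHom _ _).surjective (Cocycle.mk w _ rfl hw)
  obtain rfl : Cochain.ofHom p = w := congrArg Subtype.val hp
  have hu' : Cochain.ofHom (𝟙 (forgetComplex P)) =
      (Cochain.ofHom (forgetMap p)).comp (Cochain.ofHom (forgetMap F.map)) (zero_add 0) +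
        δ (-1) 0 (u₀.map (GrMod.forget ℬ)) := by
    rw [δ_map, ← Cochain.map_ofHom, ← Cochain.map_ofHom, ← Cochain.map_comp, ← Cochain.map_add, ← hu,
      Cochain.map_ofHom, CategoryTheory.Functor.map_id]
  refine quasiIso_of_elements _ (fun n z hz => ?_) (fun n z hz hw => ?_)
  · let z : Cochain (forgetComplex P) (forgetComplex P) n := z
    replace hz : δ n (n + 1) z = 0 := hz
    -- the cocycle `y` is homologous to the graded cocycle `w`, since the compositions with `f` agree
    let y := (Cochain.ofHom (forgetMap F.map)).comp z (zero_add n)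
    have hy : δ n (n + 1) y = 0 := by rw [δ_ofHom_comp, hz, Cochain.comp_zero]
    have hs := finite_cochainComp F.module_finite_X a (b + 1)
      (fun i hi x => F.eq_zero_of_isEmpty (hF i hi) x)
      (fun i hi x => eq_zero_of_isZero (R.isZero_of_isStrictlyGE a i hi) x)
      (y.comp (Cochain.ofHom (forgetMap f)) (add_zero n))
    let w := ∑ g ∈ hs.toFinset, cochainComp g y
    have hwf : w.comp (Cochain.ofHom (forgetMap f)) (add_zero n) =
        y.comp (Cochain.ofHom (forgetMap f)) (add_zero n) := by
      rw [sum_cochainComp_comp_ofHom]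
      exact sum_cochainComp hs.toFinset fun g hg => by simpa using hg
    have hw : δ n (n + 1) w = 0 := by
      rw [δ_sum_cochainComp, hy]
      exact Finset.sum_eq_zero fun g _ => cochainComp_zero g
    obtain ⟨v, hv⟩ := exists_δ_eq_of_comp_quasiIso (forgetMap f) (sub_add_cancel n 1) (y - w)
      (by rw [δ_sub, hy, hw, sub_zero]) 0 (by rw [δ_zero, Cochain.sub_comp, hwf, sub_self])
    refine ⟨⟨(Cochain.ofHom (forgetMap p)).comp w (zero_add n),
      ofHom_comp_mem_gradedCochain p (sum_cochainComp_mem y _)⟩, Subtype.ext ?_,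
      (Cochain.ofHom (forgetMap p)).comp v (zero_add (n - 1)) +
        n.negOnePow • (u₀.map (GrMod.forget ℬ)).comp z (by lia : -1 + n = n - 1), ?_⟩
    · change δ n (n + 1) ((Cochain.ofHom (forgetMap p)).comp w (zero_add n)) = 0
      rw [δ_ofHom_comp, hw, Cochain.comp_zero]
    · change z = (Cochain.ofHom (forgetMap p)).comp w (zero_add n) + δ (n - 1) n _
      rw [δ_add, δ_ofHom_comp, hv, δ_units_smul, δ_comp _ _ (by lia) 0 (n + 1) n (by lia) (by lia) rfl,
        hz, Cochain.comp_zero, zero_add, smul_smul, Int.units_mul_self, one_smul, Cochain.comp_sub]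
      conv_lhs => rw [← Cochain.id_comp z, hu', Cochain.add_comp]
      rw [Cochain.comp_assoc_of_first_is_zero_cochain]
      abel
  · obtain ⟨u, hu⟩ := hw
    obtain ⟨v, hv, hvz⟩ := exists_mem_gradedCochain_δ_eq z.2 u hu
    exact ⟨⟨v, hv⟩, Subtype.ext hvz⟩

section NaturalMap

variable {C E : Type u} [Ring C] [Algebra k C] [Ring E] [Algebra k E] {ι : B →ₐ[k] E}
  {κ : C →ₐ[k] E} (hικ : ∀ b c, Commute (ι b) (κ c)) {𝒞 : G → Submodule k C}
  {ℰ : G → Submodule k E} (hι : ∀ g, ∀ b ∈ ℬ g, ι b ∈ ℰ g) (hκ : ∀ g, ∀ c ∈ 𝒞 g, κ c ∈ ℰ g)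
  (h𝒞 : ∀ c : C, c ∈ ⨆ g, 𝒞 g) (P : CochainComplex (GrMod ℰ) ℤ)

omit [GradedAlgebra ℬ] in
/-- The ungraded natural map factors through the graded one. -/
theorem gradedNatMap_comp_inclusion : gradedNatMap hικ hι hκ h𝒞 P ≫
    gradedHomInclusion (resGradedComplex hι P) (resGradedComplex hι P) =
      natMap hικ (forgetComplex P) := by
  refine HomologicalComplex.from_single_hom_ext ?_
  rfl

omit [GradedAlgebra ℬ] in
theorem quasiIso_gradedNatMap_iff
    (h : QuasiIso (gradedHomInclusion (resGradedComplex hι P) (resGradedComplex hι P))) :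
    QuasiIso (gradedNatMap hικ hι hκ h𝒞 P) ↔ QuasiIso (natMap hικ (forgetComplex P)) := by
  have := quasiIso_iff_comp_right (gradedNatMap hικ hι hκ h𝒞 P)
    (gradedHomInclusion (resGradedComplex hι P) (resGradedComplex hι P))
  rw [← this, gradedNatMap_comp_inclusion]
  exact Iff.rfl

end NaturalMap

end Comparison

/-! ### The gradings of the opposite and the enveloping algebra -/

section EnvelopingAlgebra

section Gradings

variable {k : Type v} [CommRing k] {A : Type u} [Ring A] [Algebra k A] {G : Type} [DecidableEq G]
  [AddCommGroup G] (𝒜 : G → Submodule k A) [GradedAlgebra 𝒜]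

theorem isInternal_opGrading : DirectSum.IsInternal (opGrading 𝒜) := by
  refine isInternal_of_proj _ (fun g => (MulOpposite.opAddEquiv : A ≃+ Aᵐᵒᵖ).toAddMonoidHom.comp
    ((GrMod.bproj 𝒜 g).comp (MulOpposite.opAddEquiv : A ≃+ Aᵐᵒᵖ).symm.toAddMonoidHom)) ?_ ?_ ?_
  · rintro g _ ⟨x, hx, rfl⟩
    exact congrArg MulOpposite.op (internalProj_same _ hx)
  · rintro g h hgh _ ⟨x, hx, rfl⟩
    exact congrArg MulOpposite.op (internalProj_ne _ hgh hx)
  · intro x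
    refine homogeneous_induction 𝒜 (p := fun a => MulOpposite.op a ∈ AddSubmonoid.closure
      (⋃ g, (opGrading 𝒜 g : Set Aᵐᵒᵖ))) x.unop (zero_mem _) ?_ (fun _ _ hx hy => add_mem hx hy)
    exact fun g a ha => AddSubmonoid.subset_closure (Set.mem_iUnion.2 ⟨g, a, ha, rfl⟩)

instance : GradedAlgebra (opGrading 𝒜) where
  one_mem := ⟨1, SetLike.GradedOne.one_mem, rfl⟩
  mul_mem := by
    rintro g h _ _ ⟨a, ha, rfl⟩ ⟨b, hb, rfl⟩
    rw [add_comm]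
    exact ⟨b * a, SetLike.GradedMul.mul_mem hb ha, rfl⟩
  toDecomposition := (isInternal_opGrading 𝒜).chooseDecomposition

/-- The projection to the component of degree `g` of the enveloping algebra. -/
def envProj (g : G) : A ⊗[k] Aᵐᵒᵖ →ₗ[k] A ⊗[k] Aᵐᵒᵖ :=
  TensorProduct.lift ((DirectSum.toModule k G (Aᵐᵒᵖ →ₗ[k] A ⊗[k] Aᵐᵒᵖ) fun h =>
    ((TensorProduct.mk k A Aᵐᵒᵖ).compl₂ (GradedAlgebra.proj (opGrading 𝒜) (g - h))).comp
      (𝒜 h).subtype).comp (DirectSum.decomposeLinearEquiv 𝒜).toLinearMap)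

/-- On `a ⊗ b` with `a` of degree `h`, the projection takes the component of degree `g - h` of `b`. -/
theorem envProj_tmul (g : G) {g₁ g₂ : G} {a b : A} (ha : a ∈ 𝒜 g₁) (hb : b ∈ 𝒜 g₂) :
    envProj 𝒜 g (a ⊗ₜ[k] MulOpposite.op b) =
      if g₁ + g₂ = g then a ⊗ₜ[k] MulOpposite.op b else 0 := by
  have hb' : MulOpposite.op b ∈ opGrading 𝒜 g₂ := ⟨b, hb, rfl⟩
  have h1 : envProj 𝒜 g (a ⊗ₜ[k] MulOpposite.op b) =
      a ⊗ₜ[k] GradedAlgebra.proj (opGrading 𝒜) (g - g₁) (MulOpposite.op b) := by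
    rw [envProj, TensorProduct.lift.tmul, LinearMap.comp_apply]
    refine (congrArg (fun x => DirectSum.toModule k G (Aᵐᵒᵖ →ₗ[k] A ⊗[k] Aᵐᵒᵖ) (fun h =>
      ((TensorProduct.mk k A Aᵐᵒᵖ).compl₂ (GradedAlgebra.proj (opGrading 𝒜) (g - h))).comp
        (𝒜 h).subtype) x (MulOpposite.op b)) (DirectSum.decompose_of_mem 𝒜 ha)).trans ?_
    rw [← DirectSum.lof_eq_of k, DirectSum.toModule_lof]
    rfl
  rw [h1, GradedAlgebra.proj_apply]
  by_cases h : g₁ + g₂ = g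
  · rw [if_pos h, ← h, add_sub_cancel_left, DirectSum.decompose_of_mem_same _ hb']
  · rw [if_neg h, DirectSum.decompose_of_mem_ne _ hb' fun h' => h (by rw [h']; abel),
      TensorProduct.tmul_zero]

theorem isInternal_envGrading : DirectSum.IsInternal (envGrading 𝒜) := by
  refine isInternal_of_proj _ (fun g => (envProj 𝒜 g).toAddMonoidHom) ?_ ?_ ?_
  · intro g x hx
    refine Submodule.span_induction (p := fun x _ => envProj 𝒜 g x = x) ?_ (map_zero _)
      (fun x y _ _ hx hy => by rw [map_add, hx, hy]) (fun c x _ hx => by rw [map_smul, hx]) hx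
    rintro _ ⟨g₁, g₂, hg, a, ha, b, hb, rfl⟩
    rw [envProj_tmul 𝒜 g ha hb, if_pos hg]
  · intro g h hgh x hx
    refine Submodule.span_induction (p := fun x _ => envProj 𝒜 h x = 0) ?_ (map_zero _)
      (fun x y _ _ hx hy => by rw [map_add, hx, hy, add_zero])
      (fun c x _ hx => by rw [map_smul, hx, smul_zero]) hx
    rintro _ ⟨g₁, g₂, hg, a, ha, b, hb, rfl⟩
    rw [envProj_tmul 𝒜 h ha hb, if_neg (hg ▸ hgh)]
  · intro x
    induction x using TensorProduct.induction_on with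
    | zero => exact zero_mem _
    | add x y hx hy => exact add_mem hx hy
    | tmul a b =>
      refine homogeneous_induction 𝒜 (p := fun a => a ⊗ₜ[k] b ∈ AddSubmonoid.closure
        (⋃ g, (envGrading 𝒜 g : Set (A ⊗[k] Aᵐᵒᵖ)))) a
        (by rw [TensorProduct.zero_tmul]; exact zero_mem _) (fun g a ha => ?_)
        (fun x y hx hy => by rw [TensorProduct.add_tmul]; exact add_mem hx hy)
      refine homogeneous_induction 𝒜 (p := fun b => a ⊗ₜ[k] MulOpposite.op b ∈
        AddSubmonoid.closure (⋃ g, (envGrading 𝒜 g : Set (A ⊗[k] Aᵐᵒᵖ)))) b.unop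
        (by rw [MulOpposite.op_zero, TensorProduct.tmul_zero]; exact zero_mem _) (fun h b hb => ?_)
        (fun x y hx hy => by
          rw [MulOpposite.op_add, TensorProduct.tmul_add]
          exact add_mem hx hy)
      exact AddSubmonoid.subset_closure (Set.mem_iUnion.2 ⟨g + h, tmul_mem_envGrading ha hb⟩)

instance : GradedAlgebra (envGrading 𝒜) where
  one_mem := by
    have := tmul_mem_envGrading (SetLike.GradedOne.one_mem (A := 𝒜))
      (SetLike.GradedOne.one_mem (A := 𝒜))
    rwa [add_zero] at this
  mul_mem := by
    intro g h x y hx hy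
    have hle : envGrading 𝒜 g * envGrading 𝒜 h ≤ envGrading 𝒜 (g + h) := by
      rw [envGrading, envGrading, Submodule.span_mul_span, Submodule.span_le]
      rintro _ ⟨_, ⟨g₁, g₂, rfl, a, ha, b, hb, rfl⟩, _, ⟨h₁, h₂, rfl, a', ha', b', hb', rfl⟩, rfl⟩
      have := tmul_mem_envGrading (SetLike.GradedMul.mul_mem ha ha')
        (SetLike.GradedMul.mul_mem hb' hb)
      rw [add_comm h₂ g₂, add_add_add_comm] at this
      change (a ⊗ₜ[k] MulOpposite.op b) * (a' ⊗ₜ[k] MulOpposite.op b') ∈ _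
      rwa [Algebra.TensorProduct.tmul_mul_tmul, ← MulOpposite.op_mul]
    exact hle (Submodule.mul_mem_mul hx hy)
  toDecomposition := (isInternal_envGrading 𝒜).chooseDecomposition

end Gradings

/-! ### Projective modules over the enveloping algebra -/

theorem module_projective_trans (B E M : Type*) [Ring B] [Ring E] [AddCommGroup M] [Module B E]
    [Module E M] [Module B M] [IsScalarTower B E E] [IsScalarTower B E M] [Module.Free B E]
    [Module.Projective E M] : Module.Projective B M := by
  obtain ⟨s, hs⟩ := Module.projective_def'.1 (‹Module.Projective E M›)
  exact Module.Projective.of_split (P := M) (M := M →₀ E) (s.restrictScalars B)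
    ((Finsupp.linearCombination E id).restrictScalars B)
    (LinearMap.ext fun x => LinearMap.congr_fun hs x)

/-- Restriction of scalars along `B → E` preserves projective modules if `E` is a free
`B`-module. -/
theorem module_projective_restrictScalars {B E : Type u} [Ring B] [Ring E] (f : B →+* E)
    (hE : Module.Free B ((ModuleCat.restrictScalars.{u} f).obj (ModuleCat.of E E)))
    (M : ModuleCat.{u} E) [Module.Projective E M] :
    Module.Projective B ((ModuleCat.restrictScalars.{u} f).obj M) := by
  let _ : Module B E := Module.compHom E f
  let _ : Module B M := Module.compHom M f
  have : IsScalarTower B E E := ⟨fun b e m => mul_assoc (f b) e m⟩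
  have : IsScalarTower B E M := ⟨fun b e m => mul_smul (f b) e m⟩
  have : Module.Free B E := hE
  exact module_projective_trans B E M

variable (k : Type v) [Field k] (A : Type u) [Ring A] [Algebra k A]

/-- The enveloping algebra is free as a left `A`-module, since `Aᵐᵒᵖ` is free over the field `k`. -/
theorem free_restrictScalars_includeLeft : Module.Free A ((ModuleCat.restrictScalars.{u}
    (Algebra.TensorProduct.includeLeft : A →ₐ[k] A ⊗[k] Aᵐᵒᵖ).toRingHom).obj
      (ModuleCat.of (A ⊗[k] Aᵐᵒᵖ) (A ⊗[k] Aᵐᵒᵖ))) := by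
  have : Module.Free A (A ⊗[k] Aᵐᵒᵖ) :=
    Module.Free.of_basis (Algebra.TensorProduct.basis A (Module.Free.chooseBasis k Aᵐᵒᵖ))
  have hsmul (a : A) (x : A ⊗[k] Aᵐᵒᵖ) : a • x = (a ⊗ₜ[k] (1 : Aᵐᵒᵖ)) * x := by
    induction x using TensorProduct.induction_on with
    | zero => rw [smul_zero, mul_zero]
    | add x y hx hy => rw [smul_add, mul_add, hx, hy]
    | tmul b c =>
      rw [TensorProduct.smul_tmul', Algebra.TensorProduct.tmul_mul_tmul, one_mul, smul_eq_mul]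
  let e : (A ⊗[k] Aᵐᵒᵖ) ≃ₗ[A] (ModuleCat.restrictScalars.{u}
      (Algebra.TensorProduct.includeLeft : A →ₐ[k] A ⊗[k] Aᵐᵒᵖ).toRingHom).obj
        (ModuleCat.of (A ⊗[k] Aᵐᵒᵖ) (A ⊗[k] Aᵐᵒᵖ)) :=
    { toFun := fun x => x
      invFun := fun x => x
      map_add' := fun _ _ => rfl
      map_smul' := hsmul
      left_inv := fun _ => rfl
      right_inv := fun _ => rfl }
  exact Module.Free.of_equiv e

theorem free_restrictScalars_includeRight : Module.Free Aᵐᵒᵖ ((ModuleCat.restrictScalars.{u}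
    (Algebra.TensorProduct.includeRight : Aᵐᵒᵖ →ₐ[k] A ⊗[k] Aᵐᵒᵖ).toRingHom).obj
      (ModuleCat.of (A ⊗[k] Aᵐᵒᵖ) (A ⊗[k] Aᵐᵒᵖ))) := by
  have : Module.Free Aᵐᵒᵖ (Aᵐᵒᵖ ⊗[k] A) :=
    Module.Free.of_basis (Algebra.TensorProduct.basis Aᵐᵒᵖ (Module.Free.chooseBasis k A))
  have hsmul (a : Aᵐᵒᵖ) (x : Aᵐᵒᵖ ⊗[k] A) : TensorProduct.comm k Aᵐᵒᵖ A (a • x) =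
      ((1 : A) ⊗ₜ[k] a) * TensorProduct.comm k Aᵐᵒᵖ A x := by
    induction x using TensorProduct.induction_on with
    | zero => rw [smul_zero, map_zero, mul_zero]
    | add x y hx hy => rw [smul_add, map_add, map_add, mul_add, hx, hy]
    | tmul b c =>
      rw [TensorProduct.smul_tmul', TensorProduct.comm_tmul, TensorProduct.comm_tmul,
        Algebra.TensorProduct.tmul_mul_tmul, one_mul, smul_eq_mul]
  let e : (Aᵐᵒᵖ ⊗[k] A) ≃ₗ[Aᵐᵒᵖ] (ModuleCat.restrictScalars.{u}
      (Algebra.TensorProduct.includeRight : Aᵐᵒᵖ →ₐ[k] A ⊗[k] Aᵐᵒᵖ).toRingHom).obj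
        (ModuleCat.of (A ⊗[k] Aᵐᵒᵖ) (A ⊗[k] Aᵐᵒᵖ)) :=
    { toFun := TensorProduct.comm k Aᵐᵒᵖ A
      invFun := (TensorProduct.comm k Aᵐᵒᵖ A).symm
      map_add' := map_add _
      map_smul' := hsmul
      left_inv := (TensorProduct.comm k Aᵐᵒᵖ A).left_inv
      right_inv := (TensorProduct.comm k Aᵐᵒᵖ A).right_inv }
  exact Module.Free.of_equiv e

end EnvelopingAlgebra

/-! ### Dualizing complexes over connected `ℕ^r`-graded algebras -/

section Connected

section Order

theorem toLexAddEquiv_injective (r : ℕ) :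
    Function.Injective (toLexAddEquiv (Fin r → ℤ)).toAddMonoidHom :=
  (toLexAddEquiv (Fin r → ℤ)).injective

/-- The lexicographic order is a well-order on `ℕ^r`. -/
theorem isWF_image_toLex (r : ℕ) : ((toLexAddEquiv (Fin r → ℤ)).toAddMonoidHom ''
    (AddSubmonoid.nonneg (Fin r → ℤ) : Set (Fin r → ℤ))).IsWF := by
  have h : ((fun (x : Fin r → ℕ) => toLex fun i => (x i : ℤ)) '' Set.univ).IsPWO :=
    (Set.isPWO_of_wellQuasiOrderedLE _).image_of_monotone fun x y hxy =>
      Pi.toLex_monotone fun i => Int.ofNat_le.2 (hxy i)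
  refine h.isWF.mono ?_
  rintro _ ⟨x, hx, rfl⟩
  exact ⟨fun i => (x i).toNat, trivial, congrArg toLex (funext fun i => Int.toNat_of_nonneg (hx i))⟩

end Order

section OneSide

variable {k : Type v} [CommRing k] {r : ℕ} {B : Type u} [Ring B] [Algebra k B]
  {ℬ : (Fin r → ℤ) → Submodule k B} [GradedAlgebra ℬ] [IsNoetherianRing B]

/-- Over a noetherian algebra with a grading supported in `ℕ^r`, forgetting the grading does not
change the injective dimension of a bounded complex with finitely generated cohomology. -/
theorem hasInjDimLE_forgetComplex_iff (hℬ : ∀ g, ¬ 0 ≤ g → ℬ g = ⊥)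
    {K : CochainComplex (GrMod ℬ) ℤ} (hK : IsBoundedComplex K)
    (hfin : ∀ n, Module.Finite B (K.homology n)) (n : ℤ) :
    HasInjDimLE (forgetComplex K) n ↔ HasInjDimLE K n := by
  obtain ⟨a, b, _, _⟩ := hK
  exact ⟨fun h => h.of_forget a, fun h => h.forgetComplex (toLexAddEquiv_injective r)
    (AddSubmonoid.nonneg _) (fun g hg => not_imp_comm.1 (hℬ g) hg) (isWF_image_toLex r) a b
    fun n => (finite_homology_forgetComplex_iff K n).2 (hfin n)⟩

variable {C E : Type u} [Ring C] [Algebra k C] [Ring E] [Algebra k E] {ι : B →ₐ[k] E}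
  {κ : C →ₐ[k] E} (hικ : ∀ b c, Commute (ι b) (κ c)) {𝒞 : (Fin r → ℤ) → Submodule k C}
  {ℰ : (Fin r → ℤ) → Submodule k E} [GradedAlgebra ℰ] (hι : ∀ g, ∀ b ∈ ℬ g, ι b ∈ ℰ g)
  (hκ : ∀ g, ∀ c ∈ 𝒞 g, κ c ∈ ℰ g) (h𝒞 : ∀ c : C, c ∈ ⨆ g, 𝒞 g)

/-- The natural map `C → RHOM_B(R, R)` is an isomorphism if and only if the natural map
`C → RHom_B(R, R)` is. -/
theorem quasiIso_gradedNatMap_iff_of_isProjResolution (hℬ : ∀ g, ¬ 0 ≤ g → ℬ g = ⊥)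
    (hE : Module.Free B ((ModuleCat.restrictScalars.{u} ι.toRingHom).obj (ModuleCat.of E E)))
    {P R : CochainComplex (GrMod ℰ) ℤ} {f : P ⟶ R} (hf : IsProjResolution f)
    (hR : IsBoundedComplex R) (hfin : ∀ n, Module.Finite B ((resGradedComplex hι R).homology n)) :
    QuasiIso (gradedNatMap hικ hι hκ h𝒞 P) ↔ QuasiIso (natMap hικ (forgetComplex P)) := by
  obtain ⟨a, -, _, -⟩ := hR
  obtain ⟨_, hP, b, _⟩ := hf
  let f' : resGradedComplex hι P ⟶ resGradedComplex hι R :=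
    ((GrMod.restrict ι hι).mapHomologicalComplex _).map f
  have hf' : QuasiIso f' := GrMod.quasiIso_of_forgetMap f'
    ((HomologicalComplex.quasiIso_map_iff_of_preservesHomology _
      (forget₂ (ModuleCat.{u} B) AddCommGrpCat.{u})).1 (inferInstanceAs (QuasiIso
        (((forget₂ (ModuleCat.{u} E) AddCommGrpCat.{u}).mapHomologicalComplex _).map
          (forgetMap f)))))
  have hP' (i : ℤ) : Projective ((resGradedComplex hι P).X i) := by
    have := hP i
    have := GrMod.module_projective_of_projective (P.X i)
    exact (GrMod.projective_iff _).2
      (module_projective_restrictScalars ι.toRingHom hE (ModuleCat.of E (P.X i)))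
  refine quasiIso_gradedNatMap_iff hικ hι hκ h𝒞 P (quasiIso_gradedHomInclusion
    (toLexAddEquiv_injective r) ((isWF_image_toLex r).mono (Set.image_mono
      fun g hg => not_imp_comm.1 (hℬ g) hg)) hP' b f' a
    fun n => (finite_homology_forgetComplex_iff _ n).2 (hfin n))

end OneSide

variable {k : Type v} [Field k] {A : Type u} [Ring A] [Algebra k A]
  [IsNoetherianRing A] [IsNoetherianRing Aᵐᵒᵖ] {r : ℕ}

omit [IsNoetherianRing A] [IsNoetherianRing Aᵐᵒᵖ] in
theorem IsConnectedGraded.opGrading_eq_bot {𝒜 : (Fin r → ℤ) → Submodule k A}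
    (hA : IsConnectedGraded 𝒜) (g : Fin r → ℤ) (hg : ¬ 0 ≤ g) : opGrading 𝒜 g = ⊥ := by
  rw [opGrading, hA.eq_bot g hg, Submodule.map_bot]

theorem IsProjResolution.forgetComplex {G : Type} [DecidableEq G] [AddCommGroup G]
    {B : Type u} [Ring B] [Algebra k B] {ℬ : G → Submodule k B} [GradedAlgebra ℬ]
    {P R : CochainComplex (GrMod ℬ) ℤ} {f : P ⟶ R}
    (hf : IsProjResolution f) : IsProjResolution (forgetMap f) := by
  obtain ⟨_, hP, b, _⟩ := hf
  exact ⟨inferInstance, fun i => by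
    have := hP i
    exact inferInstanceAs (Projective ((GrMod.forget ℬ).obj (P.X i))), b, inferInstance⟩

variable {𝒜 : (Fin r → ℤ) → Submodule k A} [GradedAlgebra 𝒜]

theorem IsGradedDualizingComplex.forgetComplex (hA : IsConnectedGraded 𝒜)
    {R : CochainComplex (GrMod (envGrading 𝒜)) ℤ} (hR : IsGradedDualizingComplex 𝒜 R) :
    IsDualizingComplex k A (forgetComplex R) where
  bounded := by
    obtain ⟨a, b, _, _⟩ := hR.bounded
    exact ⟨a, b, inferInstance, inferInstance⟩
  finite_left n :=
    (finite_homology_forgetComplex_iff (gradedLeftComplex 𝒜 R) n).2 (hR.finite_left n)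
  finite_right n :=
    (finite_homology_forgetComplex_iff (gradedRightComplex 𝒜 R) n).2 (hR.finite_right n)
  injDim_left := by
    obtain ⟨a, b, _, _⟩ := hR.bounded
    obtain ⟨n, hn⟩ := hR.injDim_left
    exact ⟨n, (hasInjDimLE_forgetComplex_iff hA.eq_bot ⟨a, b, inferInstance, inferInstance⟩
      hR.finite_left n).2 hn⟩
  injDim_right := by
    obtain ⟨a, b, _, _⟩ := hR.bounded
    obtain ⟨n, hn⟩ := hR.injDim_right
    exact ⟨n, (hasInjDimLE_forgetComplex_iff hA.opGrading_eq_bot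
      ⟨a, b, inferInstance, inferInstance⟩ hR.finite_right n).2 hn⟩
  nat_left := by
    obtain ⟨P, f, hf, h⟩ := hR.nat_left
    exact ⟨_, forgetMap f, hf.forgetComplex, (quasiIso_gradedNatMap_iff_of_isProjResolution _ _ _ _
      hA.eq_bot (free_restrictScalars_includeLeft k A) hf hR.bounded hR.finite_left).1 h⟩
  nat_right := by
    obtain ⟨P, f, hf, h⟩ := hR.nat_right
    exact ⟨_, forgetMap f, hf.forgetComplex, (quasiIso_gradedNatMap_iff_of_isProjResolution _ _ _ _
      hA.opGrading_eq_bot (free_restrictScalars_includeRight k A) hf hR.bounded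
      hR.finite_right).1 h⟩

omit [IsNoetherianRing Aᵐᵒᵖ] in
theorem IsGradedDualizingComplex.injDim_forgetComplex (hA : IsConnectedGraded 𝒜)
    {R : CochainComplex (GrMod (envGrading 𝒜)) ℤ} (hR : IsGradedDualizingComplex 𝒜 R) :
    injDim (leftComplex k A (_root_.forgetComplex R)) = injDim (gradedLeftComplex 𝒜 R) := by
  obtain ⟨a, b, _, _⟩ := hR.bounded
  have h (n : ℤ) : HasInjDimLE (leftComplex k A (_root_.forgetComplex R)) n ↔
      HasInjDimLE (gradedLeftComplex 𝒜 R) n :=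
    hasInjDimLE_forgetComplex_iff hA.eq_bot ⟨a, b, inferInstance, inferInstance⟩ hR.finite_left n
  simp only [injDim, h]

variable {s : ℕ} (φ : (Fin r → ℤ) →+ (Fin s → ℤ))

omit [IsNoetherianRing A] [IsNoetherianRing Aᵐᵒᵖ] in
theorem IsProjResolution.pushComplex {P R : CochainComplex (GrMod (envGrading 𝒜)) ℤ} {f : P ⟶ R}
    (hf : IsProjResolution f) :
    IsProjResolution (((GrMod.push φ (envGrading (pushGrading φ 𝒜))
    fun h => (envGrading_pushGrading φ h).le).mapHomologicalComplex _).map f) := by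
  obtain ⟨_, hP, b, _⟩ := hf
  refine ⟨GrMod.quasiIso_of_forgetMap _ (inferInstanceAs (QuasiIso (forgetMap f))), fun i => ?_,
    b, inferInstance⟩
  have := hP i
  have := GrMod.module_projective_of_projective (P.X i)
  exact (GrMod.projective_iff _).2 this

/-- The conditions for `φ_!(R)` follow from the ungraded ones for the common underlying complex. -/
theorem IsGradedDualizingComplex.pushComplex (hA : IsConnectedGraded 𝒜)
    (hA' : IsConnectedGraded (pushGrading φ 𝒜))
    {R : CochainComplex (GrMod (envGrading 𝒜)) ℤ} (hR : IsGradedDualizingComplex 𝒜 R) :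
    IsGradedDualizingComplex (pushGrading φ 𝒜) (pushComplex 𝒜 φ R) := by
  have hR' := hR.forgetComplex hA
  obtain ⟨a, b, _, _⟩ := hR.bounded
  have hb : IsBoundedComplex (_root_.pushComplex 𝒜 φ R) := ⟨a, b, inferInstance, inferInstance⟩
  have hfl (n : ℤ) := (finite_homology_forgetComplex_iff
    (gradedLeftComplex (pushGrading φ 𝒜) (_root_.pushComplex 𝒜 φ R)) n).1 (hR'.finite_left n)
  have hfr (n : ℤ) := (finite_homology_forgetComplex_iff
    (gradedRightComplex (pushGrading φ 𝒜) (_root_.pushComplex 𝒜 φ R)) n).1 (hR'.finite_right n)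
  refine ⟨hb, hfl, hfr, ?_, ?_, ?_, ?_⟩
  · obtain ⟨n, hn⟩ := hR'.injDim_left
    exact ⟨n, (hasInjDimLE_forgetComplex_iff hA'.eq_bot ⟨a, b, inferInstance, inferInstance⟩
      hfl n).1 hn⟩
  · obtain ⟨n, hn⟩ := hR'.injDim_right
    exact ⟨n, (hasInjDimLE_forgetComplex_iff hA'.opGrading_eq_bot
      ⟨a, b, inferInstance, inferInstance⟩ hfr n).1 hn⟩
  · obtain ⟨P, f, hf, h⟩ := hR.nat_left
    refine ⟨_, _, hf.pushComplex φ, (quasiIso_gradedNatMap_iff_of_isProjResolution _ _ _ _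
      hA'.eq_bot (free_restrictScalars_includeLeft k A) (hf.pushComplex φ) hb hfl).2 ?_⟩
    exact (quasiIso_gradedNatMap_iff_of_isProjResolution _ _ _ _
      hA.eq_bot (free_restrictScalars_includeLeft k A) hf hR.bounded hR.finite_left).1 h
  · obtain ⟨P, f, hf, h⟩ := hR.nat_right
    refine ⟨_, _, hf.pushComplex φ, (quasiIso_gradedNatMap_iff_of_isProjResolution _ _ _ _
      hA'.opGrading_eq_bot (free_restrictScalars_includeRight k A) (hf.pushComplex φ) hb hfr).2 ?_⟩
    exact (quasiIso_gradedNatMap_iff_of_isProjResolution _ _ _ _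
      hA.opGrading_eq_bot (free_restrictScalars_includeRight k A) hf hR.bounded
      hR.finite_right).1 h

theorem IsGradedDualizingComplex.injDim_pushComplex (hA : IsConnectedGraded 𝒜)
    (hA' : IsConnectedGraded (pushGrading φ 𝒜))
    {R : CochainComplex (GrMod (envGrading 𝒜)) ℤ} (hR : IsGradedDualizingComplex 𝒜 R) :
    injDim (gradedLeftComplex (pushGrading φ 𝒜) (_root_.pushComplex 𝒜 φ R)) =
      injDim (gradedLeftComplex 𝒜 R) :=
  ((hR.pushComplex φ hA hA').injDim_forgetComplex hA').symm.trans (hR.injDim_forgetComplex hA)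

end Connected

end

theorem mainTheorem2 {k : Type v} [Field k] {A : Type u} [Ring A] [Algebra k A]
    [IsNoetherianRing A] [IsNoetherianRing Aᵐᵒᵖ] {r : ℕ}
    (𝒜 : (Fin r → ℤ) → Submodule k A) [GradedAlgebra 𝒜] (hA : IsConnectedGraded 𝒜)
    (R : CochainComplex (GrMod (envGrading 𝒜)) ℤ) (hR : IsGradedDualizingComplex 𝒜 R) :
    (∀ (s : ℕ) (φ : (Fin r → ℤ) →+ (Fin s → ℤ)), IsConnectedGraded (pushGrading φ 𝒜) →
      IsGradedDualizingComplex (pushGrading φ 𝒜) (pushComplex 𝒜 φ R) ∧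
      injDim (gradedLeftComplex (pushGrading φ 𝒜) (pushComplex 𝒜 φ R)) =
        injDim (gradedLeftComplex 𝒜 R)) ∧
    IsDualizingComplex k A (forgetComplex R) ∧
    injDim (leftComplex k A (forgetComplex R)) ≤ injDim (gradedLeftComplex 𝒜 R) + 1 := by
  refine ⟨fun s φ hA' => ⟨hR.pushComplex φ hA hA', hR.injDim_pushComplex φ hA hA'⟩,
    hR.forgetComplex hA, ?_⟩
  rw [hR.injDim_forgetComplex hA]
  exact le_add_of_nonneg_right zero_le_one
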